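/- **Setting.** Let $\mathcal V$ be a right closed Gray monoid: a strict 2-category with an object $\mathbb 1$, strict 2-functors $A\otimes-$ and $-\otimes B$ that make $\otimes$ strictly associative and unital, and invertible interchangers $\Sigma_{f,g}\colon (f\otimes B')\circ(A\otimes g)\Rightarrow (A'\otimes g)\circ(f\otimes B)$ satisfying the Gray axioms; together with, for every object $A$, a pseudofunctor $[A,-]\colon\mathcal V\to\mathcal V$ and a pseudoadjunction $-\otimes A\dashv[A,-]$, i.e. pseudonatural transformations $\eta\colon \mathrm{id}\Rightarrow[A,-\otimes A]$, $\varepsilon\colon[A,-]\otimes A\Rightarrow\mathrm{id}$ and invertible modifications (triangulators) $s\colon \mathrm{id}\Rightarrow\varepsilon\circ(\eta\otimes 1)$, $t\colon[1,\varepsilon]\circ\eta\Rightarrow\mathrm{id}$ satisfying the two swallowtail equations. (A braiding on $\mathcal V$ may be present but is not needed; in particular the statement covers every right closed semi-strict braided monoidal bicategory.) A $\mathcal V$-bicategory $\mathcal C$ has objects, hom-objects $\mathcal C(c,d)\in\mathcal V$, 1-cells $m\colon\mathcal C(d,e)\otimes\mathcal C(c,d)\to\mathcal C(c,e)$ and $u\colon\mathbb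 1\to\mathcal C(c,c)$, and invertible 2-cells $\alpha\colon m\circ(m\otimes 1)\Rightarrow m\circ(1\otimes m)$, $\lambda\colon m\circ(u\otimes1)\Rightarrow\mathrm{id}$, $\rho\colon m\circ(1\otimes u)\Rightarrow\mathrm{id}$ satisfying the triangle and pentagon axioms. A $\mathcal V$-pseudofunctor $F\colon\mathcal C\to\mathcal D$ has an object map, 1-cells $F\colon\mathcal C(a,b)\to\mathcal D(Fa,Fb)$, and invertible 2-cells $m\circ(F\otimes F)\Rightarrow F\circ m$ (compositor) and $u\Rightarrow F\circ u$ (unitor), satisfying one associativity and two unitality axioms. The self-enrichment of $\mathcal V$ has the objects of $\mathcal V$, hom-objects $[a,b]$, composition $m=[1,\varepsilon]\circ[1,1\otimes\varepsilon]\circ\eta\colon[b,c]\otimes[a,b]\to[a,c]$, unit $u=\eta\colon\mathbb 1\to[a,\mathbb 1\otimes a]=[a,a]$, and $\alpha,\lambda,\rho$ built from the pseudonaturality of $\eta$ and $\varepsilon$, the interchangers, $s^{\pm1}$ and $t$; explicitly, $s^{-1}$ and pseudonaturality give canonical 2-cells $\varepsilon\circ(m\otimes1)\cong\varepsilon\circ(1\otimes\varepsilon)$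 and $\varepsilon\circ(u\otimes1)\cong\mathrm{id}$, and $\alpha$ compares both threefold composites with $[1,\varepsilon\circ(1\otimes\varepsilon)\circ(1\otimes1\otimes\varepsilon)]\circ\eta$, while $\lambda$ and $\rho$ compare the composites with $[1,\varepsilon]\circ\eta$ and then apply $t$. **Theorem.** The self-enrichment of $\mathcal V$ is a $\mathcal V$-bicategory, and for every $\mathcal V$-bicategory $\mathcal C$ and every object $a$ of $\mathcal C$ the assignment $b\mapsto\mathcal C(a,b)$ and the 1-cells $$F_{b,c}\colon\ \mathcal C(b,c)\xrightarrow{\ \eta\ }[\mathcal C(a,b),\mathcal C(b,c)\otimes\mathcal C(a,b)]\xrightarrow{[1,m]}[\mathcal C(a,b),\mathcal C(a,c)]$$ are part of a $\mathcal V$-pseudofunctor $\mathcal C(a,-)\colon\mathcal C\to\mathcal V$ whose compositor and unitor are the following 2-cells. The compositor is the composite $$m\circ(F\otimes F)\ \cong\ [1,\ \varepsilon\circ(1\otimes\varepsilon)\circ((F\otimes F)\otimes 1)]\circ\eta\ \cong\ [1,\ m\circ(1\otimes m)]\circ\eta\ \xrightarrow{[1,\alpha^{-1}]}\ [1,\ m\circ(m\otimes1)]\circ\eta\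 \cong\ F\circ m,$$ where the first and last isomorphisms are the pseudonaturality of $\eta$ and the second consists of two instances of $\varepsilon\circ(F\otimes1)\cong m$ (given by the pseudonaturality of $\varepsilon$ and $s^{-1}$) and an interchanger. The unitor is $$u=\eta\ \xrightarrow{[1,\lambda^{-1}]}\ [1,\ m\circ(u\otimes 1)]\circ\eta\ \cong\ F\circ u .$$ -/

import Mathlib

open CategoryTheory Bicategory

universe w v u u₁ u₂

/-! Conventions.  A 2-category is a Mathlib `Bicategory` with `Bicategory.Strict`; composition
`f ≫ g` is in diagrammatic order.  Identifications that hold strictly (of objects, of 1-cells) are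
made explicit by `eqToHom` / `eqToIso`, which are the transports of identities. -/

namespace GrayEnriched

/-- A Gray monoid, that is, a monoid for the Gray tensor product of 2-categories, written out in
elementary terms: a strictly associative and unital tensor product of objects, strict 2-functors
`A ⊗ -` (`lT`) and `- ⊗ B` (`rT`), and invertible interchangers `Σ_{f,g}` satisfying the usual
axioms.  Strict equality of cells whose boundaries are only propositionally equal is `HEq`. -/
class GrayMonoid (V : Type u) [Bicategory.{w, v} V] [Bicategory.Strict V] where
  tensorObj : V → V → V
  unitObj : V
  /-- `A ⊗ f` -/
  lT (A : V) {X Y : V} (f : X ⟶ Y) : tensorObj A X ⟶ tensorObj A Y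
  /-- `f ⊗ B` -/
  rT {X Y : V} (f : X ⟶ Y) (B : V) : tensorObj X B ⟶ tensorObj Y B
  /-- `A ⊗ φ` for a 2-cell `φ` -/
  lT₂ (A : V) {X Y : V} {f g : X ⟶ Y} (φ : f ⟶ g) : lT A f ⟶ lT A g
  /-- `φ ⊗ B` for a 2-cell `φ` -/
  rT₂ {X Y : V} {f g : X ⟶ Y} (φ : f ⟶ g) (B : V) : rT f B ⟶ rT g B
  -- `A ⊗ -` is a strict 2-functor
  lT_id (A X : V) : lT A (𝟙 X) = 𝟙 (tensorObj A X)
  lT_comp (A : V) {X Y Z : V} (f : X ⟶ Y) (g : Y ⟶ Z) : lT A (f ≫ g) = lT A f ≫ lT A g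
  lT₂_id (A : V) {X Y : V} (f : X ⟶ Y) : lT₂ A (𝟙 f) = 𝟙 (lT A f)
  lT₂_comp (A : V) {X Y : V} {f g h : X ⟶ Y} (φ : f ⟶ g) (ψ : g ⟶ h) :
    lT₂ A (φ ≫ ψ) = lT₂ A φ ≫ lT₂ A ψ
  lT₂_whiskerLeft (A : V) {X Y Z : V} (f : X ⟶ Y) {g g' : Y ⟶ Z} (ψ : g ⟶ g') :
    lT₂ A (f ◁ ψ) = eqToHom (lT_comp A f g) ≫ lT A f ◁ lT₂ A ψ ≫ eqToHom (lT_comp A f g').symm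
  lT₂_whiskerRight (A : V) {X Y Z : V} {f f' : X ⟶ Y} (φ : f ⟶ f') (g : Y ⟶ Z) :
    lT₂ A (φ ▷ g) = eqToHom (lT_comp A f g) ≫ lT₂ A φ ▷ lT A g ≫ eqToHom (lT_comp A f' g).symm
  -- `- ⊗ B` is a strict 2-functor
  rT_id (X B : V) : rT (𝟙 X) B = 𝟙 (tensorObj X B)
  rT_comp {X Y Z : V} (f : X ⟶ Y) (g : Y ⟶ Z) (B : V) : rT (f ≫ g) B = rT f B ≫ rT g B
  rT₂_id {X Y : V} (f : X ⟶ Y) (B : V) : rT₂ (𝟙 f) B = 𝟙 (rT f B)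
  rT₂_comp {X Y : V} {f g h : X ⟶ Y} (φ : f ⟶ g) (ψ : g ⟶ h) (B : V) :
    rT₂ (φ ≫ ψ) B = rT₂ φ B ≫ rT₂ ψ B
  rT₂_whiskerLeft {X Y Z : V} (f : X ⟶ Y) {g g' : Y ⟶ Z} (ψ : g ⟶ g') (B : V) :
    rT₂ (f ◁ ψ) B = eqToHom (rT_comp f g B) ≫ rT f B ◁ rT₂ ψ B ≫ eqToHom (rT_comp f g' B).symm
  rT₂_whiskerRight {X Y Z : V} {f f' : X ⟶ Y} (φ : f ⟶ f') (g : Y ⟶ Z) (B : V) :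
    rT₂ (φ ▷ g) B = eqToHom (rT_comp f g B) ≫ rT₂ φ B ▷ rT g B ≫ eqToHom (rT_comp f' g B).symm
  -- strict unitality
  unit_tensor (A : V) : tensorObj unitObj A = A
  tensor_unit (A : V) : tensorObj A unitObj = A
  unit_lT {X Y : V} (f : X ⟶ Y) : HEq (lT unitObj f) f
  rT_unit {X Y : V} (f : X ⟶ Y) : HEq (rT f unitObj) f
  unit_lT₂ {X Y : V} {f g : X ⟶ Y} (φ : f ⟶ g) : HEq (lT₂ unitObj φ) φ
  rT₂_unit {X Y : V} {f g : X ⟶ Y} (φ : f ⟶ g) : HEq (rT₂ φ unitObj) φ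
  -- strict associativity
  tensor_assoc (A B C : V) : tensorObj (tensorObj A B) C = tensorObj A (tensorObj B C)
  rT_rT {X Y : V} (f : X ⟶ Y) (B C : V) : HEq (rT (rT f B) C) (rT f (tensorObj B C))
  lT_rT (A : V) {X Y : V} (f : X ⟶ Y) (C : V) : HEq (rT (lT A f) C) (lT A (rT f C))
  lT_lT (A B : V) {X Y : V} (f : X ⟶ Y) : HEq (lT (tensorObj A B) f) (lT A (lT B f))
  rT₂_rT₂ {X Y : V} {f g : X ⟶ Y} (φ : f ⟶ g) (B C : V) :
    HEq (rT₂ (rT₂ φ B) C) (rT₂ φ (tensorObj B C))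
  lT₂_rT₂ (A : V) {X Y : V} {f g : X ⟶ Y} (φ : f ⟶ g) (C : V) :
    HEq (rT₂ (lT₂ A φ) C) (lT₂ A (rT₂ φ C))
  lT₂_lT₂ (A B : V) {X Y : V} {f g : X ⟶ Y} (φ : f ⟶ g) :
    HEq (lT₂ (tensorObj A B) φ) (lT₂ A (lT₂ B φ))
  /-- the interchanger `Σ_{f,g} : (f ⊗ B') ∘ (A ⊗ g) ⇒ (A' ⊗ g) ∘ (f ⊗ B)` -/
  inter {A A' B B' : V} (f : A ⟶ A') (g : B ⟶ B') : lT A g ≫ rT f B' ≅ rT f B ≫ lT A' g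
  -- identities
  inter_id_left (A : V) {B B' : V} (g : B ⟶ B') :
    (inter (𝟙 A) g).hom = eqToHom (by
      rw [rT_id, rT_id, Bicategory.Strict.comp_id, Bicategory.Strict.id_comp])
  inter_id_right {A A' : V} (f : A ⟶ A') (B : V) :
    (inter f (𝟙 B)).hom = eqToHom (by
      rw [lT_id, lT_id, Bicategory.Strict.comp_id, Bicategory.Strict.id_comp])
  -- naturality in 2-cells
  inter_naturality_left {A A' B B' : V} {f f' : A ⟶ A'} (φ : f ⟶ f') (g : B ⟶ B') :
    lT A g ◁ rT₂ φ B' ≫ (inter f' g).hom = (inter f g).hom ≫ rT₂ φ B ▷ lT A' g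
  inter_naturality_right {A A' B B' : V} (f : A ⟶ A') {g g' : B ⟶ B'} (ψ : g ⟶ g') :
    lT₂ A ψ ▷ rT f B' ≫ (inter f g').hom = (inter f g).hom ≫ rT f B ◁ lT₂ A' ψ
  -- compatibility with composition of 1-cells
  inter_comp_left {A A' A'' B B' : V} (f : A ⟶ A') (f' : A' ⟶ A'') (g : B ⟶ B') :
    (inter (f ≫ f') g).hom =
      eqToHom (by rw [rT_comp, Bicategory.Strict.assoc]) ≫ (inter f g).hom ▷ rT f' B' ≫
        (α_ _ _ _).hom ≫ rT f B ◁ (inter f' g).hom ≫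
          eqToHom (by rw [rT_comp, Bicategory.Strict.assoc])
  inter_comp_right {A A' B B' B'' : V} (f : A ⟶ A') (g : B ⟶ B') (g' : B' ⟶ B'') :
    (inter f (g ≫ g')).hom =
      eqToHom (by rw [lT_comp, Bicategory.Strict.assoc]) ≫ lT A g ◁ (inter f g').hom ≫
        (α_ _ _ _).inv ≫ (inter f g).hom ▷ lT A' g' ≫
          eqToHom (by rw [lT_comp, Bicategory.Strict.assoc])
  -- compatibility with the tensor product
  lT₂_inter (C : V) {A A' B B' : V} (f : A ⟶ A') (g : B ⟶ B') :
    HEq (lT₂ C (inter f g).hom) (inter (lT C f) g).hom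
  inter_rT (C : V) {A A' B B' : V} (f : A ⟶ A') (g : B ⟶ B') :
    HEq (inter (rT f C) g).hom (inter f (lT C g)).hom
  rT₂_inter {A A' B B' : V} (f : A ⟶ A') (g : B ⟶ B') (C : V) :
    HEq (rT₂ (inter f g).hom C) (inter f (rT g C)).hom

infixr:87 " ⊠ " => GrayMonoid.tensorObj
infixr:85 " ◃ " => GrayMonoid.lT
infixl:85 " ▹ " => GrayMonoid.rT
infixr:85 " ◃₂ " => GrayMonoid.lT₂
infixl:85 " ▹₂ " => GrayMonoid.rT₂

theorem slide_of_heq {V : Type u} [Bicategory.{w, v} V] [Bicategory.Strict V]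
    {X X' Y Y' : V} (hX : X = X') (hY : Y = Y') {f : X ⟶ Y} {g : X' ⟶ Y'}
    (h : HEq f g) : f ≫ eqToHom hY = eqToHom hX ≫ g := by
  subst hX hY
  obtain rfl := eq_of_heq h
  simp

section Gray

variable {V : Type u} [Bicategory.{w, v} V] [Bicategory.Strict V] [GrayMonoid V]

open GrayMonoid

variable (V) in
/-- The monoidal unit. -/
abbrev I : V := unitObj

/-- The equality `(A ⊗ B) ⊗ C = A ⊗ (B ⊗ C)` as a 1-cell. -/
def asr (A B C : V) : (A ⊠ B) ⊠ C ⟶ A ⊠ B ⊠ C := eqToHom (tensor_assoc A B C)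

/-- The equality `I ⊗ A = A` as a 1-cell. -/
def lun (A : V) : I V ⊠ A ⟶ A := eqToHom (unit_tensor A)

/-- The equality `A ⊗ I = A` as a 1-cell. -/
def run (A : V) : A ⊠ I V ⟶ A := eqToHom (tensor_unit A)

theorem rT_asr {X Y : V} (f : X ⟶ Y) (B C : V) :
    f ▹ B ▹ C ≫ asr Y B C = asr X B C ≫ f ▹ (B ⊠ C) :=
  slide_of_heq _ _ (rT_rT f B C)

theorem mT_asr (A : V) {X Y : V} (f : X ⟶ Y) (C : V) :
    (A ◃ f) ▹ C ≫ asr A Y C = asr A X C ≫ A ◃ (f ▹ C) :=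
  slide_of_heq _ _ (lT_rT A f C)

theorem lT_asr (A B : V) {X Y : V} (f : X ⟶ Y) :
    (A ⊠ B) ◃ f ≫ asr A B Y = asr A B X ≫ A ◃ B ◃ f :=
  slide_of_heq _ _ (lT_lT A B f)

theorem lT_lun {X Y : V} (f : X ⟶ Y) : I V ◃ f ≫ lun Y = lun X ≫ f :=
  slide_of_heq _ _ (unit_lT f)

theorem rT_run {X Y : V} (f : X ⟶ Y) : f ▹ I V ≫ run Y = run X ≫ f :=
  slide_of_heq _ _ (rT_unit f)

theorem rT_asr' {X Y Z : V} (f : X ⟶ Y) (B C : V) (k : Y ⊠ B ⊠ C ⟶ Z) :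
    f ▹ B ▹ C ≫ asr Y B C ≫ k = asr X B C ≫ f ▹ (B ⊠ C) ≫ k := by
  rw [← Strict.assoc, rT_asr, Strict.assoc]

theorem mT_asr' (A : V) {X Y Z : V} (f : X ⟶ Y) (C : V) (k : A ⊠ Y ⊠ C ⟶ Z) :
    (A ◃ f) ▹ C ≫ asr A Y C ≫ k = asr A X C ≫ A ◃ (f ▹ C) ≫ k := by
  rw [← Strict.assoc, mT_asr, Strict.assoc]

theorem lT_asr' (A B : V) {X Y Z : V} (f : X ⟶ Y) (k : A ⊠ B ⊠ Y ⟶ Z) :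
    (A ⊠ B) ◃ f ≫ asr A B Y ≫ k = asr A B X ≫ A ◃ B ◃ f ≫ k := by
  rw [← Strict.assoc, lT_asr, Strict.assoc]

theorem lT_lun' {X Y Z : V} (f : X ⟶ Y) (k : Y ⟶ Z) :
    I V ◃ f ≫ lun Y ≫ k = lun X ≫ f ≫ k := by
  rw [← Strict.assoc, lT_lun, Strict.assoc]

theorem rT_run' {X Y Z : V} (f : X ⟶ Y) (k : Y ⟶ Z) :
    f ▹ I V ≫ run Y ≫ k = run X ≫ f ≫ k := by
  rw [← Strict.assoc, rT_run, Strict.assoc]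

theorem lT_eqToHom (A : V) {X Y : V} (h : X = Y) :
    A ◃ eqToHom h = eqToHom (congrArg (A ⊠ ·) h) := by
  subst h; simp [lT_id]

theorem eqToHom_rT {X Y : V} (h : X = Y) (B : V) :
    eqToHom h ▹ B = eqToHom (congrArg (· ⊠ B) h) := by
  subst h; simp [rT_id]

theorem asr_lun (A B : V) : asr A (I V) B ≫ A ◃ lun B = run A ▹ B := by
  simp [asr, lun, run, lT_eqToHom, eqToHom_rT]

theorem asr_lun_tensor (A B : V) : asr (I V) A B ≫ lun (A ⊠ B) = lun A ▹ B := by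
  simp [asr, lun, eqToHom_rT]

theorem asr_run_tensor (A B : V) : asr A B (I V) ≫ A ◃ run B = run (A ⊠ B) := by
  simp [asr, run, lT_eqToHom]

theorem asr_pentagon (A B C D : V) :
    asr A B C ▹ D ≫ asr A (B ⊠ C) D ≫ A ◃ asr B C D =
      asr (A ⊠ B) C D ≫ asr A B (C ⊠ D) := by
  simp [asr, lT_eqToHom, eqToHom_rT]

theorem asr_pentagon' (A B C D : V) {Z : V} (k : A ⊠ B ⊠ C ⊠ D ⟶ Z) :
    asr A B C ▹ D ≫ asr A (B ⊠ C) D ≫ A ◃ asr B C D ≫ k =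
      asr (A ⊠ B) C D ≫ asr A B (C ⊠ D) ≫ k := by
  have h := congrArg (· ≫ k) (asr_pentagon A B C D)
  simpa only [Strict.assoc] using h

/-- `A ⊗ φ` for an invertible 2-cell `φ`. -/
@[simps]
def lTIso (A : V) {X Y : V} {f g : X ⟶ Y} (φ : f ≅ g) : A ◃ f ≅ A ◃ g where
  hom := A ◃₂ φ.hom
  inv := A ◃₂ φ.inv
  hom_inv_id := by rw [← lT₂_comp, φ.hom_inv_id, lT₂_id]
  inv_hom_id := by rw [← lT₂_comp, φ.inv_hom_id, lT₂_id]

/-- `φ ⊗ B` for an invertible 2-cell `φ`. -/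
@[simps]
def rTIso {X Y : V} {f g : X ⟶ Y} (φ : f ≅ g) (B : V) : f ▹ B ≅ g ▹ B where
  hom := φ.hom ▹₂ B
  inv := φ.inv ▹₂ B
  hom_inv_id := by rw [← rT₂_comp, φ.hom_inv_id, rT₂_id]
  inv_hom_id := by rw [← rT₂_comp, φ.inv_hom_id, rT₂_id]

theorem eqToHom_rT₂ {X Y : V} {f g : X ⟶ Y} (h : f = g) (B : V) :
    eqToHom h ▹₂ B = eqToHom (congrArg (· ▹ B) h) := by
  subst h; simp [rT₂_id]

/-- The strict 2-functor `- ⊗ A`, as a pseudofunctor. -/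
@[simps]
def tensorRight (A : V) : V ⥤ᵖ V where
  obj X := X ⊠ A
  map f := f ▹ A
  map₂ φ := φ ▹₂ A
  map₂_id f := rT₂_id f A
  map₂_comp φ ψ := rT₂_comp φ ψ A
  mapId X := eqToIso (rT_id X A)
  mapComp f g := eqToIso (rT_comp f g A)
  map₂_whisker_left f _ _ φ := by simpa using rT₂_whiskerLeft f φ A
  map₂_whisker_right φ f := by simpa using rT₂_whiskerRight φ f A
  map₂_associator f g h := by
    simp [Strict.associator_eqToIso, eqToHom_rT₂]
  map₂_left_unitor f := by
    simp [Strict.leftUnitor_eqToIso, eqToHom_rT₂]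
  map₂_right_unitor f := by
    simp [Strict.rightUnitor_eqToIso, eqToHom_rT₂]

end Gray

section Adj

variable {B : Type*} [Bicategory B] {C : Type*} [Bicategory C]

/-- A pseudoadjunction `F ⊣ G` between bicategories: pseudonatural transformations
`η : id ⇒ GF` and `ε : FG ⇒ id`, and invertible modifications `s : id_F ⇛ εF ∘ Fη` and
`t : Gε ∘ ηG ⇛ id_G` satisfying the two swallowtail equations. -/
structure Pseudoadjunction (F : B ⥤ᵖ C) (G : C ⥤ᵖ B) where
  unit : Pseudofunctor.StrongTrans (Pseudofunctor.id B) (F.comp G)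
  counit : Pseudofunctor.StrongTrans (G.comp F) (Pseudofunctor.id C)
  s (X : B) : 𝟙 (F.obj X) ≅ F.map (unit.app X) ≫ counit.app (F.obj X)
  t (Y : C) : unit.app (G.obj Y) ≫ G.map (counit.app Y) ≅ 𝟙 (G.obj Y)
  /-- `s` is a modification -/
  s_naturality {X Y : B} (f : X ⟶ Y) :
    F.map f ◁ (s Y).hom ≫ (α_ _ _ _).inv ≫
        (F.mapComp f (unit.app Y)).inv ▷ counit.app (F.obj Y) ≫
        F.map₂ (unit.naturality f).hom ▷ counit.app (F.obj Y) ≫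
        (F.mapComp (unit.app X) (G.map (F.map f))).hom ▷ counit.app (F.obj Y) ≫
        (α_ _ _ _).hom ≫
        F.map (unit.app X) ◁ (counit.naturality (F.map f)).hom ≫ (α_ _ _ _).inv =
      (ρ_ (F.map f)).hom ≫ (λ_ (F.map f)).inv ≫ (s X).hom ▷ F.map f
  /-- `t` is a modification -/
  t_naturality {X Y : C} (g : X ⟶ Y) :
    (α_ _ _ _).inv ≫ (unit.naturality (G.map g)).hom ▷ G.map (counit.app Y) ≫
        (α_ _ _ _).hom ≫
        unit.app (G.obj X) ◁ (G.mapComp (F.map (G.map g)) (counit.app Y)).inv ≫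
        unit.app (G.obj X) ◁ G.map₂ (counit.naturality g).hom ≫
        unit.app (G.obj X) ◁ (G.mapComp (counit.app X) g).hom ≫
        (α_ _ _ _).inv ≫ (t X).hom ▷ G.map g =
      G.map g ◁ (t Y).hom ≫ (ρ_ (G.map g)).hom ≫ (λ_ (G.map g)).inv
  swallowtail_unit (X : B) :
    (ρ_ (unit.app X)).inv ≫ unit.app X ◁ (G.mapId (F.obj X)).inv ≫
        unit.app X ◁ G.map₂ (s X).hom ≫
        unit.app X ◁ (G.mapComp (F.map (unit.app X)) (counit.app (F.obj X))).hom ≫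
        (α_ _ _ _).inv ≫ (unit.naturality (unit.app X)).inv ▷ G.map (counit.app (F.obj X)) ≫
        (α_ _ _ _).hom ≫ unit.app X ◁ (t (F.obj X)).hom ≫ (ρ_ (unit.app X)).hom =
      𝟙 (unit.app X)
  swallowtail_counit (Y : C) :
    (λ_ (counit.app Y)).inv ≫ (s (G.obj Y)).hom ▷ counit.app Y ≫ (α_ _ _ _).hom ≫
        F.map (unit.app (G.obj Y)) ◁ (counit.naturality (counit.app Y)).inv ≫
        (α_ _ _ _).inv ≫
        (F.mapComp (unit.app (G.obj Y)) (G.map (counit.app Y))).inv ▷ counit.app Y ≫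
        F.map₂ (t Y).hom ▷ counit.app Y ≫ (F.mapId (G.obj Y)).hom ▷ counit.app Y ≫
        (λ_ (counit.app Y)).hom =
      𝟙 (counit.app Y)

/-- A pseudofunctor applied to an equality of objects. -/
def mapEqToHomIso (F : B ⥤ᵖ C) {X Y : B} (h : X = Y) :
    F.map (eqToHom h) ≅ eqToHom (congrArg F.obj h) := by
  subst h
  exact F.mapId X

end Adj

section Enriched

open GrayMonoid

variable (V : Type u) [Bicategory.{w, v} V] [Bicategory.Strict V] [GrayMonoid V]

/-- The data of a `V`-bicategory: objects, hom-objects, composition `m`, units `u`, and invertible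
2-cells `α`, `λ`, `ρ`. -/
structure EnrichedBicategoryData where
  Obj : Type u₁
  hom : Obj → Obj → V
  m (c d e : Obj) : hom d e ⊠ hom c d ⟶ hom c e
  u (c : Obj) : I V ⟶ hom c c
  assoc (c d e f : Obj) :
    m d e f ▹ hom c d ≫ m c d f ≅ asr (hom e f) (hom d e) (hom c d) ≫ hom e f ◃ m c d e ≫ m c e f
  lam (c d : Obj) : u d ▹ hom c d ≫ m c d d ≅ lun (hom c d)
  rho (c d : Obj) : hom c d ◃ u c ≫ m c c d ≅ run (hom c d)

variable {V}

/-- The two coherence axioms of a `V`-bicategory. -/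
structure EnrichedBicategoryData.IsCoherent (C : EnrichedBicategoryData.{w, v, u, u₁} V) :
    Prop where
  /-- identity coherence (triangle) -/
  identity (c d e : C.Obj) :
    ((C.hom d e ◃ C.u d) ▹ C.hom c d ◁ (C.assoc c d d e).hom ≫
        eqToHom (by simp only [mT_asr', lT_comp, Strict.assoc]) ≫
        asr (C.hom d e) (I V) (C.hom c d) ◁ (C.hom d e ◃₂ (C.lam c d).hom) ▷ C.m c d e ≫
        eqToHom (by rw [← asr_lun, Strict.assoc]) :
      (C.hom d e ◃ C.u d) ▹ C.hom c d ≫ C.m d d e ▹ C.hom c d ≫ C.m c d e ⟶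
        run (C.hom d e) ▹ C.hom c d ≫ C.m c d e) =
      eqToHom (by rw [rT_comp, Strict.assoc]) ≫ ((C.rho d e).hom ▹₂ C.hom c d) ▷ C.m c d e
  /-- associativity coherence (pentagon) -/
  associativity (c d e f g : C.Obj) :
    (eqToHom (by rw [rT_comp, Strict.assoc]) ≫
        ((C.assoc d e f g).hom ▹₂ C.hom c d) ▷ C.m c d g ≫
        eqToHom (by simp only [rT_comp, Strict.assoc]) ≫
        (asr (C.hom f g) (C.hom e f) (C.hom d e) ▹ C.hom c d ≫
          (C.hom f g ◃ C.m d e f) ▹ C.hom c d) ◁ (C.assoc c d f g).hom ≫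
        eqToHom (by simp only [mT_asr', lT_comp, Strict.assoc]) ≫
        (asr (C.hom f g) (C.hom e f) (C.hom d e) ▹ C.hom c d ≫
          asr (C.hom f g) (C.hom e f ⊠ C.hom d e) (C.hom c d)) ◁
            (C.hom f g ◃₂ (C.assoc c d e f).hom) ▷ C.m c f g ≫
        eqToHom (by simp only [lT_comp, Strict.assoc, asr_pentagon']) :
      C.m e f g ▹ C.hom d e ▹ C.hom c d ≫ C.m d e g ▹ C.hom c d ≫ C.m c d g ⟶
        asr (C.hom f g ⊠ C.hom e f) (C.hom d e) (C.hom c d) ≫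
          asr (C.hom f g) (C.hom e f) (C.hom d e ⊠ C.hom c d) ≫
            C.hom f g ◃ C.hom e f ◃ C.m c d e ≫ C.hom f g ◃ C.m c e f ≫ C.m c f g) =
      C.m e f g ▹ C.hom d e ▹ C.hom c d ◁ (C.assoc c d e g).hom ≫
        eqToHom (by simp only [rT_asr', Strict.assoc]) ≫
        asr (C.hom f g ⊠ C.hom e f) (C.hom d e) (C.hom c d) ◁
          (inter (C.m e f g) (C.m c d e)).inv ▷ C.m c e g ≫
        eqToHom (by simp only [Strict.assoc]) ≫
        (asr (C.hom f g ⊠ C.hom e f) (C.hom d e) (C.hom c d) ≫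
          (C.hom f g ⊠ C.hom e f) ◃ C.m c d e) ◁ (C.assoc c e f g).hom ≫
        eqToHom (by simp only [lT_asr', Strict.assoc])

variable (V) in
/-- A `V`-bicategory. -/
structure EnrichedBicategory extends EnrichedBicategoryData.{w, v, u, u₁} V where
  coherent : toEnrichedBicategoryData.IsCoherent

/-- The tensor product `f ⊗ g := (B ⊗ g) ∘ (f ⊗ A')` of two 1-cells; the other order is isomorphic
to it by the interchanger. -/
abbrev tens {A B A' B' : V} (f : A ⟶ B) (g : A' ⟶ B') : A ⊠ A' ⟶ B ⊠ B' :=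
  f ▹ A' ≫ B ◃ g

/-- The data of a `V`-pseudofunctor: action on objects and hom-objects, compositor, unitor. -/
structure EnrichedPseudofunctorData (C : EnrichedBicategoryData.{w, v, u, u₁} V)
    (D : EnrichedBicategoryData.{w, v, u, u₂} V) where
  obj : C.Obj → D.Obj
  map (a b : C.Obj) : C.hom a b ⟶ D.hom (obj a) (obj b)
  mapComp (a b c : C.Obj) :
    tens (map b c) (map a b) ≫ D.m (obj a) (obj b) (obj c) ≅ C.m a b c ≫ map a c
  mapUnit (a : C.Obj) : D.u (obj a) ≅ C.u a ≫ map a a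

/-- A `V`-pseudofunctor between `V`-bicategories. -/
structure EnrichedPseudofunctor (C : EnrichedBicategory.{w, v, u, u₁} V)
    (D : EnrichedBicategory.{w, v, u, u₂} V) extends
    EnrichedPseudofunctorData C.toEnrichedBicategoryData D.toEnrichedBicategoryData where
  /-- compatibility with the associators -/
  map_assoc (a b c d : C.Obj) :
    (tens (map c d) (map b c) ▹ C.hom a b ≫
          (D.hom (obj c) (obj d) ⊠ D.hom (obj b) (obj c)) ◃ map a b) ◁
          (D.assoc (obj a) (obj b) (obj c) (obj d)).hom ≫
        eqToHom (by simp only [rT_comp, lT_comp, lT_asr', mT_asr', rT_asr', Strict.assoc]) ≫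
        (asr (C.hom c d) (C.hom b c) (C.hom a b) ≫ map c d ▹ (C.hom b c ⊠ C.hom a b)) ◁
          (D.hom (obj c) (obj d) ◃₂ (mapComp a b c).hom) ▷ D.m (obj a) (obj c) (obj d) ≫
        eqToHom (by simp only [lT_comp, Strict.assoc]) ≫
        asr (C.hom c d) (C.hom b c) (C.hom a b) ◁ (inter (map c d) (C.m a b c)).inv ▷
          (D.hom (obj c) (obj d) ◃ map a c ≫ D.m (obj a) (obj c) (obj d)) ≫
        eqToHom (by simp only [Strict.assoc]) ≫
        (asr (C.hom c d) (C.hom b c) (C.hom a b) ≫ C.hom c d ◃ C.m a b c) ◁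
          (mapComp a c d).hom ≫
        eqToHom (by simp only [Strict.assoc]) =
      (eqToHom (by simp only [Strict.assoc]) ≫
        tens (map c d) (map b c) ▹ C.hom a b ◁
          (inter (D.m (obj b) (obj c) (obj d)) (map a b)).hom ▷
            D.m (obj a) (obj b) (obj d) ≫
        eqToHom (by simp only [rT_comp, Strict.assoc]) ≫
        ((mapComp b c d).hom ▹₂ C.hom a b) ▷
          (D.hom (obj b) (obj d) ◃ map a b ≫ D.m (obj a) (obj b) (obj d)) ≫
        eqToHom (by simp only [rT_comp, Strict.assoc]) ≫
        C.m b c d ▹ C.hom a b ◁ (mapComp a b d).hom ≫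
        eqToHom (by simp only [Strict.assoc]) ≫
        (C.assoc a b c d).hom ▷ map a d :
      (tens (map c d) (map b c) ▹ C.hom a b ≫
          (D.hom (obj c) (obj d) ⊠ D.hom (obj b) (obj c)) ◃ map a b) ≫
          D.m (obj b) (obj c) (obj d) ▹ D.hom (obj a) (obj b) ≫ D.m (obj a) (obj b) (obj d) ⟶
        (asr (C.hom c d) (C.hom b c) (C.hom a b) ≫ C.hom c d ◃ C.m a b c ≫ C.m a c d) ≫
          map a d)
  /-- compatibility with the left unitors -/
  map_lam (a b : C.Obj) :
    (I V ◃ map a b ◁ ((mapUnit b).hom ▹₂ D.hom (obj a) (obj b)) ▷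
          D.m (obj a) (obj b) (obj b) ≫
        eqToHom (by simp only [Strict.assoc]) ≫
        (inter (C.u b ≫ map b b) (map a b)).hom ▷ D.m (obj a) (obj b) (obj b) ≫
        eqToHom (by simp only [rT_comp, Strict.assoc]) ≫
        C.u b ▹ C.hom a b ◁ (mapComp a b b).hom ≫
        eqToHom (by simp only [Strict.assoc]) ≫
        (C.lam a b).hom ▷ map a b :
      I V ◃ map a b ≫ D.u (obj b) ▹ D.hom (obj a) (obj b) ≫ D.m (obj a) (obj b) (obj b) ⟶
        lun (C.hom a b) ≫ map a b) =
      I V ◃ map a b ◁ (D.lam (obj a) (obj b)).hom ≫ eqToHom (by simp only [lT_lun])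
  /-- compatibility with the right unitors -/
  map_rho (a b : C.Obj) :
    (map a b ▹ I V ◁ (D.hom (obj a) (obj b) ◃₂ (mapUnit a).hom) ▷
          D.m (obj a) (obj a) (obj b) ≫
        eqToHom (by simp only [lT_comp, Strict.assoc]) ≫
        (inter (map a b) (C.u a)).inv ▷
          (D.hom (obj a) (obj b) ◃ map a a ≫ D.m (obj a) (obj a) (obj b)) ≫
        eqToHom (by simp only [Strict.assoc]) ≫
        C.hom a b ◃ C.u a ◁ (mapComp a a b).hom ≫
        eqToHom (by simp only [Strict.assoc]) ≫
        (C.rho a b).hom ▷ map a b :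
      map a b ▹ I V ≫ D.hom (obj a) (obj b) ◃ D.u (obj a) ≫ D.m (obj a) (obj a) (obj b) ⟶
        run (C.hom a b) ≫ map a b) =
      map a b ▹ I V ◁ (D.rho (obj a) (obj b)).hom ≫ eqToHom (by simp only [rT_run])

end Enriched

section Closed

open GrayMonoid

/-- A right closed structure: for every `A`, a pseudofunctor `[A, -]` and a pseudoadjunction
`- ⊗ A ⊣ [A, -]`. -/
class RightClosed (V : Type u) [Bicategory.{w, v} V] [Bicategory.Strict V] [GrayMonoid V] where
  ihom (A : V) : V ⥤ᵖ V
  adj (A : V) : Pseudoadjunction (tensorRight A) (ihom A)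

variable {V : Type u} [Bicategory.{w, v} V] [Bicategory.Strict V] [GrayMonoid V] [RightClosed V]

/-- The internal hom `[A, B]`. -/
abbrev inn (A B : V) : V := (RightClosed.ihom A).obj B

/-- `[A, f]` -/
abbrev innMap (A : V) {X Y : V} (f : X ⟶ Y) : inn A X ⟶ inn A Y := (RightClosed.ihom A).map f

/-- `[A, φ]` for an invertible 2-cell `φ` -/
abbrev innMap₂ (A : V) {X Y : V} {f g : X ⟶ Y} (φ : f ≅ g) : innMap A f ≅ innMap A g :=
  (RightClosed.ihom A).map₂Iso φ

abbrev innMapComp (A : V) {X Y Z : V} (f : X ⟶ Y) (g : Y ⟶ Z) :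
    innMap A (f ≫ g) ≅ innMap A f ≫ innMap A g :=
  (RightClosed.ihom A).mapComp f g

/-- The unit `η`. -/
abbrev eta (A X : V) : X ⟶ inn A (X ⊠ A) := (RightClosed.adj A).unit.app X

/-- The counit `ε` (evaluation). -/
abbrev eps (A Y : V) : inn A Y ⊠ A ⟶ Y := (RightClosed.adj A).counit.app Y

/-- Pseudonaturality of the unit. -/
abbrev etaNat (A : V) {X Y : V} (f : X ⟶ Y) : f ≫ eta A Y ≅ eta A X ≫ innMap A (f ▹ A) :=
  (RightClosed.adj A).unit.naturality f

/-- Pseudonaturality of the counit. -/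
abbrev epsNat (A : V) {X Y : V} (f : X ⟶ Y) : innMap A f ▹ A ≫ eps A Y ≅ eps A X ≫ f :=
  (RightClosed.adj A).counit.naturality f

/-- The triangulator `s`. -/
abbrev triS (A X : V) : 𝟙 (X ⊠ A) ≅ eta A X ▹ A ≫ eps A (X ⊠ A) := (RightClosed.adj A).s X

/-- The triangulator `t`. -/
abbrev triT (A Y : V) : eta A (inn A Y) ≫ innMap A (eps A Y) ≅ 𝟙 (inn A Y) :=
  (RightClosed.adj A).t Y

/-- The 1-cell `[A, k] ∘ η`. -/
abbrev curry {A X Y : V} (k : X ⊠ A ⟶ Y) : X ⟶ inn A Y := eta A X ≫ innMap A k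

/-- The functor `[A, - ] ∘ η` on invertible 2-cells. -/
abbrev curryIso {A X Y : V} {k l : X ⊠ A ⟶ Y} (φ : k ≅ l) : curry k ≅ curry l :=
  whiskerLeftIso (eta A X) (innMap₂ A φ)

/-- The 2-cell `ε ∘ (([A, k] ∘ η) ⊗ A) ≅ k`, given by pseudonaturality of `ε` and `s⁻¹`. -/
def evCurry {A X Y : V} (k : X ⊠ A ⟶ Y) : curry k ▹ A ≫ eps A Y ≅ k :=
  eqToIso (by rw [rT_comp, Strict.assoc]) ≪≫
    whiskerLeftIso (eta A X ▹ A) (epsNat A k) ≪≫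
    eqToIso (by rw [Strict.assoc]) ≪≫
    whiskerRightIso (triS A X).symm k ≪≫
    eqToIso (Strict.id_comp k)

/-- The 2-cell `[A, k] ∘ η ∘ h ≅ [A, k ∘ (h ⊗ A)] ∘ η`, given by pseudonaturality of `η`. -/
def curryNat {A X Y Z : V} (h : Z ⟶ X) (k : X ⊠ A ⟶ Y) : h ≫ curry k ≅ curry (h ▹ A ≫ k) :=
  eqToIso (by rw [Strict.assoc]) ≪≫
    whiskerRightIso (etaNat A h) (innMap A k) ≪≫
    eqToIso (by rw [Strict.assoc]) ≪≫
    whiskerLeftIso (eta A Z) (innMapComp A (h ▹ A) k).symm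

/-- The composition `m = [1, ε] ∘ [1, 1 ε] ∘ η : [b, c] ⊗ [a, b] ⟶ [a, c]`. -/
def selfComp (a b c : V) : inn b c ⊠ inn a b ⟶ inn a c :=
  eta a (inn b c ⊠ inn a b) ≫ innMap a (asr (inn b c) (inn a b) a ≫ inn b c ◃ eps a b) ≫
    innMap a (eps b c)

/-- The unit `u = η : I ⟶ [a, I ⊗ a] = [a, a]`. -/
def selfUnit (a : V) : I V ⟶ inn a a :=
  eta a (I V) ≫ eqToHom (congrArg (inn a) (unit_tensor a))

def selfCompIso (a b c : V) :
    selfComp a b c ≅ curry (asr (inn b c) (inn a b) a ≫ inn b c ◃ eps a b ≫ eps b c) :=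
  whiskerLeftIso (eta a (inn b c ⊠ inn a b)) ((innMapComp a _ _).symm ≪≫
    innMap₂ a (eqToIso (by rw [Strict.assoc])))

def selfUnitIso (a : V) : selfUnit a ≅ curry (lun a) :=
  whiskerLeftIso (eta a (I V)) (mapEqToHomIso (RightClosed.ihom a) (unit_tensor a)).symm

/-- The 2-cell `ε ∘ (m ⊗ a) ≅ ε ∘ ([b, c] ⊗ ε)`. -/
def evComp (a b c : V) :
    selfComp a b c ▹ a ≫ eps a c ≅ asr (inn b c) (inn a b) a ≫ inn b c ◃ eps a b ≫ eps b c :=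
  whiskerRightIso (rTIso (selfCompIso a b c) a) (eps a c) ≪≫ evCurry _

/-- The 2-cell `ε ∘ (u ⊗ a) ≅ id`. -/
def evUnit (a : V) : selfUnit a ▹ a ≫ eps a a ≅ lun a :=
  whiskerRightIso (rTIso (selfUnitIso a) a) (eps a a) ≪≫ evCurry _

/-- The associator of the self-enrichment: both composites are compared, through `s⁻¹` and the
pseudonaturality of `η` and `ε`, with the transpose of the threefold evaluation. -/
def selfAssoc (a b c d : V) :
    selfComp b c d ▹ inn a b ≫ selfComp a b d ≅
      asr (inn c d) (inn b c) (inn a b) ≫ inn c d ◃ selfComp a b c ≫ selfComp a c d :=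
  (whiskerLeftIso (selfComp b c d ▹ inn a b) (selfCompIso a b d) ≪≫
    curryNat (selfComp b c d ▹ inn a b) _ ≪≫
    curryIso
      (eqToIso (by simp only [rT_asr', Strict.assoc]) ≪≫
        whiskerLeftIso (asr (inn c d ⊠ inn b c) (inn a b) a)
          (whiskerRightIso (inter (selfComp b c d) (eps a b)).symm (eps b d)) ≪≫
        eqToIso (by simp only [Strict.assoc]) ≪≫
        whiskerLeftIso (asr (inn c d ⊠ inn b c) (inn a b) a ≫ (inn c d ⊠ inn b c) ◃ eps a b)
          (evComp b c d) ≪≫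
        eqToIso (by simp only [lT_asr', Strict.assoc]))) ≪≫
  (eqToIso (by simp only [Strict.assoc]) ≪≫
    whiskerLeftIso (asr (inn c d) (inn b c) (inn a b) ≫ inn c d ◃ selfComp a b c)
      (selfCompIso a c d) ≪≫
    curryNat (asr (inn c d) (inn b c) (inn a b) ≫ inn c d ◃ selfComp a b c) _ ≪≫
    curryIso
      (eqToIso (by simp only [rT_comp, lT_comp, mT_asr', Strict.assoc]) ≪≫
        whiskerLeftIso (asr (inn c d) (inn b c) (inn a b) ▹ a ≫ asr (inn c d) (inn b c ⊠ inn a b) a)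
          (whiskerRightIso (lTIso (inn c d) (evComp a b c)) (eps c d)) ≪≫
        eqToIso (by simp only [lT_comp, Strict.assoc, asr_pentagon']) :
      _ ≅ asr (inn c d ⊠ inn b c) (inn a b) a ≫ asr (inn c d) (inn b c) (inn a b ⊠ a) ≫
        inn c d ◃ inn b c ◃ eps a b ≫ inn c d ◃ eps b c ≫ eps c d)).symm

/-- The 2-cell `[1, ε ∘ (h ⊗ 1)] ∘ η = [1, ε] ∘ η ∘ h ≅ h`, given by `t`, for `h` an equality. -/
def curryEps {X a b : V} (h : X = inn a b) : curry (eqToHom h ▹ a ≫ eps a b) ≅ eqToHom h :=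
  eqToIso (by subst h; simp [rT_id]) ≪≫
    whiskerLeftIso (eqToHom h) (triT a b) ≪≫
    eqToIso (Strict.comp_id _)

/-- The left unitor of the self-enrichment, built from `s⁻¹` and `t`. -/
def selfLam (a b : V) : selfUnit b ▹ inn a b ≫ selfComp a b b ≅ lun (inn a b) :=
  whiskerLeftIso (selfUnit b ▹ inn a b) (selfCompIso a b b) ≪≫
    curryNat (selfUnit b ▹ inn a b) _ ≪≫
    curryIso
      (eqToIso (by simp only [rT_asr', Strict.assoc]) ≪≫
        whiskerLeftIso (asr (I V) (inn a b) a)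
          (whiskerRightIso (inter (selfUnit b) (eps a b)).symm (eps b b)) ≪≫
        eqToIso (by simp only [Strict.assoc]) ≪≫
        whiskerLeftIso (asr (I V) (inn a b) a ≫ I V ◃ eps a b) (evUnit b) ≪≫
        eqToIso (by rw [Strict.assoc, lT_lun, ← Strict.assoc, asr_lun_tensor]; rfl)) ≪≫
    curryEps (unit_tensor (inn a b))

/-- The right unitor of the self-enrichment, built from `s⁻¹` and `t`. -/
def selfRho (a b : V) : inn a b ◃ selfUnit a ≫ selfComp a a b ≅ run (inn a b) :=
  whiskerLeftIso (inn a b ◃ selfUnit a) (selfCompIso a a b) ≪≫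
    curryNat (inn a b ◃ selfUnit a) _ ≪≫
    curryIso
      (eqToIso (by simp only [lT_comp, mT_asr', Strict.assoc]) ≪≫
        whiskerLeftIso (asr (inn a b) (I V) a)
          (whiskerRightIso (lTIso (inn a b) (evUnit a)) (eps a b)) ≪≫
        eqToIso (by rw [← Strict.assoc, asr_lun]; rfl)) ≪≫
    curryEps (tensor_unit (inn a b))

variable (V) in
/-- The data of the self-enrichment of a right closed Gray monoid. -/
def selfData : EnrichedBicategoryData.{w, v, u, u} V where
  Obj := V
  hom a b := inn a b
  m a b c := selfComp a b c
  u a := selfUnit a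
  assoc a b c d := selfAssoc a b c d
  lam a b := selfLam a b
  rho a b := selfRho a b

variable (C : EnrichedBicategoryData.{w, v, u, u₁} V)

/-- The 1-cell `[1, m] ∘ η : C(b, c) ⟶ [C(a, b), C(a, c)]`. -/
def homMap (a b c : C.Obj) : C.hom b c ⟶ inn (C.hom a b) (C.hom a c) :=
  eta (C.hom a b) (C.hom b c) ≫ innMap (C.hom a b) (C.m a b c)

/-- The 2-cell `ε ∘ (C(a, -) ⊗ 1) ≅ m`, built from the triangulator `s⁻¹`. -/
def evHom (a b c : C.Obj) :
    homMap C a b c ▹ C.hom a b ≫ eps (C.hom a b) (C.hom a c) ≅ C.m a b c :=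
  evCurry (C.m a b c)

/-- The compositor of `C(a, -)`, built from two instances of `s⁻¹` and `α⁻¹`. -/
def homComp (a b c d : C.Obj) :
    tens (homMap C a c d) (homMap C a b c) ≫ selfComp (C.hom a b) (C.hom a c) (C.hom a d) ≅
      C.m b c d ≫ homMap C a b d :=
  whiskerLeftIso (tens (homMap C a c d) (homMap C a b c)) (selfCompIso _ _ _) ≪≫
    curryNat (tens (homMap C a c d) (homMap C a b c)) _ ≪≫
    curryIso
      (eqToIso (by simp only [rT_comp, lT_comp, mT_asr', rT_asr', Strict.assoc]) ≪≫
        whiskerLeftIso (asr (C.hom c d) (C.hom b c) (C.hom a b) ≫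
            homMap C a c d ▹ (C.hom b c ⊠ C.hom a b))
          (whiskerRightIso (lTIso (inn (C.hom a c) (C.hom a d)) (evHom C a b c))
            (eps (C.hom a c) (C.hom a d))) ≪≫
        eqToIso (by simp only [Strict.assoc]) ≪≫
        whiskerLeftIso (asr (C.hom c d) (C.hom b c) (C.hom a b))
          (whiskerRightIso (inter (homMap C a c d) (C.m a b c)).symm
            (eps (C.hom a c) (C.hom a d))) ≪≫
        eqToIso (by simp only [Strict.assoc]) ≪≫
        whiskerLeftIso (asr (C.hom c d) (C.hom b c) (C.hom a b) ≫ C.hom c d ◃ C.m a b c)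
          (evHom C a c d) ≪≫
        eqToIso (by simp only [Strict.assoc]) ≪≫
        (C.assoc a b c d).symm) ≪≫
    (curryNat (C.m b c d) (C.m a b d)).symm

/-- The unitor of `C(a, -)`, built from `λ⁻¹`. -/
def homUnit (a b : C.Obj) : selfUnit (C.hom a b) ≅ C.u b ≫ homMap C a b b :=
  selfUnitIso (C.hom a b) ≪≫ curryIso (C.lam a b).symm ≪≫ (curryNat (C.u b) (C.m a b b)).symm

/-- The data of the hom-pseudofunctor `C(a, -)`. -/
def homData (a : C.Obj) : EnrichedPseudofunctorData C (selfData V) where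
  obj b := C.hom a b
  map b c := homMap C a b c
  mapComp b c d := homComp C a b c d
  mapUnit b := homUnit C a b

end Closed

end GrayEnriched

open GrayEnriched

/-! Transposition `φ ↦ ε ∘ (φ ⊗ A)` is faithful on 2-cells between 1-cells into `[A, Y]`
(`ev_injective`). By pseudonaturality of `η`, the transpose of `φ` determines `φ` whiskered with
`[1, ε] ∘ η`, and the invertible `t` identifies `[1, ε] ∘ η` with the identity. Every axiom in
question is an equation between 2-cells with values in an internal hom, so it may be checked after
evaluation.

Evaluation makes the structure explicit. The cells `evCurry` undo `[1, -] ∘ η`. They are natural in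
the transposed 1-cell (`c₂_evCurry_naturality`), they absorb `curryNat` because `s` is a
modification (`c₂_evCurry_curryNat`), and by a swallowtail equation they agree at `ε` with the
transpose of `t` (`c₂_curryEps`). Hence the associator and unitors of the self-enrichment, and the
compositor and unitor of `C(a, -)`, satisfy equations (`c₂_ev_selfAssoc`, `c₂_ev_selfLam`,
`c₂_ev_selfRho`, `c₂_ev_homComp`, `c₂_ev_homUnit`) that express their transposes through `evComp`,
`evUnit`, `evHom`, interchangers and the structure cells of `C`.

After these substitutions the triangle and pentagon of the self-enrichment need only the interchange
law and the compatibilities of the interchanger with 2-cells and composition. For `C(a, -)`,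
associativity becomes the pentagon of `C` and the right unit axiom its triangle. The left unit axiom
needs the left unit law of a composite, which is not an axiom; `cell_lam_comp` derives it by Kelly's
argument from the pentagon and two triangles.

All calculations take place among cells stripped of their boundaries, where transports along strict
equalities vanish. -/

namespace GrayEnriched

/-! ### Cells without types

The 1-cells and the 2-cells of `V`, regardless of their boundaries, with compositions that are `0`
where the boundaries do not match.  The laws of a strict 2-category become unconditional equations,
without `eqToHom`. -/

/-- 1-cells with arbitrary boundary, a zero for undefined composites, and a formal unit. -/
inductive Cell₁ (V : Type u) [Bicategory.{w, v} V]
  | zero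
  | one
  | mk {X Y : V} (f : X ⟶ Y)

/-- 2-cells with arbitrary boundary, and a zero for undefined composites. -/
inductive Cell₂ (V : Type u) [Bicategory.{w, v} V]
  | zero
  | mk {X Y : V} {f g : X ⟶ Y} (φ : f ⟶ g)

section Cells

variable {V : Type u} [Bicategory.{w, v} V]

instance : Zero (Cell₁ V) := ⟨.zero⟩
-- The formal unit stands for an empty whiskering context, so that one lemma about cells `p ⋉ x ⋊ q`
-- also covers the cases in which `p` or `q` is absent.
instance : One (Cell₁ V) := ⟨.one⟩
instance : Zero (Cell₂ V) := ⟨.zero⟩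

/-- The untyped cell of a 1-cell. -/
abbrev c₁ {X Y : V} (f : X ⟶ Y) : Cell₁ V := .mk f

/-- The untyped cell of a 2-cell. -/
abbrev c₂ {X Y : V} {f g : X ⟶ Y} (φ : f ⟶ g) : Cell₂ V := .mk φ

@[elab_as_elim]
theorem Cell₁.cases' {P : Cell₁ V → Prop} (p : Cell₁ V) (h0 : P 0) (h1 : P 1)
    (hm : ∀ {X Y : V} (f : X ⟶ Y), P (c₁ f)) : P p := by
  cases p
  · exact h0
  · exact h1
  · exact hm _

@[elab_as_elim]
theorem Cell₂.cases' {P : Cell₂ V → Prop} (x : Cell₂ V) (h0 : P 0)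
    (hm : ∀ {X Y : V} {f g : X ⟶ Y} (φ : f ⟶ g), P (c₂ φ)) : P x := by
  cases x
  · exact h0
  · exact hm _

/-- The way back: an equation between parallel typed 2-cells follows from the equation of their
untyped cells. -/
theorem c₂_injective {X Y : V} {f g : X ⟶ Y} {φ ψ : f ⟶ g} (h : c₂ φ = c₂ ψ) : φ = ψ := by
  injection h with _ _ _ _ h

theorem c₁_congr {X X' Y Y' : V} {f : X ⟶ Y} {f' : X' ⟶ Y'} (hX : X = X') (hY : Y = Y')
    (h : HEq f f') : c₁ f = c₁ f' := by
  subst hX hY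
  rw [eq_of_heq h]

theorem c₂_congr {X X' Y Y' : V} {f g : X ⟶ Y} {f' g' : X' ⟶ Y'} {φ : f ⟶ g} {φ' : f' ⟶ g'}
    (hX : X = X') (hY : Y = Y') (hf : HEq f f') (hg : HEq g g') (h : HEq φ φ') :
    c₂ φ = c₂ φ' := by
  subst hX hY
  obtain rfl := eq_of_heq hf
  obtain rfl := eq_of_heq hg
  rw [eq_of_heq h]

-- Transports along equalities of 1-cells are invisible to untyped cells, whatever proof of equality
-- they carry.
@[simp] theorem c₂_eqToHom_comp {X Y : V} {f g h : X ⟶ Y} (e : f = g) (φ : g ⟶ h) :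
    c₂ (eqToHom e ≫ φ) = c₂ φ := by
  subst e; simp

@[simp] theorem c₂_comp_eqToHom {X Y : V} {f g h : X ⟶ Y} (e : g = h) (φ : f ⟶ g) :
    c₂ (φ ≫ eqToHom e) = c₂ φ := by
  subst e; simp

open Classical in
/-- Composition of 1-cells. -/
noncomputable def Cell₁.comp : Cell₁ V → Cell₁ V → Cell₁ V
    | .zero, _ => .zero
    | .one, q => q
    | .mk _, .zero => .zero
    | .mk f, .one => .mk f
    | @Cell₁.mk _ _ _ Y f, @Cell₁.mk _ _ Y' _ g =>
      if e : Y = Y' then (by subst e; exact .mk (f ≫ g)) else .zero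

noncomputable instance : Mul (Cell₁ V) := ⟨Cell₁.comp⟩

open Classical in
/-- Vertical composition of 2-cells. -/
noncomputable def Cell₂.comp : Cell₂ V → Cell₂ V → Cell₂ V
    | .zero, _ => .zero
    | .mk _, .zero => .zero
    | @Cell₂.mk _ _ X Y _ g φ, @Cell₂.mk _ _ X' Y' g' _ ψ =>
      if e : X = X' ∧ Y = Y' ∧ HEq g g' then
        (by
          obtain ⟨rfl, rfl, e⟩ := e
          obtain rfl := eq_of_heq e
          exact .mk (φ ≫ ψ))
      else .zero

noncomputable instance : Mul (Cell₂ V) := ⟨Cell₂.comp⟩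

open Classical in
/-- Whiskering on the left. -/
noncomputable def wl : Cell₁ V → Cell₂ V → Cell₂ V
  | .zero, _ => .zero
  | .one, x => x
  | .mk _, .zero => .zero
  | @Cell₁.mk _ _ _ Y f, @Cell₂.mk _ _ Y' _ _ _ φ =>
    if e : Y = Y' then (by subst e; exact .mk (f ◁ φ)) else .zero

open Classical in
/-- Whiskering on the right. -/
noncomputable def wr : Cell₂ V → Cell₁ V → Cell₂ V
  | _, .zero => .zero
  | x, .one => x
  | .zero, .mk _ => .zero
  | @Cell₂.mk _ _ _ Y _ _ φ, @Cell₁.mk _ _ Y' _ f =>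
    if e : Y = Y' then (by subst e; exact .mk (φ ▷ f)) else .zero

infixr:82 " ⋉ " => wl
infixl:83 " ⋊ " => wr

/-- The domain of a 2-cell. -/
def dom₁ : Cell₂ V → Cell₁ V
  | .zero => .zero
  | @Cell₂.mk _ _ _ _ f _ _ => .mk f

/-- The codomain of a 2-cell. -/
def cod₁ : Cell₂ V → Cell₁ V
  | .zero => .zero
  | @Cell₂.mk _ _ _ _ _ g _ => .mk g

/-- The source object of a 1-cell. -/
def src₁ : Cell₁ V → Option V
  | @Cell₁.mk _ _ X _ _ => some X
  | _ => none

/-- The target object of a 1-cell. -/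
def tgt₁ : Cell₁ V → Option V
  | @Cell₁.mk _ _ _ Y _ => some Y
  | _ => none

/-- The source object of a 2-cell. -/
def src₂ : Cell₂ V → Option V
  | @Cell₂.mk _ _ X _ _ _ _ => some X
  | _ => none

/-- The target object of a 2-cell. -/
def tgt₂ : Cell₂ V → Option V
  | @Cell₂.mk _ _ _ Y _ _ _ => some Y
  | _ => none

/-- The identity 2-cell. -/
def idc : Cell₁ V → Cell₂ V
  | .mk f => .mk (𝟙 f)
  | _ => .zero

variable (p q r : Cell₁ V) (x y z : Cell₂ V)

theorem c₁_mul {X Y Z : V} (f : X ⟶ Y) (g : Y ⟶ Z) : c₁ (f ≫ g) = c₁ f * c₁ g := by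
  change _ = Cell₁.comp _ _
  simp [Cell₁.comp]

theorem c₁_mul_ne {X Y Y' Z : V} (f : X ⟶ Y) (g : Y' ⟶ Z) (h : Y ≠ Y') : c₁ f * c₁ g = 0 :=
  dif_neg h

theorem c₂_mul {X Y : V} {f g h : X ⟶ Y} (φ : f ⟶ g) (ψ : g ⟶ h) :
    c₂ (φ ≫ ψ) = c₂ φ * c₂ ψ := by
  change _ = Cell₂.comp _ _
  simp only [Cell₂.comp]
  rw [dif_pos ⟨rfl, rfl, HEq.rfl⟩]

theorem c₂_mul_ne {X Y X' Y' : V} {f g : X ⟶ Y} {g' h : X' ⟶ Y'} (φ : f ⟶ g) (ψ : g' ⟶ h)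
    (e : c₁ g ≠ c₁ g') : c₂ φ * c₂ ψ = 0 :=
  dif_neg fun ⟨hX, hY, h⟩ => e (c₁_congr hX hY h)

theorem c₂_wl {X Y Z : V} (p : X ⟶ Y) {f g : Y ⟶ Z} (φ : f ⟶ g) : c₂ (p ◁ φ) = c₁ p ⋉ c₂ φ := by
  simp [wl]

theorem c₂_wl_ne {X Y Y' Z : V} (p : X ⟶ Y) {f g : Y' ⟶ Z} (φ : f ⟶ g) (h : Y ≠ Y') :
    c₁ p ⋉ c₂ φ = 0 :=
  dif_neg h

theorem c₂_wr {X Y Z : V} {f g : X ⟶ Y} (φ : f ⟶ g) (p : Y ⟶ Z) : c₂ (φ ▷ p) = c₂ φ ⋊ c₁ p := by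
  simp [wr]

theorem c₂_wr_ne {X Y Y' Z : V} {f g : X ⟶ Y} (φ : f ⟶ g) (p : Y' ⟶ Z) (h : Y ≠ Y') :
    c₂ φ ⋊ c₁ p = 0 :=
  dif_neg h

@[simp] theorem zero_mul₁ : 0 * p = 0 := id rfl
@[simp] theorem mul_zero₁ : p * 0 = 0 := by cases p <;> rfl
@[simp] theorem one_mul₁ : 1 * p = p := id rfl
@[simp] theorem mul_one₁ : p * 1 = p := by cases p <;> rfl
@[simp] theorem zero_mul₂ : 0 * x = 0 := id rfl
@[simp] theorem mul_zero₂ : x * 0 = 0 := by cases x <;> rfl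
@[simp] theorem zero_wl : 0 ⋉ x = 0 := id rfl
@[simp] theorem wl_zero : p ⋉ (0 : Cell₂ V) = 0 := by cases p <;> rfl
@[simp] theorem one_wl : 1 ⋉ x = x := id rfl
@[simp] theorem zero_wr : (0 : Cell₂ V) ⋊ p = 0 := by cases p <;> rfl
@[simp] theorem wr_zero : x ⋊ 0 = 0 := by cases x <;> rfl
@[simp] theorem wr_one : x ⋊ 1 = x := by cases x <;> rfl
@[simp] theorem dom₁_zero : dom₁ (0 : Cell₂ V) = 0 := id rfl
@[simp] theorem cod₁_zero : cod₁ (0 : Cell₂ V) = 0 := id rfl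
@[simp] theorem idc_zero : idc (0 : Cell₁ V) = 0 := id rfl
@[simp] theorem dom₁_c₂ {X Y : V} {f g : X ⟶ Y} (φ : f ⟶ g) : dom₁ (c₂ φ) = c₁ f := id rfl
@[simp] theorem cod₁_c₂ {X Y : V} {f g : X ⟶ Y} (φ : f ⟶ g) : cod₁ (c₂ φ) = c₁ g := id rfl
theorem idc_c₁ {X Y : V} (f : X ⟶ Y) : idc (c₁ f) = c₂ (𝟙 f) := id rfl

theorem c₁_eq_iff {X Y X' Y' : V} {f : X ⟶ Y} {f' : X' ⟶ Y'} :
    c₁ f = c₁ f' ↔ X = X' ∧ Y = Y' ∧ HEq f f' :=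
  ⟨fun h => by injection h; tauto, fun ⟨hX, hY, h⟩ => c₁_congr hX hY h⟩

section

variable {X Y X' Y' : V} {f g : X ⟶ Y} {f' g' : X' ⟶ Y'}

theorem c₂_eq_iff {φ : f ⟶ g} {φ' : f' ⟶ g'} :
    c₂ φ = c₂ φ' ↔ X = X' ∧ Y = Y' ∧ HEq f f' ∧ HEq g g' ∧ HEq φ φ' :=
  ⟨fun h => by injection h; tauto, fun ⟨hX, hY, hf, hg, h⟩ => c₂_congr hX hY hf hg h⟩

theorem c₂_congr' {φ : f ⟶ g} {φ' : f' ⟶ g'} (hf : c₁ f = c₁ f') (hg : c₁ g = c₁ g')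
    (h : HEq φ φ') : c₂ φ = c₂ φ' :=
  have ⟨hX, hY, hf⟩ := c₁_eq_iff.1 hf
  c₂_congr hX hY hf (c₁_eq_iff.1 hg).2.2 h

/-- The Gray axioms speak of the forward interchanger only; this carries them over to its inverse.
-/
theorem c₂_inv_congr {φ : f ≅ g} {φ' : f' ≅ g'} (h : c₂ φ.hom = c₂ φ'.hom) :
    c₂ φ.inv = c₂ φ'.inv := by
  obtain ⟨rfl, rfl, hf, hg, h⟩ := c₂_eq_iff.1 h
  obtain rfl := eq_of_heq hf
  obtain rfl := eq_of_heq hg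
  obtain rfl := Iso.ext (eq_of_heq h)
  rfl

end

/-! ### Laws of a strict 2-category for untyped cells -/

/-- No composability condition is needed: if one of the two boundaries fails to match, both sides
are zero. -/
theorem mul_assoc₁ [Strict V] : (p * q) * r = p * (q * r) := by
  induction p using Cell₁.cases' with
  | h0 => simp
  | h1 => simp
  | hm f =>
  induction q using Cell₁.cases' with
  | h0 => simp
  | h1 => simp
  | hm g =>
  induction r using Cell₁.cases' with
  | h0 => simp
  | h1 => simp
  | hm h =>
  rename_i X Y Y' Z Z' W
  by_cases e : Y = Y'
  · subst e
    by_cases e' : Z = Z'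
    · subst e'
      simp only [← c₁_mul, Strict.assoc]
    · rw [← c₁_mul, c₁_mul_ne _ _ e', c₁_mul_ne _ _ e', mul_zero₁]
  · by_cases e' : Z = Z'
    · subst e'
      rw [← c₁_mul, c₁_mul_ne _ _ e, c₁_mul_ne _ _ e, zero_mul₁]
    · rw [c₁_mul_ne _ _ e, c₁_mul_ne _ _ e', zero_mul₁, mul_zero₁]

theorem mul_assoc₂ : (x * y) * z = x * (y * z) := by
  induction x using Cell₂.cases' with
  | h0 => simp
  | hm φ =>
  induction y using Cell₂.cases' with
  | h0 => simp
  | hm ψ =>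
  induction z using Cell₂.cases' with
  | h0 => simp
  | hm χ =>
  rename_i X Y f g X' Y' g' h X'' Y'' h' k
  by_cases e : c₁ g = c₁ g'
  · obtain ⟨rfl, rfl, e⟩ := c₁_eq_iff.1 e
    obtain rfl := eq_of_heq e
    by_cases e' : c₁ h = c₁ h'
    · obtain ⟨rfl, rfl, e'⟩ := c₁_eq_iff.1 e'
      obtain rfl := eq_of_heq e'
      simp only [← c₂_mul, Category.assoc]
    · rw [← c₂_mul, c₂_mul_ne _ _ e', c₂_mul_ne _ _ e', mul_zero₂]
  · by_cases e' : c₁ h = c₁ h'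
    · obtain ⟨rfl, rfl, e'⟩ := c₁_eq_iff.1 e'
      obtain rfl := eq_of_heq e'
      rw [← c₂_mul, c₂_mul_ne _ _ e, c₂_mul_ne _ _ e, zero_mul₂]
    · rw [c₂_mul_ne _ _ e, c₂_mul_ne _ _ e', zero_mul₂, mul_zero₂]

/-- The interchange law. -/
theorem wr_mul_wl : (x ⋊ dom₁ y) * (cod₁ x ⋉ y) = (dom₁ x ⋉ y) * (x ⋊ cod₁ y) := by
  induction x using Cell₂.cases' with
  | h0 => simp
  | hm φ =>
  induction y using Cell₂.cases' with
  | h0 => simp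
  | hm ψ =>
  rename_i X Y f g Y' Z h k
  by_cases e : Y = Y'
  · subst e
    simp only [dom₁_c₂, cod₁_c₂, ← c₂_wl, ← c₂_wr, ← c₂_mul, whisker_exchange]
  · simp only [dom₁_c₂, cod₁_c₂, c₂_wr_ne _ _ e, c₂_wl_ne _ _ e, zero_mul₂]

theorem mul_reassoc {a b c d : Cell₂ V} (h : a * b = c * d) (z : Cell₂ V) :
    a * (b * z) = c * (d * z) := by
  rw [← mul_assoc₂, h, mul_assoc₂]

theorem mul_reassoc_of_eq {x y z : Cell₂ V} (h : x * y = z) (t : Cell₂ V) :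
    x * (y * t) = z * t := by
  rw [← mul_assoc₂, h]

theorem wl_idc {X Y : V} (f : X ⟶ Y) : p ⋉ idc (c₁ f) = idc (p * c₁ f) := by
  induction p using Cell₁.cases' with
  | h0 => simp
  | h1 => simp
  | hm g =>
  rename_i W X'
  by_cases e : X' = X
  · subst e
    rw [← c₁_mul, idc_c₁, idc_c₁, ← c₂_wl, Bicategory.whiskerLeft_id]
  · rw [idc_c₁, c₂_wl_ne _ _ e, c₁_mul_ne _ _ e, idc_zero]

theorem idc_wr {X Y : V} (f : X ⟶ Y) : idc (c₁ f) ⋊ p = idc (c₁ f * p) := by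
  induction p using Cell₁.cases' with
  | h0 => simp
  | h1 => simp
  | hm g =>
  rename_i Y' Z
  by_cases e : Y = Y'
  · subst e
    rw [← c₁_mul, idc_c₁, idc_c₁, ← c₂_wr, Bicategory.id_whiskerRight]
  · rw [idc_c₁, c₂_wr_ne _ _ e, c₁_mul_ne _ _ e, idc_zero]

theorem idc_mul {p : Cell₁ V} {x : Cell₂ V} (e : dom₁ x = p) : idc p * x = x := by
  subst e
  induction x using Cell₂.cases' with
  | h0 => rfl
  | hm φ => rw [dom₁_c₂, idc_c₁, ← c₂_mul, Category.id_comp]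

theorem mul_idc {p : Cell₁ V} {x : Cell₂ V} (e : cod₁ x = p) : x * idc p = x := by
  subst e
  induction x using Cell₂.cases' with
  | h0 => rfl
  | hm φ => rw [cod₁_c₂, idc_c₁, ← c₂_mul, Category.comp_id]

/-! ### Boundaries of untyped cells and the laws that depend on them -/

section

variable {X Y : V} {p q : Cell₁ V} {x y : Cell₂ V}

theorem src₁_c₁ (f : X ⟶ Y) : src₁ (c₁ f) = some X := id rfl

theorem tgt₁_c₁ (f : X ⟶ Y) : tgt₁ (c₁ f) = some Y := id rfl

theorem src₂_c₂ {f g : X ⟶ Y} (φ : f ⟶ g) : src₂ (c₂ φ) = some X := id rfl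

theorem tgt₂_c₂ {f g : X ⟶ Y} (φ : f ⟶ g) : tgt₂ (c₂ φ) = some Y := id rfl

theorem src₁_eq {p : Cell₁ V} {X : V} (h : src₁ p = some X) :
    ∃ (Y : V) (f : X ⟶ Y), p = c₁ f := by
  cases p <;> cases h
  exact ⟨_, _, rfl⟩

theorem tgt₁_eq {p : Cell₁ V} {Y : V} (h : tgt₁ p = some Y) :
    ∃ (X : V) (f : X ⟶ Y), p = c₁ f := by
  cases p <;> cases h
  exact ⟨_, _, rfl⟩

/-- Zero and the formal unit have no source or target object, so matching boundaries leave these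
degenerate cases besides a genuine composite. -/
theorem composable₁ (h : tgt₁ p = src₁ q) :
    p * q = 0 ∧ (p = 0 ∨ p = 1) ∧ (q = 0 ∨ q = 1) ∨ p = 1 ∧ q = 1 ∨
      ∃ (X Y Z : V) (f : X ⟶ Y) (g : Y ⟶ Z), p = c₁ f ∧ q = c₁ g := by
  induction p using Cell₁.cases' <;> induction q using Cell₁.cases' <;>
  first
  | (cases h; done)
  | (cases h; exact .inr (.inr ⟨_, _, _, _, _, rfl, rfl⟩))
  | simp

theorem composable₂ (h : cod₁ x = dom₁ y) :
    x = 0 ∧ y = 0 ∨ ∃ (X Y : V) (f g k : X ⟶ Y) (φ : f ⟶ g) (ψ : g ⟶ k), x = c₂ φ ∧ y = c₂ ψ := by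
  induction x using Cell₂.cases' <;> induction y using Cell₂.cases' <;>
  first
  | (cases h; done)
  | (cases h; exact .inr ⟨_, _, _, _, _, _, _, rfl, rfl⟩)
  | simp

theorem composable_wl (h : tgt₁ p = src₂ x) :
    (p = 0 ∨ p = 1) ∧ x = 0 ∨
      ∃ (X Y Z : V) (f : X ⟶ Y) (g k : Y ⟶ Z) (φ : g ⟶ k), p = c₁ f ∧ x = c₂ φ := by
  induction p using Cell₁.cases' <;> induction x using Cell₂.cases' <;>
  first
  | (cases h; done)
  | (cases h; exact .inr ⟨_, _, _, _, _, _, _, rfl, rfl⟩)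
  | simp

theorem composable_wr (h : tgt₂ x = src₁ p) :
    (p = 0 ∨ p = 1) ∧ x = 0 ∨
      ∃ (X Y Z : V) (g k : X ⟶ Y) (φ : g ⟶ k) (f : Y ⟶ Z), p = c₁ f ∧ x = c₂ φ := by
  induction p using Cell₁.cases' <;> induction x using Cell₂.cases' <;>
  first
  | (cases h; done)
  | (cases h; exact .inr ⟨_, _, _, _, _, _, _, rfl, rfl⟩)
  | simp

theorem src₁_mul (h : tgt₁ p = src₁ q) : src₁ (p * q) = src₁ p := by
  obtain ⟨_, rfl | rfl, rfl | rfl⟩ | ⟨rfl, rfl⟩ | ⟨_, _, _, f, g, rfl, rfl⟩ := composable₁ h <;>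
  first
  | rfl
  | rw [← c₁_mul]; rfl

theorem tgt₁_mul (h : tgt₁ p = src₁ q) : tgt₁ (p * q) = tgt₁ q := by
  obtain ⟨_, rfl | rfl, rfl | rfl⟩ | ⟨rfl, rfl⟩ | ⟨_, _, _, f, g, rfl, rfl⟩ := composable₁ h <;>
  first
  | rfl
  | rw [← c₁_mul]; rfl

theorem dom₁_mul (h : cod₁ x = dom₁ y) : dom₁ (x * y) = dom₁ x := by
  obtain ⟨rfl, rfl⟩ | ⟨_, _, _, _, _, φ, ψ, rfl, rfl⟩ := composable₂ h
  · rfl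
  · rw [← c₂_mul]; rfl

theorem cod₁_mul (h : cod₁ x = dom₁ y) : cod₁ (x * y) = cod₁ y := by
  obtain ⟨rfl, rfl⟩ | ⟨_, _, _, _, _, φ, ψ, rfl, rfl⟩ := composable₂ h
  · rfl
  · rw [← c₂_mul]; rfl

theorem tgt₂_mul (h : cod₁ x = dom₁ y) : tgt₂ (x * y) = tgt₂ x := by
  obtain ⟨rfl, rfl⟩ | ⟨_, _, _, _, _, φ, ψ, rfl, rfl⟩ := composable₂ h
  · rfl
  · rw [← c₂_mul]; rfl

theorem tgt₂_wl (h : tgt₁ p = src₂ x) : tgt₂ (p ⋉ x) = tgt₂ x := by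
  obtain ⟨rfl | rfl, rfl⟩ | ⟨_, _, _, f, _, _, φ, rfl, rfl⟩ := composable_wl h
  · rfl
  · rfl
  · rw [← c₂_wl]; rfl

theorem src₂_wr (h : tgt₂ x = src₁ p) : src₂ (x ⋊ p) = src₂ x := by
  obtain ⟨rfl | rfl, rfl⟩ | ⟨_, _, _, _, _, φ, f, rfl, rfl⟩ := composable_wr h
  · rfl
  · rfl
  · rw [← c₂_wr]; rfl

theorem tgt₂_wr (h : tgt₂ x = src₁ p) : tgt₂ (x ⋊ p) = tgt₁ p := by
  obtain ⟨rfl | rfl, rfl⟩ | ⟨_, _, _, _, _, φ, f, rfl, rfl⟩ := composable_wr h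
  · rfl
  · rfl
  · rw [← c₂_wr]; rfl

/-- The condition is essential: `p` may equalise `cod₁ x` and `dom₁ y`, in which case the right side
can be nonzero although `x * y` is zero. -/
theorem wl_mul (h : cod₁ x = dom₁ y) : p ⋉ (x * y) = p ⋉ x * p ⋉ y := by
  obtain ⟨rfl, rfl⟩ | ⟨X, Y, f, g, k, φ, ψ, rfl, rfl⟩ := composable₂ h
  · simp
  · induction p using Cell₁.cases' with
    | h0 => simp
    | h1 => simp
    | hm p =>
    rename_i W X'
    by_cases e : X' = X
    · subst e
      rw [← c₂_mul, ← c₂_wl, Bicategory.whiskerLeft_comp, c₂_mul, c₂_wl, c₂_wl]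
    · rw [← c₂_mul, c₂_wl_ne _ _ e, c₂_wl_ne _ _ e, zero_mul₂]

theorem mul_wr (h : cod₁ x = dom₁ y) : (x * y) ⋊ p = x ⋊ p * y ⋊ p := by
  obtain ⟨rfl, rfl⟩ | ⟨X, Y, f, g, k, φ, ψ, rfl, rfl⟩ := composable₂ h
  · simp
  · induction p using Cell₁.cases' with
    | h0 => simp
    | h1 => simp
    | hm p =>
    rename_i X' W
    by_cases e : Y = X'
    · subst e
      rw [← c₂_mul, ← c₂_wr, Bicategory.comp_whiskerRight, c₂_mul, c₂_wr, c₂_wr]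
    · rw [← c₂_mul, c₂_wr_ne _ _ e, c₂_wr_ne _ _ e, zero_mul₂]

end

theorem dom₁_wl : dom₁ (p ⋉ x) = p * dom₁ x := by
  induction p using Cell₁.cases' with
  | h0 => simp
  | h1 => simp
  | hm f =>
  induction x using Cell₂.cases' with
  | h0 => simp
  | hm φ =>
  rename_i X Y Y' Z h k
  by_cases e : Y = Y'
  · subst e
    simp only [dom₁_c₂, ← c₂_wl, ← c₁_mul]
  · rw [c₂_wl_ne _ _ e, dom₁_c₂, c₁_mul_ne _ _ e, dom₁_zero]

theorem cod₁_wl : cod₁ (p ⋉ x) = p * cod₁ x := by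
  induction p using Cell₁.cases' with
  | h0 => simp
  | h1 => simp
  | hm f =>
  induction x using Cell₂.cases' with
  | h0 => simp
  | hm φ =>
  rename_i X Y Y' Z h k
  by_cases e : Y = Y'
  · subst e
    simp only [cod₁_c₂, ← c₂_wl, ← c₁_mul]
  · rw [c₂_wl_ne _ _ e, cod₁_c₂, c₁_mul_ne _ _ e, cod₁_zero]

theorem dom₁_wr : dom₁ (x ⋊ q) = dom₁ x * q := by
  induction q using Cell₁.cases' with
  | h0 => simp
  | h1 => simp
  | hm f =>
  induction x using Cell₂.cases' with
  | h0 => simp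
  | hm φ =>
  rename_i Y' Z X Y h k
  by_cases e : Y = Y'
  · subst e
    simp only [dom₁_c₂, ← c₂_wr, ← c₁_mul]
  · rw [c₂_wr_ne _ _ e, dom₁_c₂, c₁_mul_ne _ _ e, dom₁_zero]

theorem cod₁_wr : cod₁ (x ⋊ q) = cod₁ x * q := by
  induction q using Cell₁.cases' with
  | h0 => simp
  | h1 => simp
  | hm f =>
  induction x using Cell₂.cases' with
  | h0 => simp
  | hm φ =>
  rename_i Y' Z X Y h k
  by_cases e : Y = Y'
  · subst e
    simp only [cod₁_c₂, ← c₂_wr, ← c₁_mul]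
  · rw [c₂_wr_ne _ _ e, cod₁_c₂, c₁_mul_ne _ _ e, cod₁_zero]

variable [Strict V]

theorem mul_wl : (p * q) ⋉ x = p ⋉ q ⋉ x := by
  induction p using Cell₁.cases' with
  | h0 => simp
  | h1 => simp
  | hm f =>
  induction q using Cell₁.cases' with
  | h0 => simp
  | h1 => simp
  | hm g =>
  induction x using Cell₂.cases' with
  | h0 => simp
  | hm φ =>
  rename_i X Y Y' Z Z' W h k
  by_cases e : Y = Y'
  · subst e
    by_cases e' : Z = Z'
    · subst e'
      simp only [← c₁_mul, ← c₂_wl, comp_whiskerLeft, Strict.associator_eqToIso, eqToIso.hom,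
        eqToIso.inv, c₂_eqToHom_comp, c₂_comp_eqToHom]
    · rw [← c₁_mul, c₂_wl_ne _ _ e', c₂_wl_ne _ _ e', wl_zero]
  · by_cases e' : Z = Z'
    · subst e'
      rw [← c₂_wl, c₁_mul_ne _ _ e, c₂_wl_ne _ _ e, zero_wl]
    · rw [c₁_mul_ne _ _ e, c₂_wl_ne _ _ e', zero_wl, wl_zero]

theorem wr_mul : x ⋊ (p * q) = x ⋊ p ⋊ q := by
  induction p using Cell₁.cases' with
  | h0 => simp
  | h1 => simp
  | hm f =>
  induction q using Cell₁.cases' with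
  | h0 => simp
  | h1 => simp
  | hm g =>
  induction x using Cell₂.cases' with
  | h0 => simp
  | hm φ =>
  rename_i Y Y' Z Z' X W h k
  by_cases e : W = Y
  · subst e
    by_cases e' : Y' = Z
    · subst e'
      simp only [← c₁_mul, ← c₂_wr, whiskerRight_comp, Strict.associator_eqToIso, eqToIso.hom,
        eqToIso.inv, c₂_eqToHom_comp, c₂_comp_eqToHom]
    · rw [← c₂_wr, c₁_mul_ne _ _ e', c₂_wr_ne _ _ e', wr_zero]
  · by_cases e' : Y' = Z
    · subst e'
      rw [← c₁_mul, c₂_wr_ne _ _ e, c₂_wr_ne _ _ e, zero_wr]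
    · rw [c₁_mul_ne _ _ e', c₂_wr_ne _ _ e, zero_wr, wr_zero]

theorem wl_wr : (p ⋉ x) ⋊ q = p ⋉ x ⋊ q := by
  induction p using Cell₁.cases' with
  | h0 => simp
  | h1 => simp
  | hm f =>
  induction q using Cell₁.cases' with
  | h0 => simp
  | h1 => simp
  | hm g =>
  induction x using Cell₂.cases' with
  | h0 => simp
  | hm φ =>
  rename_i X X' Z' Z Y Y' h k
  by_cases e : X' = Y
  · subst e
    by_cases e' : Y' = Z'
    · subst e'
      simp only [← c₂_wl, ← c₂_wr, whisker_assoc, Strict.associator_eqToIso, eqToIso.hom,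
        eqToIso.inv, c₂_eqToHom_comp, c₂_comp_eqToHom]
    · rw [← c₂_wl, c₂_wr_ne _ _ e', c₂_wr_ne _ _ e', wl_zero]
  · by_cases e' : Y' = Z'
    · subst e'
      rw [← c₂_wr, c₂_wl_ne _ _ e, c₂_wl_ne _ _ e, zero_wr]
    · rw [c₂_wl_ne _ _ e, c₂_wr_ne _ _ e', zero_wr, wl_zero]

theorem wl_wl : p ⋉ q ⋉ x = (p * q) ⋉ x := (mul_wl p q x).symm

theorem wr_wr : x ⋊ p ⋊ q = x ⋊ (p * q) := (wr_mul p q x).symm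

/-- The interchange law for two whiskered 2-cells. -/
theorem slice_swap :
    (p ⋉ x ⋊ (q * (dom₁ y * r))) * ((p * (cod₁ x * q)) ⋉ y ⋊ r) =
      ((p * (dom₁ x * q)) ⋉ y ⋊ r) * (p ⋉ x ⋊ (q * (cod₁ y * r))) := by
  have h := wr_mul_wl (p ⋉ x ⋊ q) (y ⋊ r)
  simpa only [dom₁_wl, cod₁_wl, dom₁_wr, cod₁_wr, wl_wr, wr_wr, mul_assoc₁] using h

/-- The interchange law for two whiskered 2-cells, in front of other cells. -/
theorem slice_swap' :
    (p ⋉ x ⋊ (q * (dom₁ y * r))) * (((p * (cod₁ x * q)) ⋉ y ⋊ r) * z) =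
      ((p * (dom₁ x * q)) ⋉ y ⋊ r) * ((p ⋉ x ⋊ (q * (cod₁ y * r))) * z) := by
  rw [← mul_assoc₂, slice_swap, mul_assoc₂]

theorem c₂_cancel_right {X Y X' Y' : V} {f g : X ⟶ Y} {φ ψ : f ⟶ g} {g' h : X' ⟶ Y'}
    (χ : g' ⟶ h) [IsIso χ] (e : c₁ g = c₁ g') (H : c₂ φ * c₂ χ = c₂ ψ * c₂ χ) : φ = ψ := by
  obtain ⟨rfl, rfl, e⟩ := c₁_eq_iff.1 e
  obtain rfl := eq_of_heq e
  rw [← c₂_mul, ← c₂_mul] at H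
  exact (cancel_mono χ).1 (c₂_injective H)

theorem c₂_cancel_left {X Y X' Y' : V} {f g : X ⟶ Y} {φ ψ : f ⟶ g} {f' h : X' ⟶ Y'}
    (χ : h ⟶ f') [IsIso χ] (e : c₁ f' = c₁ f) (H : c₂ χ * c₂ φ = c₂ χ * c₂ ψ) : φ = ψ := by
  obtain ⟨rfl, rfl, e⟩ := c₁_eq_iff.1 e
  obtain rfl := eq_of_heq e
  rw [← c₂_mul, ← c₂_mul] at H
  exact (cancel_epi χ).1 (c₂_injective H)

section EqToHom

variable {X Y : V}

/-- With this and its variants the associativity and unit equalities of objects drop out of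
composites. The condition on the source is needed because a composite with a mismatched boundary is
zero. -/
theorem c₁_eqToHom_mul (h : X = Y) (p : Cell₁ V) (e : src₁ p = some Y) :
    c₁ (eqToHom h) * p = p := by
  subst h
  induction p using Cell₁.cases' with
  | h0 => cases e
  | h1 => cases e
  | hm f =>
    cases e
    rw [← c₁_mul, eqToHom_refl, Strict.id_comp]

theorem c₁_mul_eqToHom (h : X = Y) (p : Cell₁ V) (e : tgt₁ p = some X) :
    p * c₁ (eqToHom h) = p := by
  subst h
  induction p using Cell₁.cases' with
  | h0 => cases e
  | h1 => cases e
  | hm f =>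
    cases e
    rw [← c₁_mul, eqToHom_refl, Strict.comp_id]

theorem c₁_eqToHom_wl (h : X = Y) (x : Cell₂ V) (e : src₂ x = some Y) :
    c₁ (eqToHom h) ⋉ x = x := by
  subst h
  induction x using Cell₂.cases' with
  | h0 => cases e
  | hm f =>
    cases e
    simp only [← c₂_wl, eqToHom_refl, id_whiskerLeft, Strict.leftUnitor_eqToIso, eqToIso.hom,
      eqToIso.inv, c₂_eqToHom_comp, c₂_comp_eqToHom]

theorem c₂_wr_eqToHom (h : X = Y) (x : Cell₂ V) (e : tgt₂ x = some X) :
    x ⋊ c₁ (eqToHom h) = x := by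
  subst h
  induction x using Cell₂.cases' with
  | h0 => cases e
  | hm f =>
    cases e
    simp only [← c₂_wr, eqToHom_refl, whiskerRight_id, Strict.rightUnitor_eqToIso, eqToIso.hom,
      eqToIso.inv, c₂_eqToHom_comp, c₂_comp_eqToHom]

theorem c₁_eqToHom_mul_mul (h : X = Y) (p q : Cell₁ V) (e : src₁ p = some Y) :
    c₁ (eqToHom h) * (p * q) = p * q := by
  rw [← mul_assoc₁, c₁_eqToHom_mul h p e]

theorem c₁_eqToHom_wl_wr (h : X = Y) (x : Cell₂ V) (q : Cell₁ V) (e : src₂ x = some Y) :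
    c₁ (eqToHom h) ⋉ x ⋊ q = x ⋊ q := by
  rw [← wl_wr, c₁_eqToHom_wl h x e]

theorem c₁_id_mul (p : Cell₁ V) (e : src₁ p = some X) : c₁ (𝟙 X) * p = p :=
  c₁_eqToHom_mul rfl p e

theorem c₁_mul_id (p : Cell₁ V) (e : tgt₁ p = some X) : p * c₁ (𝟙 X) = p :=
  c₁_mul_eqToHom rfl p e

theorem c₁_id_wl (x : Cell₂ V) (e : src₂ x = some X) : c₁ (𝟙 X) ⋉ x = x :=
  c₁_eqToHom_wl rfl x e

theorem c₂_wr_id (x : Cell₂ V) (e : tgt₂ x = some X) : x ⋊ c₁ (𝟙 X) = x :=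
  c₂_wr_eqToHom rfl x e

end EqToHom

theorem wl_idc_wr {X Y : V} (f : X ⟶ Y) : p ⋉ idc (c₁ f) ⋊ q = idc (p * (c₁ f * q)) := by
  rw [← wl_wr, wl_idc]
  induction p using Cell₁.cases' with
  | h0 => simp
  | h1 => rw [one_mul₁, one_mul₁, idc_wr]
  | hm g =>
  rename_i W X'
  by_cases e : X' = X
  · subst e
    rw [← c₁_mul, idc_wr, c₁_mul, mul_assoc₁]
  · rw [← mul_assoc₁, c₁_mul_ne _ _ e, zero_mul₁, idc_zero, zero_wr]

section Inverses

variable {X Y : V} {f g : X ⟶ Y} (φ : f ≅ g)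

/-- The context may be uncomposable with `φ`; then both sides are zero, so the cancellation carries
no side condition. -/
theorem slice_hom_inv :
    (p ⋉ c₂ φ.hom ⋊ q) * (p ⋉ c₂ φ.inv ⋊ q) = idc (p * (c₁ f * q)) := by
  rw [← wl_idc_wr, idc_c₁, ← φ.hom_inv_id, c₂_mul, mul_wr rfl, wl_mul]
  rw [cod₁_wr, dom₁_wr, cod₁_c₂, dom₁_c₂]

theorem slice_inv_hom :
    (p ⋉ c₂ φ.inv ⋊ q) * (p ⋉ c₂ φ.hom ⋊ q) = idc (p * (c₁ g * q)) :=
  slice_hom_inv p q φ.symm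

theorem slice_hom_inv_mul (h : dom₁ z = p * (c₁ f * q)) :
    (p ⋉ c₂ φ.hom ⋊ q) * ((p ⋉ c₂ φ.inv ⋊ q) * z) = z := by
  rw [← mul_assoc₂, slice_hom_inv, idc_mul h]

theorem slice_inv_hom_mul (h : dom₁ z = p * (c₁ g * q)) :
    (p ⋉ c₂ φ.inv ⋊ q) * ((p ⋉ c₂ φ.hom ⋊ q) * z) = z := by
  rw [← mul_assoc₂, slice_inv_hom, idc_mul h]

end Inverses

theorem c₂_eqToHom {X Y : V} {f g : X ⟶ Y} (h : f = g) : c₂ (eqToHom h) = idc (c₁ f) := by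
  subst h; rfl

end Cells

/-! ### The Gray tensor product on untyped cells -/

section GrayCells

open GrayMonoid

variable {V : Type u} [Bicategory.{w, v} V] [Bicategory.Strict V] [GrayMonoid V]

variable {X Y : V}

/-- `A ⊗ p` for an untyped 1-cell. -/
def lt₁ (A : V) : Cell₁ V → Cell₁ V
  | .zero => .zero
  | .one => .one
  | .mk f => .mk (A ◃ f)

/-- `p ⊗ B` for an untyped 1-cell. -/
def rt₁ : Cell₁ V → V → Cell₁ V
  | .zero, _ => .zero
  | .one, _ => .one
  | .mk f, B => .mk (f ▹ B)

/-- `A ⊗ x` for an untyped 2-cell. -/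
def lt₂ (A : V) : Cell₂ V → Cell₂ V
  | .zero => .zero
  | .mk φ => .mk (A ◃₂ φ)

/-- `x ⊗ B` for an untyped 2-cell. -/
def rt₂ : Cell₂ V → V → Cell₂ V
  | .zero, _ => .zero
  | .mk φ, B => .mk (φ ▹₂ B)

theorem c₁_lT (A : V) (f : X ⟶ Y) : c₁ (A ◃ f) = lt₁ A (c₁ f) := id rfl
theorem c₁_rT (f : X ⟶ Y) (B : V) : c₁ (f ▹ B) = rt₁ (c₁ f) B := id rfl
theorem c₂_lT {f g : X ⟶ Y} (A : V) (φ : f ⟶ g) : c₂ (A ◃₂ φ) = lt₂ A (c₂ φ) := id rfl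
theorem c₂_rT {f g : X ⟶ Y} (φ : f ⟶ g) (B : V) : c₂ (φ ▹₂ B) = rt₂ (c₂ φ) B := id rfl

section Laws

variable (A B C : V) (p q : Cell₁ V) (x : Cell₂ V)

/-- For untyped cells the heterogeneous equalities of strict associativity and unitality become
ordinary equations, which can be used for rewriting. -/
theorem lt₁_lt₁ : lt₁ A (lt₁ B p) = lt₁ (A ⊠ B) p := by
  cases p
  · rfl
  · rfl
  · exact c₁_congr (tensor_assoc _ _ _).symm (tensor_assoc _ _ _).symm (lT_lT A B _).symm

theorem rt₁_rt₁ : rt₁ (rt₁ p B) C = rt₁ p (B ⊠ C) := by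
  cases p
  · rfl
  · rfl
  · exact c₁_congr (tensor_assoc _ _ _) (tensor_assoc _ _ _) (rT_rT _ B C)

theorem rt₁_lt₁ : rt₁ (lt₁ A p) C = lt₁ A (rt₁ p C) := by
  cases p
  · rfl
  · rfl
  · exact c₁_congr (tensor_assoc _ _ _) (tensor_assoc _ _ _) (lT_rT A _ C)

theorem lt₁_unit : lt₁ (unitObj : V) p = p := by
  cases p
  · rfl
  · rfl
  · exact c₁_congr (unit_tensor _) (unit_tensor _) (unit_lT _)

theorem rt₁_unit : rt₁ p (unitObj : V) = p := by
  cases p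
  · rfl
  · rfl
  · exact c₁_congr (tensor_unit _) (tensor_unit _) (rT_unit _)

theorem lt₂_lt₂ : lt₂ A (lt₂ B x) = lt₂ (A ⊠ B) x := by
  cases x
  · rfl
  · exact c₂_congr (tensor_assoc _ _ _).symm (tensor_assoc _ _ _).symm (lT_lT _ _ _).symm
      (lT_lT _ _ _).symm (lT₂_lT₂ A B _).symm

theorem rt₂_rt₂ : rt₂ (rt₂ x B) C = rt₂ x (B ⊠ C) := by
  cases x
  · rfl
  · exact c₂_congr (tensor_assoc _ _ _) (tensor_assoc _ _ _) (rT_rT _ _ _) (rT_rT _ _ _)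
      (rT₂_rT₂ _ B C)

theorem rt₂_lt₂ : rt₂ (lt₂ A x) C = lt₂ A (rt₂ x C) := by
  cases x
  · rfl
  · exact c₂_congr (tensor_assoc _ _ _) (tensor_assoc _ _ _) (lT_rT _ _ _) (lT_rT _ _ _)
      (lT₂_rT₂ A _ C)

theorem lt₂_unit : lt₂ (unitObj : V) x = x := by
  cases x
  · rfl
  · exact c₂_congr (unit_tensor _) (unit_tensor _) (unit_lT _) (unit_lT _) (unit_lT₂ _)

end Laws

/-! Interchangers -/

/-- The untyped interchanger. -/
def sig : Cell₁ V → Cell₁ V → Cell₂ V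
  | .mk f, .mk g => .mk (inter f g).hom
  | _, _ => .zero

/-- The untyped inverse interchanger. -/
def sigInv : Cell₁ V → Cell₁ V → Cell₂ V
  | .mk f, .mk g => .mk (inter f g).inv
  | _, _ => .zero

section Laws

variable (A B C : V) (p q : Cell₁ V)

theorem c₂_lT_inter {A A' B B' : V} (f : A ⟶ A') (g : B ⟶ B') :
    c₂ (C ◃₂ (inter f g).hom) = c₂ (inter (C ◃ f) g).hom := by
  refine c₂_congr' ?_ ?_ (lT₂_inter C f g) <;>
  simp only [lT_comp, c₁_mul, c₁_lT, c₁_rT, lt₁_lt₁, rt₁_lt₁]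

theorem c₂_inter_rT {A A' B B' : V} (f : A ⟶ A') (g : B ⟶ B') :
    c₂ ((inter f g).hom ▹₂ C) = c₂ (inter f (g ▹ C)).hom := by
  refine c₂_congr' ?_ ?_ (rT₂_inter f g C) <;>
  simp only [rT_comp, c₁_mul, c₁_lT, c₁_rT, rt₁_rt₁, rt₁_lt₁]

theorem c₂_inter_lT {A A' B B' : V} (f : A ⟶ A') (g : B ⟶ B') :
    c₂ (inter (f ▹ C) g).hom = c₂ (inter f (C ◃ g)).hom := by
  refine c₂_congr' ?_ ?_ (inter_rT C f g) <;>
  simp only [c₁_mul, c₁_lT, c₁_rT, lt₁_lt₁, rt₁_rt₁]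

theorem lt₂_sigInv : lt₂ C (sigInv p q) = sigInv (lt₁ C p) q := by
  cases p <;> cases q <;>
  first
  | rfl
  | exact c₂_inv_congr (φ := lTIso C (inter _ _)) (c₂_lT_inter C _ _)

theorem rt₂_sigInv : rt₂ (sigInv p q) C = sigInv p (rt₁ q C) := by
  cases p <;> cases q <;>
  first
  | rfl
  | exact c₂_inv_congr (φ := rTIso (inter _ _) C) (c₂_inter_rT C _ _)

theorem sigInv_rt₁ : sigInv (rt₁ p C) q = sigInv p (lt₁ C q) := by
  cases p <;> cases q <;>
  first
  | rfl
  | exact c₂_inv_congr (c₂_inter_lT C _ _)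

end Laws

variable {A A' A'' B B' B'' : V}

theorem c₂_inter (f : A ⟶ A') (g : B ⟶ B') : c₂ (inter f g).hom = sig (c₁ f) (c₁ g) := id rfl

theorem c₂_inter_inv (f : A ⟶ A') (g : B ⟶ B') : c₂ (inter f g).inv = sigInv (c₁ f) (c₁ g) := id rfl

theorem inter_comp_left_iso (f : A ⟶ A') (f' : A' ⟶ A'') (g : B ⟶ B') :
    inter (f ≫ f') g =
      eqToIso (by rw [rT_comp, Strict.assoc]) ≪≫ whiskerRightIso (inter f g) (f' ▹ B') ≪≫
        α_ _ _ _ ≪≫ whiskerLeftIso (f ▹ B) (inter f' g) ≪≫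
          eqToIso (by rw [rT_comp, Strict.assoc]) :=
  Iso.ext (inter_comp_left f f' g)

theorem inter_comp_right_iso (f : A ⟶ A') (g : B ⟶ B') (g' : B' ⟶ B'') :
    inter f (g ≫ g') =
      eqToIso (by rw [lT_comp, Strict.assoc]) ≪≫ whiskerLeftIso (A ◃ g) (inter f g') ≪≫
        (α_ _ _ _).symm ≪≫ whiskerRightIso (inter f g) (A' ◃ g') ≪≫
          eqToIso (by rw [lT_comp, Strict.assoc]) :=
  Iso.ext (inter_comp_right f g g')

/-- The calculus is developed for the inverse interchanger, the direction that occurs in the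
structure cells of the self-enrichment and in the compositor of `C(a, -)`. -/
theorem sigInv_comp_left (f : A ⟶ A') {A₁ : V} (f' : A₁ ⟶ A'') (g : B ⟶ B') (e : A' = A₁) :
    sigInv (c₁ f * c₁ f') (c₁ g) =
      (c₁ (f ▹ B) ⋉ sigInv (c₁ f') (c₁ g)) * (sigInv (c₁ f) (c₁ g) ⋊ c₁ (f' ▹ B')) := by
  subst e
  rw [← c₁_mul, ← c₂_inter_inv, inter_comp_left_iso]
  simp only [Iso.trans_inv, eqToIso.inv, Strict.associator_eqToIso, Category.assoc]
  simp only [↓c₂_eqToHom_comp, ↓c₂_comp_eqToHom, c₂_mul, c₂_wl, c₂_wr, c₂_inter_inv,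
    whiskerLeftIso_inv, whiskerRightIso_inv]

theorem sigInv_comp_right (f : A ⟶ A') (g : B ⟶ B') {B₁ : V} (g' : B₁ ⟶ B'') (e : B' = B₁) :
    sigInv (c₁ f) (c₁ g * c₁ g') =
      (sigInv (c₁ f) (c₁ g) ⋊ c₁ (A' ◃ g')) * (c₁ (A ◃ g) ⋉ sigInv (c₁ f) (c₁ g')) := by
  subst e
  rw [← c₁_mul, ← c₂_inter_inv, inter_comp_right_iso]
  simp only [Iso.trans_inv, Iso.symm_inv, eqToIso.hom, eqToIso.inv, Strict.associator_eqToIso,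
    Category.assoc]
  simp only [↓c₂_eqToHom_comp, ↓c₂_comp_eqToHom, c₂_mul, c₂_wl, c₂_wr, c₂_inter_inv,
    whiskerLeftIso_inv, whiskerRightIso_inv]

section Composition

variable {p p' q q' : Cell₁ V}

theorem sigInv_mul_left (hp : tgt₁ p = some A') (hp' : src₁ p' = some A') (hq : src₁ q = some B)
    (hq' : tgt₁ q = some B') :
    sigInv (p * p') q = (rt₁ p B ⋉ sigInv p' q) * (sigInv p q ⋊ rt₁ p' B') := by
  obtain ⟨_, f, rfl⟩ := tgt₁_eq hp
  obtain ⟨_, f', rfl⟩ := src₁_eq hp'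
  obtain ⟨_, g, rfl⟩ := src₁_eq hq
  cases hq'
  exact sigInv_comp_left f f' g rfl

theorem sigInv_mul_right (hq : tgt₁ q = some B') (hq' : src₁ q' = some B')
    (hp : src₁ p = some A) (hp' : tgt₁ p = some A') :
    sigInv p (q * q') = (sigInv p q ⋊ lt₁ A' q') * (lt₁ A q ⋉ sigInv p q') := by
  obtain ⟨_, g, rfl⟩ := tgt₁_eq hq
  obtain ⟨_, g', rfl⟩ := src₁_eq hq'
  obtain ⟨_, f, rfl⟩ := src₁_eq hp
  cases hp'
  exact sigInv_comp_right f g g' rfl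

theorem dom₁_sig (hp : src₁ p = some A) (hq : tgt₁ q = some B') :
    dom₁ (sig p q) = lt₁ A q * rt₁ p B' := by
  obtain ⟨_, f, rfl⟩ := src₁_eq hp
  obtain ⟨_, g, rfl⟩ := tgt₁_eq hq
  exact c₁_mul _ _

theorem cod₁_sig (hp : tgt₁ p = some A') (hq : src₁ q = some B) :
    cod₁ (sig p q) = rt₁ p B * lt₁ A' q := by
  obtain ⟨_, f, rfl⟩ := tgt₁_eq hp
  obtain ⟨_, g, rfl⟩ := src₁_eq hq
  exact c₁_mul _ _

theorem dom₁_sigInv (hp : tgt₁ p = some A') (hq : src₁ q = some B) :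
    dom₁ (sigInv p q) = rt₁ p B * lt₁ A' q := by
  obtain ⟨_, f, rfl⟩ := tgt₁_eq hp
  obtain ⟨_, g, rfl⟩ := src₁_eq hq
  exact c₁_mul _ _

theorem cod₁_sigInv (hp : src₁ p = some A) (hq : tgt₁ q = some B') :
    cod₁ (sigInv p q) = lt₁ A q * rt₁ p B' := by
  obtain ⟨_, f, rfl⟩ := src₁_eq hp
  obtain ⟨_, g, rfl⟩ := tgt₁_eq hq
  exact c₁_mul _ _

end Composition

/-- The naturality axiom conjugated by the interchangers; `φ` may be any 2-cell, not only an
invertible one. -/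
theorem sigInv_naturality_left {f f' : A ⟶ A'} (φ : f ⟶ f') (g : B ⟶ B') :
    (c₂ (φ ▹₂ B) ⋊ c₁ (A' ◃ g)) * sigInv (c₁ f') (c₁ g) =
      sigInv (c₁ f) (c₁ g) * (c₁ (A ◃ g) ⋉ c₂ (φ ▹₂ B')) := by
  have h : φ ▹₂ B ▷ A' ◃ g ≫ (inter f' g).inv = (inter f g).inv ≫ A ◃ g ◁ φ ▹₂ B' := by
    rw [Iso.comp_inv_eq, Category.assoc, inter_naturality_left, Iso.inv_hom_id_assoc]
  simpa only [c₂_mul, c₂_wl, c₂_wr, c₂_inter_inv] using congrArg c₂ h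

theorem sigInv_naturality_right (f : A ⟶ A') {g g' : B ⟶ B'} (ψ : g ⟶ g') :
    (c₁ (f ▹ B) ⋉ c₂ (A' ◃₂ ψ)) * sigInv (c₁ f) (c₁ g') =
      sigInv (c₁ f) (c₁ g) * (c₂ (A ◃₂ ψ) ⋊ c₁ (f ▹ B')) := by
  have h : f ▹ B ◁ A' ◃₂ ψ ≫ (inter f g').inv = (inter f g).inv ≫ (A ◃₂ ψ) ▷ f ▹ B' := by
    rw [Iso.comp_inv_eq, Category.assoc, inter_naturality_right, Iso.inv_hom_id_assoc]
  simpa only [c₂_mul, c₂_wl, c₂_wr, c₂_inter_inv] using congrArg c₂ h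

theorem sigInv_eqToHom_left (h : A = A') (g : B ⟶ B') :
    sigInv (c₁ (eqToHom h)) (c₁ g) = idc (c₁ (A ◃ g)) := by
  subst h
  have e : (inter (𝟙 A) g).inv = eqToHom (by
      rw [rT_id, rT_id, Bicategory.Strict.comp_id, Bicategory.Strict.id_comp]) := by
    rw [← cancel_epi (inter (𝟙 A) g).hom, Iso.hom_inv_id, inter_id_left, eqToHom_trans,
      eqToHom_refl]
  refine (congrArg c₂ e).trans ?_
  rw [c₂_eqToHom, rT_id, Strict.id_comp]

section Boundaries

variable {X Y : V} (A B : V)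

theorem src₁_lt₁ (p : Cell₁ V) : src₁ (lt₁ A p) = (src₁ p).map (A ⊠ ·) := by cases p <;> rfl
theorem tgt₁_lt₁ (p : Cell₁ V) : tgt₁ (lt₁ A p) = (tgt₁ p).map (A ⊠ ·) := by cases p <;> rfl
theorem src₁_rt₁ (p : Cell₁ V) : src₁ (rt₁ p B) = (src₁ p).map (· ⊠ B) := by cases p <;> rfl
theorem tgt₁_rt₁ (p : Cell₁ V) : tgt₁ (rt₁ p B) = (tgt₁ p).map (· ⊠ B) := by cases p <;> rfl
theorem src₂_lt₂ (x : Cell₂ V) : src₂ (lt₂ A x) = (src₂ x).map (A ⊠ ·) := by cases x <;> rfl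
theorem tgt₂_lt₂ (x : Cell₂ V) : tgt₂ (lt₂ A x) = (tgt₂ x).map (A ⊠ ·) := by cases x <;> rfl
theorem tgt₂_rt₂ (x : Cell₂ V) : tgt₂ (rt₂ x B) = (tgt₂ x).map (· ⊠ B) := by cases x <;> rfl

theorem src₂_sigInv {p q : Cell₁ V} {X Y : V} (hp : src₁ p = some X) (hq : src₁ q = some Y) :
    src₂ (sigInv p q) = some (X ⊠ Y) := by
  obtain ⟨_, f, rfl⟩ := src₁_eq hp
  obtain ⟨_, g, rfl⟩ := src₁_eq hq
  rfl

theorem tgt₂_sigInv {p q : Cell₁ V} {X Y : V} (hp : tgt₁ p = some X) (hq : tgt₁ q = some Y) :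
    tgt₂ (sigInv p q) = some (X ⊠ Y) := by
  obtain ⟨_, f, rfl⟩ := tgt₁_eq hp
  obtain ⟨_, g, rfl⟩ := tgt₁_eq hq
  rfl

variable {f g : X ⟶ Y} (φ : f ⟶ g)

theorem dom₁_lt₂ : dom₁ (lt₂ A (c₂ φ)) = c₁ (A ◃ f) := id rfl
theorem cod₁_lt₂ : cod₁ (lt₂ A (c₂ φ)) = c₁ (A ◃ g) := id rfl
theorem dom₁_rt₂ : dom₁ (rt₂ (c₂ φ) B) = c₁ (f ▹ B) := id rfl
theorem cod₁_rt₂ : cod₁ (rt₂ (c₂ φ) B) = c₁ (g ▹ B) := id rfl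
theorem dom₁_lt₂_rt₂ : dom₁ (lt₂ A (rt₂ (c₂ φ) B)) = c₁ (A ◃ (f ▹ B)) := id rfl
theorem cod₁_lt₂_rt₂ : cod₁ (lt₂ A (rt₂ (c₂ φ) B)) = c₁ (A ◃ (g ▹ B)) := id rfl

end Boundaries

/-! Conditional distributivity -/

section Distributivity

variable {p q : Cell₁ V} {x y : Cell₂ V} (A B : V)

/-- Composability has to be assumed: distinct objects may become equal after tensoring with `A`,
which would make only the right side nonzero. -/
theorem lt₁_mul (h : tgt₁ p = src₁ q) : lt₁ A (p * q) = lt₁ A p * lt₁ A q := by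
  obtain ⟨_, rfl | rfl, rfl | rfl⟩ | ⟨rfl, rfl⟩ | ⟨_, _, _, f, g, rfl, rfl⟩ := composable₁ h <;>
  first
  | rfl
  | rw [← c₁_mul, ← c₁_lT, lT_comp, c₁_mul, c₁_lT, c₁_lT]

theorem rt₁_mul (h : tgt₁ p = src₁ q) : rt₁ (p * q) B = rt₁ p B * rt₁ q B := by
  obtain ⟨_, rfl | rfl, rfl | rfl⟩ | ⟨rfl, rfl⟩ | ⟨_, _, _, f, g, rfl, rfl⟩ := composable₁ h <;>
  first
  | rfl
  | rw [← c₁_mul, ← c₁_rT, rT_comp, c₁_mul, c₁_rT, c₁_rT]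

theorem lt₂_mul (h : cod₁ x = dom₁ y) : lt₂ A (x * y) = lt₂ A x * lt₂ A y := by
  obtain ⟨rfl, rfl⟩ | ⟨_, _, _, _, _, φ, ψ, rfl, rfl⟩ := composable₂ h
  · rfl
  · rw [← c₂_mul, ← c₂_lT, lT₂_comp, c₂_mul, c₂_lT, c₂_lT]

theorem rt₂_mul (h : cod₁ x = dom₁ y) : rt₂ (x * y) B = rt₂ x B * rt₂ y B := by
  obtain ⟨rfl, rfl⟩ | ⟨_, _, _, _, _, φ, ψ, rfl, rfl⟩ := composable₂ h
  · rfl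
  · rw [← c₂_mul, ← c₂_rT, rT₂_comp, c₂_mul, c₂_rT, c₂_rT]

theorem lt₂_wl (h : tgt₁ p = src₂ x) : lt₂ A (p ⋉ x) = lt₁ A p ⋉ lt₂ A x := by
  obtain ⟨rfl | rfl, rfl⟩ | ⟨_, _, _, f, _, _, φ, rfl, rfl⟩ := composable_wl h
  · rfl
  · rfl
  · rw [← c₂_wl, ← c₂_lT, lT₂_whiskerLeft, c₂_eqToHom_comp, c₂_comp_eqToHom, c₂_wl, c₁_lT, c₂_lT]

theorem rt₂_wl (h : tgt₁ p = src₂ x) : rt₂ (p ⋉ x) B = rt₁ p B ⋉ rt₂ x B := by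
  obtain ⟨rfl | rfl, rfl⟩ | ⟨_, _, _, f, _, _, φ, rfl, rfl⟩ := composable_wl h
  · rfl
  · rfl
  · rw [← c₂_wl, ← c₂_rT, rT₂_whiskerLeft, c₂_eqToHom_comp, c₂_comp_eqToHom, c₂_wl, c₁_rT, c₂_rT]

theorem lt₂_wr (h : tgt₂ x = src₁ p) : lt₂ A (x ⋊ p) = lt₂ A x ⋊ lt₁ A p := by
  obtain ⟨rfl | rfl, rfl⟩ | ⟨_, _, _, _, _, φ, f, rfl, rfl⟩ := composable_wr h
  · rfl
  · rfl
  · rw [← c₂_wr, ← c₂_lT, lT₂_whiskerRight, c₂_eqToHom_comp, c₂_comp_eqToHom, c₂_wr, c₁_lT, c₂_lT]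

theorem rt₂_wr (h : tgt₂ x = src₁ p) : rt₂ (x ⋊ p) B = rt₂ x B ⋊ rt₁ p B := by
  obtain ⟨rfl | rfl, rfl⟩ | ⟨_, _, _, _, _, φ, f, rfl, rfl⟩ := composable_wr h
  · rfl
  · rfl
  · rw [← c₂_wr, ← c₂_rT, rT₂_whiskerRight, c₂_eqToHom_comp, c₂_comp_eqToHom, c₂_wr, c₁_rT, c₂_rT]

end Distributivity

theorem c₁_asr (A B C : V) : c₁ (asr A B C) = c₁ (eqToHom (tensor_assoc A B C)) := id rfl

theorem c₁_lun (A : V) : c₁ (lun A) = c₁ (eqToHom (unit_tensor A)) := id rfl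

theorem c₁_run (A : V) : c₁ (run A) = c₁ (eqToHom (tensor_unit A)) := id rfl

theorem lt₁_eqToHom (A : V) {X Y : V} (h : X = Y) :
    lt₁ A (c₁ (eqToHom h)) = c₁ (eqToHom (congrArg (A ⊠ ·) h)) := by
  rw [← c₁_lT, lT_eqToHom]

theorem rt₁_eqToHom {X Y : V} (h : X = Y) (B : V) :
    rt₁ (c₁ (eqToHom h)) B = c₁ (eqToHom (congrArg (· ⊠ B) h)) := by
  rw [← c₁_rT, eqToHom_rT]

-- These rules define a normal form: a vertical composite, bracketed to the right, of slices `p ⋉ x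
-- ⋊ q`, with tensor products pushed inwards to the generating cells and equalities of objects
-- erased.
attribute [simp] mul_assoc₁ mul_assoc₂ wl_wl wr_wr wl_wr c₁_lT c₁_rT c₂_lT c₂_rT lt₁_lt₁ rt₁_rt₁
  rt₁_lt₁ lt₁_unit rt₁_unit lt₂_lt₂ rt₂_rt₂ rt₂_lt₂ lt₂_unit lt₂_sigInv rt₂_sigInv sigInv_rt₁
  c₂_inter c₂_inter_inv c₂_wl c₂_wr src₁_c₁ tgt₁_c₁ src₁_lt₁ tgt₁_lt₁ src₁_rt₁ tgt₁_rt₁ src₂_c₂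
  tgt₂_c₂ src₂_lt₂ tgt₂_lt₂ tgt₂_rt₂ src₂_sigInv tgt₂_sigInv dom₁_sig cod₁_sig dom₁_sigInv
  cod₁_sigInv dom₁_lt₂ cod₁_lt₂ dom₁_rt₂ cod₁_rt₂ dom₁_lt₂_rt₂ cod₁_lt₂_rt₂ c₁_eqToHom_mul
  c₁_mul_eqToHom c₁_eqToHom_wl c₂_wr_eqToHom c₁_eqToHom_mul_mul c₁_eqToHom_wl_wr lT_comp rT_comp
  lT₂_comp rT₂_comp lT₂_whiskerLeft lT₂_whiskerRight rT₂_whiskerLeft rT₂_whiskerRight eqToHom_rT₂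
  lt₁_eqToHom rt₁_eqToHom tensor_assoc unit_tensor tensor_unit c₁_asr c₁_lun c₁_run c₁_id_mul
  c₁_mul_id c₁_id_wl c₂_wr_id Strict.associator_eqToIso Strict.leftUnitor_eqToIso
  Strict.rightUnitor_eqToIso

attribute [simp] lt₁_mul rt₁_mul src₁_mul tgt₁_mul dom₁_mul cod₁_mul tgt₂_mul tgt₂_wl src₂_wr
  tgt₂_wr wl_mul mul_wr lt₂_mul rt₂_mul lt₂_wl rt₂_wl lt₂_wr rt₂_wr dom₁_wl cod₁_wl dom₁_wr
  cod₁_wr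

-- The low priority lets transports be erased before a typed composite is split.
attribute [simp low] c₁_mul c₂_mul

end GrayCells

/-! ### Transposition along the pseudoadjunction and its faithfulness -/

section Transposes

open GrayMonoid

variable {V : Type u} [Bicategory.{w, v} V] [Bicategory.Strict V] [GrayMonoid V] [RightClosed V]

/-! The structure of the closed Gray monoid as atomic cells. -/

def unitCell (A X : V) : X ⟶ inn A (X ⊠ A) := eta A X

def counitCell (A Y : V) : inn A Y ⊠ A ⟶ Y := eps A Y

def unitNat (A : V) {X Y : V} (f : X ⟶ Y) :
    f ≫ unitCell A Y ≅ unitCell A X ≫ innMap A (f ▹ A) :=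
  etaNat A f

def counitNat (A : V) {X Y : V} (f : X ⟶ Y) :
    innMap A f ▹ A ≫ counitCell A Y ≅ counitCell A X ≫ f :=
  epsNat A f

def unitTri (A X : V) : 𝟙 (X ⊠ A) ≅ unitCell A X ▹ A ≫ counitCell A (X ⊠ A) := triS A X

def counitTri (A Y : V) : unitCell A (inn A Y) ≫ innMap A (counitCell A Y) ≅ 𝟙 (inn A Y) :=
  triT A Y

section

variable (A : V) {X Y Z : V}

theorem c₁_eta (X : V) : c₁ (eta A X) = c₁ (unitCell A X) := id rfl
theorem c₁_eps (Y : V) : c₁ (eps A Y) = c₁ (counitCell A Y) := id rfl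
theorem c₂_etaNat (f : X ⟶ Y) : c₂ (etaNat A f).hom = c₂ (unitNat A f).hom := id rfl
theorem c₂_epsNat (f : X ⟶ Y) : c₂ (epsNat A f).hom = c₂ (counitNat A f).hom := id rfl
theorem c₂_epsNat_inv (f : X ⟶ Y) : c₂ (epsNat A f).inv = c₂ (counitNat A f).inv := id rfl
theorem c₂_triS (X : V) : c₂ (triS A X).hom = c₂ (unitTri A X).hom := id rfl
theorem c₂_triS_inv (X : V) : c₂ (triS A X).inv = c₂ (unitTri A X).inv := id rfl
theorem c₂_triT (Y : V) : c₂ (triT A Y).hom = c₂ (counitTri A Y).hom := id rfl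

attribute [simp] c₁_eta c₁_eps c₂_etaNat c₂_epsNat c₂_epsNat_inv c₂_triS c₂_triS_inv c₂_triT

theorem epsNat_naturality {f g : X ⟶ Y} (φ : f ⟶ g) :
    ((RightClosed.ihom A).map₂ φ ▹₂ A) ▷ eps A Y ≫ (epsNat A g).hom =
      (epsNat A f).hom ≫ eps A X ◁ φ :=
  (RightClosed.adj A).counit.naturality_naturality φ

theorem etaNat_naturality {f g : X ⟶ Y} (φ : f ⟶ g) :
    φ ▷ eta A Y ≫ (etaNat A g).hom =
      (etaNat A f).hom ≫ eta A X ◁ (RightClosed.ihom A).map₂ (φ ▹₂ A) :=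
  (RightClosed.adj A).unit.naturality_naturality φ

theorem epsNat_comp (f : X ⟶ Y) (g : Y ⟶ Z) :
    (epsNat A (f ≫ g)).hom =
      ((innMapComp A f g).hom ▹₂ A ≫ eqToHom (rT_comp _ _ A)) ▷ eps A Z ≫ (α_ _ _ _).hom ≫
        innMap A f ▹ A ◁ (epsNat A g).hom ≫ (α_ _ _ _).inv ≫ (epsNat A f).hom ▷ g ≫
        (α_ _ _ _).hom := by
  have h : (epsNat A (f ≫ g)).hom ≫ eps A X ◁ 𝟙 (f ≫ g) = _ :=
    (RightClosed.adj A).counit.naturality_comp f g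
  rw [Bicategory.whiskerLeft_id, Category.comp_id] at h
  exact h

theorem s_naturality (f : X ⟶ Y) :
    f ▹ A ◁ (triS A Y).hom ≫ (α_ _ _ _).inv ≫ eqToHom (rT_comp _ _ A).symm ▷ eps A (Y ⊠ A) ≫
      ((etaNat A f).hom ▹₂ A) ▷ eps A (Y ⊠ A) ≫ eqToHom (rT_comp _ _ A) ▷ eps A (Y ⊠ A) ≫
      (α_ _ _ _).hom ≫ eta A X ▹ A ◁ (epsNat A (f ▹ A)).hom ≫ (α_ _ _ _).inv =
    (ρ_ (f ▹ A)).hom ≫ (λ_ (f ▹ A)).inv ≫ (triS A X).hom ▷ f ▹ A :=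
  (RightClosed.adj A).s_naturality f

theorem swallowtail_counit (Y : V) :
    (λ_ (eps A Y)).inv ≫ (triS A (inn A Y)).hom ▷ eps A Y ≫ (α_ _ _ _).hom ≫
        eta A (inn A Y) ▹ A ◁ (epsNat A (eps A Y)).inv ≫ (α_ _ _ _).inv ≫
        eqToHom (rT_comp _ _ A).symm ▷ eps A Y ≫ ((triT A Y).hom ▹₂ A) ▷ eps A Y ≫
        eqToHom (rT_id _ A) ▷ eps A Y ≫ (λ_ (eps A Y)).hom =
      𝟙 (eps A Y) :=
  (RightClosed.adj A).swallowtail_counit Y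

theorem c₂_epsNat_naturality {f g : X ⟶ Y} (φ : f ⟶ g) :
    (rt₂ (c₂ ((RightClosed.ihom A).map₂ φ)) A ⋊ c₁ (counitCell A Y)) * c₂ (counitNat A g).hom =
      c₂ (counitNat A f).hom * c₁ (counitCell A X) ⋉ c₂ φ := by
  simpa using congrArg c₂ (epsNat_naturality A φ)

theorem c₂_etaNat_naturality {f g : X ⟶ Y} (φ : f ⟶ g) :
    (c₂ φ ⋊ c₁ (unitCell A Y)) * c₂ (unitNat A g).hom =
      c₂ (unitNat A f).hom * c₁ (unitCell A X) ⋉ c₂ ((RightClosed.ihom A).map₂ (φ ▹₂ A)) := by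
  simpa using congrArg c₂ (etaNat_naturality A φ)

/-- The composition constraint of `[A, -]` is moved to the left as an inverse, the form in which
`curryNat` contains it. -/
theorem c₂_epsNat_comp (f : X ⟶ Y) (g : Y ⟶ Z) :
    (rt₂ (c₂ (innMapComp A f g).inv) A ⋊ c₁ (counitCell A Z)) * c₂ (counitNat A (f ≫ g)).hom =
      rt₁ (c₁ (innMap A f)) A ⋉ c₂ (counitNat A g).hom * c₂ (counitNat A f).hom ⋊ c₁ g := by
  have h := congrArg c₂ (epsNat_comp A f g)
  simp at h
  rw [h]
  have e := slice_inv_hom_mul 1 (c₁ (counitCell A Z)) (z := rt₁ (c₁ (innMap A f)) A ⋉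
    c₂ (counitNat A g).hom * c₂ (counitNat A f).hom ⋊ c₁ g) (rTIso (innMapComp A f g) A) (by simp)
  simpa using e

/-- The modification axiom solved for `s⁻¹`, since `evCurry` is built from `s⁻¹`. -/
theorem c₂_s_naturality (f : X ⟶ Y) :
    (rt₂ (c₂ (unitNat A f).hom) A ⋊ c₁ (counitCell A (Y ⊠ A))) *
      (rt₁ (c₁ (unitCell A X)) A ⋉ c₂ (counitNat A (f ▹ A)).hom *
        c₂ (unitTri A X).inv ⋊ rt₁ (c₁ f) A) =
    rt₁ (c₁ f) A ⋉ c₂ (unitTri A Y).inv := by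
  -- Both sides are composed with `s⁻¹` at `Y` in front and with `s⁻¹` at `X` behind, which cancels
  -- the two occurrences of `s`.
  have h := congrArg (fun t => rt₁ (c₁ f) A ⋉ c₂ (unitTri A Y).inv *
    (t * c₂ (unitTri A X).inv ⋊ rt₁ (c₁ f) A)) (congrArg c₂ (s_naturality A f))
  have e := slice_hom_inv 1 (rt₁ (c₁ f) A) (unitTri A X)
  have e' := fun z => slice_inv_hom_mul (rt₁ (c₁ f) A) 1 z (unitTri A Y)
  simp at h e e'
  rwa [e, e', mul_idc] at h
  · simp
  · simp

/-- The swallowtail equation solved for the transpose of `t`; its right side is the formula for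
`evCurry` at `ε`. -/
theorem c₂_swallowtail_counit (Y : V) :
    rt₂ (c₂ (counitTri A Y).hom) A ⋊ c₁ (counitCell A Y) =
      rt₁ (c₁ (unitCell A (inn A Y))) A ⋉ c₂ (counitNat A (counitCell A Y)).hom *
        c₂ (unitTri A (inn A Y)).inv ⋊ c₁ (counitCell A Y) := by
  have h := congrArg (fun t => rt₁ (c₁ (unitCell A (inn A Y))) A ⋉
    c₂ (counitNat A (counitCell A Y)).hom * (c₂ (unitTri A (inn A Y)).inv ⋊ c₁ (counitCell A Y) *
      t)) (congrArg c₂ (swallowtail_counit A Y))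
  have e := fun z => slice_inv_hom_mul 1 (c₁ (counitCell A Y)) z (unitTri A (inn A Y))
  have e' := fun z => slice_hom_inv_mul (rt₁ (c₁ (unitCell A (inn A Y))) A) 1 z
    (counitNat A (counitCell A Y))
  have e₂ : c₂ (counitNat A (eps A Y)).inv = c₂ (counitNat A (counitCell A Y)).inv := rfl
  have e₃ : c₂ (𝟙 (eps A Y)) = idc (c₁ (counitCell A Y)) := rfl
  simp [e₂, e₃] at h e e'
  rwa [e, e', mul_idc] at h
  · simp
  · simp
  · simp

end

/-! Transposition `p ↦ ε ∘ (p ⊗ A)` -/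

variable {A X Y Z : V}

theorem c₂_evCurry (k : X ⊠ A ⟶ Y) :
    c₂ (evCurry k).hom =
      rt₁ (c₁ (unitCell A X)) A ⋉ c₂ (counitNat A k).hom * c₂ (unitTri A X).inv ⋊ c₁ k := by
  simp [evCurry]

/-- Naturality of the pseudonaturality cells of `ε` in 2-cells, followed by sliding `φ` past `s⁻¹`.
-/
theorem c₂_evCurry_naturality {k l : X ⊠ A ⟶ Y} (φ : k ≅ l) :
    (rt₂ (c₂ (curryIso φ).hom) A ⋊ c₁ (counitCell A Y)) * c₂ (evCurry l).hom =
      c₂ (evCurry k).hom * c₂ φ.hom := by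
  have h := congrArg (rt₁ (c₁ (unitCell A X)) A ⋉ ·) (c₂_epsNat_naturality A φ.hom)
  have e := slice_swap 1 1 1 (c₂ (unitTri A X).inv) (c₂ φ.hom)
  simp at h e
  simp [c₂_evCurry, mul_reassoc h, e]

/-- The pseudonaturality of `ε` at the composite `h ▹ A ≫ k` splits into its two factors; the factor
at `h ▹ A` cancels against the pseudonaturality of `η` because `s` is a modification. -/
theorem c₂_evCurry_curryNat (h : Z ⟶ X) (k : X ⊠ A ⟶ Y) :
    (rt₂ (c₂ (curryNat h k).hom) A ⋊ c₁ (counitCell A Y)) * c₂ (evCurry (h ▹ A ≫ k)).hom =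
      rt₁ (c₁ h) A ⋉ c₂ (evCurry k).hom := by
  have e := congrArg (rt₁ (c₁ (unitCell A Z)) A ⋉ ·) (c₂_epsNat_comp A (h ▹ A) k)
  have e' := congrArg (· ⋊ c₁ k) (c₂_s_naturality A h)
  have e₂ := slice_swap' 1 1 1 (rt₂ (c₂ (unitNat A h).hom) A) (c₂ (counitNat A k).hom)
  simp at e e' e₂
  simp [c₂_evCurry, curryNat, mul_reassoc e, e₂, e']

theorem c₂_evCurry_congr {k l : X ⊠ A ⟶ Y} (h : k = l) :
    c₂ (evCurry k).hom = c₂ (evCurry l).hom := by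
  rw [h]

/-- Once the equality of objects is eliminated, this is the swallowtail equation. It is the property
of `t` through which the unitors are evaluated. -/
theorem c₂_curryEps {a b : V} (h : X = inn a b) :
    (rt₂ (c₂ (curryEps h).hom) a ⋊ c₁ (counitCell a b)) =
      c₂ (evCurry (eqToHom h ▹ a ≫ eps a b)).hom := by
  have e := c₂_swallowtail_counit a b
  subst h
  rw [c₂_evCurry_congr (l := counitCell a b) (by simp [rT_id, counitCell])]
  rw [c₂_evCurry, ← e]
  dsimp only [curryEps]
  simp only [Iso.trans_hom, eqToIso.hom, whiskerLeftIso_hom, c₂_eqToHom_comp, c₂_comp_eqToHom]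
  simp

theorem map₂_wr {f g : Z ⟶ X} (φ : f ⟶ g) (k : X ⟶ Y) :
    (RightClosed.ihom A).map₂ (φ ▷ k) =
      (innMapComp A f k).hom ≫ (RightClosed.ihom A).map₂ φ ▷ innMap A k ≫
        (innMapComp A g k).inv := by
  simp

/-- `curryNat` is natural in the 1-cell that is transposed. -/
theorem c₂_curryNat_naturality {f g : Z ⟶ X} (φ : f ⟶ g) (k : X ⊠ A ⟶ Y) :
    (c₂ φ ⋊ c₁ (curry k)) * c₂ (curryNat g k).hom =
      c₂ (curryNat f k).hom *
        c₁ (unitCell A Z) ⋉ c₂ ((RightClosed.ihom A).map₂ (φ ▹₂ A ▷ k)) := by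
  have e := congrArg (· ⋊ c₁ (innMap A k)) (c₂_etaNat_naturality A φ)
  have e' := fun z => slice_inv_hom_mul (c₁ (unitCell A Z)) 1 z (innMapComp A (f ▹ A) k)
  rw [map₂_wr]
  simp at e e'
  simp [curryNat, mul_reassoc e]
  rw [e']
  simp

/-- Transposition is faithful. -/
theorem ev_injective {f g : Z ⟶ inn A Y} {φ ψ : f ⟶ g}
    (h : rt₂ (c₂ φ) A ⋊ c₁ (counitCell A Y) = rt₂ (c₂ ψ) A ⋊ c₁ (counitCell A Y)) : φ = ψ := by
  have h' : φ ▹₂ A ▷ counitCell A Y = ψ ▹₂ A ▷ counitCell A Y := c₂_injective (by simpa using h)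
  -- Naturality of `curryNat` expresses this whiskering through the transpose of `φ` and invertible
  -- cells alone.
  have e : φ ▷ curry (counitCell A Y) = ψ ▷ curry (counitCell A Y) := by
    refine c₂_cancel_right (curryNat g (counitCell A Y)).hom rfl ?_
    rw [c₂_wr, c₂_wr, c₂_curryNat_naturality, c₂_curryNat_naturality, h']
  -- Sliding past the invertible `t : [1, ε] ∘ η ⇒ id` recovers `φ` from its whiskering with `[1, ε]
  -- ∘ η`.
  have e' := fun χ : f ⟶ g => slice_swap 1 1 1 (c₂ χ) (c₂ (counitTri A Y).hom)
  have e₂ := congrArg c₂ e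
  refine c₂_cancel_left (f ◁ (counitTri A Y).hom) ?_ ?_
  · simp
  simp at e' e₂
  simp [← e', e₂]

end Transposes

/-! ### Transposes of the structure 2-cells -/

section Evaluation

open GrayMonoid

variable {V : Type u} [Bicategory.{w, v} V] [Bicategory.Strict V] [GrayMonoid V] [RightClosed V]

variable {A X Y Z : V}

/-- The common first half of the structure cells except the unitor of `C(a, -)`. Under evaluation
`ι` and `curryNat` together become `ν`, and `curryIso θ` becomes `θ`. Passing `ν` separately with
`hν` keeps cells such as `evComp` folded. -/
theorem c₂_ev_transpose {h : Z ⟶ X} {p : X ⟶ inn A Y} {k : X ⊠ A ⟶ Y} {l : Z ⊠ A ⟶ Y}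
    (ι : p ≅ curry k) {ν : p ▹ A ≫ eps A Y ≅ k}
    (hν : whiskerRightIso (rTIso ι A) (eps A Y) ≪≫ evCurry k = ν) (θ : h ▹ A ≫ k ≅ l) :
    (rt₂ (c₂ (whiskerLeftIso h ι ≪≫ curryNat h k ≪≫ curryIso θ).hom) A ⋊ c₁ (counitCell A Y)) *
        c₂ (evCurry l).hom =
      (rt₁ (c₁ h) A ⋉ c₂ ν.hom) *
        c₂ θ.hom := by
  subst hν
  have e := c₂_evCurry_naturality θ
  have e' := c₂_evCurry_curryNat h k
  simp at e e'
  simp [e, mul_reassoc_of_eq e']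

theorem c₂_ev_comp {f g k : Z ⟶ inn A Y} (φ : f ⟶ g) (ψ : g ⟶ k) :
    rt₂ (c₂ (φ ≫ ψ)) A ⋊ c₁ (counitCell A Y) =
      (rt₂ (c₂ φ) A ⋊ c₁ (counitCell A Y)) * (rt₂ (c₂ ψ) A ⋊ c₁ (counitCell A Y)) := by
  rw [← c₂_rT, ← c₂_rT, ← c₂_rT, ← c₂_wr, ← c₂_wr, ← c₂_wr, ← c₂_mul, ← comp_whiskerRight,
    ← rT₂_comp]

/-- A cell of the form `S ≫ T⁻¹` is described by its composite with `T`, so that the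
characterisations below contain no inverse of `T`. -/
theorem c₂_ev_trans_symm {f g k : Z ⟶ inn A Y} (S : f ≅ k) (T : g ≅ k) :
    (rt₂ (c₂ (S ≪≫ T.symm).hom) A ⋊ c₁ (counitCell A Y)) *
        (rt₂ (c₂ T.hom) A ⋊ c₁ (counitCell A Y)) =
      rt₂ (c₂ S.hom) A ⋊ c₁ (counitCell A Y) := by
  rw [← c₂_ev_comp]
  simp only [Iso.trans_hom, Iso.symm_hom, Category.assoc, Iso.inv_hom_id, Category.comp_id]

theorem c₂_ev_compare {X' : V} {g : Z ⟶ inn A Y} {h : Z ⟶ X} {p : X ⟶ inn A Y} {k : X ⊠ A ⟶ Y}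
    {h' : Z ⟶ X'} {p' : X' ⟶ inn A Y} {k' : X' ⊠ A ⟶ Y} {l : Z ⊠ A ⟶ Y}
    (ι : p ≅ curry k) {ν : p ▹ A ≫ eps A Y ≅ k}
    (hν : whiskerRightIso (rTIso ι A) (eps A Y) ≪≫ evCurry k = ν) (θ : h ▹ A ≫ k ≅ l)
    (ι' : p' ≅ curry k') {ν' : p' ▹ A ≫ eps A Y ≅ k'}
    (hν' : whiskerRightIso (rTIso ι' A) (eps A Y) ≪≫ evCurry k' = ν') (θ' : h' ▹ A ≫ k' ≅ l)
    (e : g = h' ≫ p') :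
    (rt₂ (c₂ ((whiskerLeftIso h ι ≪≫ curryNat h k ≪≫ curryIso θ) ≪≫
        (eqToIso e ≪≫ whiskerLeftIso h' ι' ≪≫ curryNat h' k' ≪≫ curryIso θ').symm).hom) A ⋊
          c₁ (counitCell A Y)) * ((rt₁ (c₁ h') A ⋉ c₂ ν'.hom) * c₂ θ'.hom) =
      (rt₁ (c₁ h) A ⋉ c₂ ν.hom) * c₂ θ.hom := by
  subst e
  rw [← c₂_ev_transpose ι hν θ, ← c₂_ev_transpose ι' hν' θ', ← mul_assoc₂, eqToIso_refl,
    Iso.refl_trans, c₂_ev_trans_symm]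

theorem c₂_ev_compare_curryNat {X' : V} {h : Z ⟶ X} {p : X ⟶ inn A Y} {k : X ⊠ A ⟶ Y}
    {h' : Z ⟶ X'} {k' : X' ⊠ A ⟶ Y} (ι : p ≅ curry k) {ν : p ▹ A ≫ eps A Y ≅ k}
    (hν : whiskerRightIso (rTIso ι A) (eps A Y) ≪≫ evCurry k = ν) (θ : h ▹ A ≫ k ≅ h' ▹ A ≫ k') :
    (rt₂ (c₂ (whiskerLeftIso h ι ≪≫ curryNat h k ≪≫ curryIso θ ≪≫
        (curryNat h' k').symm).hom) A ⋊ c₁ (counitCell A Y)) *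
          (rt₁ (c₁ h') A ⋉ c₂ (evCurry k').hom) =
      (rt₁ (c₁ h) A ⋉ c₂ ν.hom) * c₂ θ.hom := by
  have e := c₂_ev_trans_symm (whiskerLeftIso h ι ≪≫ curryNat h k ≪≫ curryIso θ) (curryNat h' k')
  simp only [Iso.trans_assoc] at e
  rw [← c₂_ev_transpose ι hν θ, ← c₂_evCurry_curryNat, ← mul_assoc₂, e]

theorem c₂_ev_curryIso_curryNat {p : Z ⟶ inn A Y} {k : Z ⊠ A ⟶ Y} {h' : Z ⟶ X}
    {k' : X ⊠ A ⟶ Y} (ι : p ≅ curry k) {ν : p ▹ A ≫ eps A Y ≅ k}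
    (hν : whiskerRightIso (rTIso ι A) (eps A Y) ≪≫ evCurry k = ν) (θ : k ≅ h' ▹ A ≫ k') :
    (rt₂ (c₂ (ι ≪≫ curryIso θ ≪≫ (curryNat h' k').symm).hom) A ⋊ c₁ (counitCell A Y)) *
          (rt₁ (c₁ h') A ⋉ c₂ (evCurry k').hom) =
      c₂ ν.hom * c₂ θ.hom := by
  subst hν
  have e := c₂_ev_trans_symm (ι ≪≫ curryIso θ) (curryNat h' k')
  rw [Iso.trans_assoc] at e
  rw [← c₂_evCurry_curryNat, ← mul_assoc₂, e, Iso.trans_hom, c₂_ev_comp, mul_assoc₂,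
    c₂_evCurry_naturality]
  simp

theorem c₂_ev_compare_curryEps {h : Z ⟶ X} {p : X ⟶ inn A Y} {k : X ⊠ A ⟶ Y} (e : Z = inn A Y)
    (ι : p ≅ curry k) {ν : p ▹ A ≫ eps A Y ≅ k}
    (hν : whiskerRightIso (rTIso ι A) (eps A Y) ≪≫ evCurry k = ν)
    (θ : h ▹ A ≫ k ≅ eqToHom e ▹ A ≫ eps A Y) :
    rt₂ (c₂ (whiskerLeftIso h ι ≪≫ curryNat h k ≪≫ curryIso θ ≪≫ curryEps e).hom) A ⋊
        c₁ (counitCell A Y) =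
      (rt₁ (c₁ h) A ⋉ c₂ ν.hom) * c₂ θ.hom := by
  rw [← c₂_ev_transpose ι hν θ, ← c₂_curryEps, ← c₂_ev_comp]
  simp only [Iso.trans_hom, Category.assoc]

/-- The two ways of reducing the evaluation of a threefold composite to iterated evaluation differ
by the associator. The interchanger appears because the left bracketing composes the outer maps
before the argument is evaluated. -/
theorem c₂_ev_selfAssoc (a b c d : V) :
    (rt₂ (c₂ (selfAssoc a b c d).hom) a ⋊ c₁ (counitCell a d)) *
      (lt₁ (inn c d) (rt₁ (c₁ (selfComp a b c)) a) ⋉ c₂ (evComp a c d).hom *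
        lt₂ (inn c d) (c₂ (evComp a b c).hom) ⋊ c₁ (counitCell c d)) =
    (rt₁ (c₁ (selfComp b c d)) (inn a b ⊠ a) ⋉ c₂ (evComp a b d).hom *
      (sigInv (c₁ (selfComp b c d)) (c₁ (counitCell a b)) ⋊ c₁ (counitCell b d) *
        lt₁ (inn c d ⊠ inn b c) (c₁ (counitCell a b)) ⋉ c₂ (evComp b c d).hom)) := by
  have e : rt₂ (c₂ (selfAssoc a b c d).hom) a ⋊ c₁ (counitCell a d) * _ = _ :=
    c₂_ev_compare (selfCompIso a b d) (ν := evComp a b d) rfl _ (selfCompIso a c d)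
      (ν' := evComp a c d) rfl _ _
  simpa using e

theorem c₂_ev_selfLam (a b : V) :
    rt₂ (c₂ (selfLam a b).hom) a ⋊ c₁ (counitCell a b) =
      rt₁ (c₁ (selfUnit b)) (inn a b ⊠ a) ⋉ c₂ (evComp a b b).hom *
        (sigInv (c₁ (selfUnit b)) (c₁ (counitCell a b)) ⋊ c₁ (counitCell b b) *
          c₁ (counitCell a b) ⋉ c₂ (evUnit b).hom) := by
  have e : rt₂ (c₂ (selfLam a b).hom) a ⋊ c₁ (counitCell a b) = _ :=
    c₂_ev_compare_curryEps (h := selfUnit b ▹ inn a b) (unit_tensor _) (selfCompIso a b b)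
      (ν := evComp a b b) rfl _
  simpa using e

theorem c₂_ev_selfRho (a b : V) :
    rt₂ (c₂ (selfRho a b).hom) a ⋊ c₁ (counitCell a b) =
      lt₁ (inn a b) (rt₁ (c₁ (selfUnit a)) a) ⋉ c₂ (evComp a a b).hom *
        lt₂ (inn a b) (c₂ (evUnit a).hom) ⋊ c₁ (counitCell a b) := by
  have e : rt₂ (c₂ (selfRho a b).hom) a ⋊ c₁ (counitCell a b) = _ :=
    c₂_ev_compare_curryEps (h := inn a b ◃ selfUnit a) (tensor_unit _) (selfCompIso a a b)
      (ν := evComp a a b) rfl _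
  simpa using e

variable (C : EnrichedBicategoryData.{w, v, u, u₁} V)

/-- The compositor contains `α⁻¹`; composing with `α` on the left cancels it and leaves a statement
without inverses of structure cells of `C`. -/
theorem c₂_ev_homComp (a b c d : C.Obj) :
    (rt₂ (c₂ (homComp C a b c d).hom) (C.hom a b) ⋊ c₁ (counitCell (C.hom a b) (C.hom a d))) *
      (rt₁ (c₁ (C.m b c d)) (C.hom a b) ⋉ c₂ (evHom C a b d).hom * c₂ (C.assoc a b c d).hom) =
    (rt₁ (c₁ (homMap C a c d)) (C.hom b c ⊠ C.hom a b) *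
          lt₁ (inn (C.hom a c) (C.hom a d)) (rt₁ (c₁ (homMap C a b c)) (C.hom a b))) ⋉
        c₂ (evComp (C.hom a b) (C.hom a c) (C.hom a d)).hom *
      (rt₁ (c₁ (homMap C a c d)) (C.hom b c ⊠ C.hom a b) ⋉
          lt₂ (inn (C.hom a c) (C.hom a d)) (c₂ (evHom C a b c).hom) ⋊
            c₁ (counitCell (C.hom a c) (C.hom a d)) *
        (sigInv (c₁ (homMap C a c d)) (c₁ (C.m a b c)) ⋊ c₁ (counitCell (C.hom a c) (C.hom a d)) *
          lt₁ (C.hom c d) (c₁ (C.m a b c)) ⋉ c₂ (evHom C a c d).hom)) := by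
  have e : rt₂ (c₂ (homComp C a b c d).hom) (C.hom a b) ⋊ _ *
      (rt₁ (c₁ (C.m b c d)) (C.hom a b) ⋉ c₂ (evHom C a b d).hom) = _ :=
    c₂_ev_compare_curryNat (h := tens (homMap C a c d) (homMap C a b c)) (h' := C.m b c d)
      (k' := C.m a b d) (selfCompIso _ _ _) (ν := evComp (C.hom a b) (C.hom a c) (C.hom a d)) rfl _
  have e' := congrArg (· * c₂ (C.assoc a b c d).hom) e
  have e₂ := slice_inv_hom 1 1 (C.assoc a b c d)
  simp at e' e₂
  rw [e', e₂, mul_idc]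
  simp

theorem c₂_ev_homUnit (a b : C.Obj) :
    (rt₂ (c₂ (homUnit C a b).hom) (C.hom a b) ⋊ c₁ (counitCell (C.hom a b) (C.hom a b))) *
      (rt₁ (c₁ (C.u b)) (C.hom a b) ⋉ c₂ (evHom C a b b).hom * c₂ (C.lam a b).hom) =
    c₂ (evUnit (C.hom a b)).hom := by
  have e : rt₂ (c₂ (homUnit C a b).hom) (C.hom a b) ⋊ _ *
      (rt₁ (c₁ (C.u b)) (C.hom a b) ⋉ c₂ (evHom C a b b).hom) = _ :=
    c₂_ev_curryIso_curryNat (h' := C.u b) (k' := C.m a b b) (selfUnitIso (C.hom a b))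
      (ν := evUnit (C.hom a b)) rfl (C.lam a b).symm
  have e' := congrArg (· * c₂ (C.lam a b).hom) e
  have e₂ := slice_inv_hom 1 1 (C.lam a b)
  simp at e' e₂
  rw [e', e₂, mul_idc]
  simp

end Evaluation

/-! ### The axioms of a `V`-bicategory for untyped cells -/

section Coherence

open GrayMonoid

variable {V : Type u} [Bicategory.{w, v} V] [Bicategory.Strict V] [GrayMonoid V]

variable (C : EnrichedBicategoryData.{w, v, u, u₁} V)

/-- The hypotheses are the triangle and pentagon with transports and equalities of objects erased;
the converse passages are `cell_identity` and `cell_associativity`. -/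
theorem isCoherent_of_cells
    (h : ∀ c d e,
      lt₁ (C.hom d e) (rt₁ (c₁ (C.u d)) (C.hom c d)) ⋉ c₂ (C.assoc c d d e).hom *
        lt₂ (C.hom d e) (c₂ (C.lam c d).hom) ⋊ c₁ (C.m c d e) =
      rt₂ (c₂ (C.rho d e).hom) (C.hom c d) ⋊ c₁ (C.m c d e))
    (h' : ∀ c d e f g,
      rt₂ (c₂ (C.assoc d e f g).hom) (C.hom c d) ⋊ c₁ (C.m c d g) *
        (lt₁ (C.hom f g) (rt₁ (c₁ (C.m d e f)) (C.hom c d)) ⋉ c₂ (C.assoc c d f g).hom *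
          lt₂ (C.hom f g) (c₂ (C.assoc c d e f).hom) ⋊ c₁ (C.m c f g)) =
      rt₁ (c₁ (C.m e f g)) (C.hom d e ⊠ C.hom c d) ⋉ c₂ (C.assoc c d e g).hom *
        (sigInv (c₁ (C.m e f g)) (c₁ (C.m c d e)) ⋊ c₁ (C.m c e g) *
          lt₁ (C.hom f g ⊠ C.hom e f) (c₁ (C.m c d e)) ⋉ c₂ (C.assoc c e f g).hom)) :
    C.IsCoherent where
  identity c d e := c₂_injective (by simpa using h c d e)
  associativity c d e f g := c₂_injective (by simpa using h' c d e f g)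

variable {C}

theorem EnrichedBicategoryData.IsCoherent.cell_identity (h : C.IsCoherent) (c d e : C.Obj) :
    lt₁ (C.hom d e) (rt₁ (c₁ (C.u d)) (C.hom c d)) ⋉ c₂ (C.assoc c d d e).hom *
        lt₂ (C.hom d e) (c₂ (C.lam c d).hom) ⋊ c₁ (C.m c d e) =
      rt₂ (c₂ (C.rho d e).hom) (C.hom c d) ⋊ c₁ (C.m c d e) := by
  simpa using congrArg c₂ (h.identity c d e)

theorem EnrichedBicategoryData.IsCoherent.cell_associativity (h : C.IsCoherent)
    (c d e f g : C.Obj) :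
    rt₂ (c₂ (C.assoc d e f g).hom) (C.hom c d) ⋊ c₁ (C.m c d g) *
        (lt₁ (C.hom f g) (rt₁ (c₁ (C.m d e f)) (C.hom c d)) ⋉ c₂ (C.assoc c d f g).hom *
          lt₂ (C.hom f g) (c₂ (C.assoc c d e f).hom) ⋊ c₁ (C.m c f g)) =
      rt₁ (c₁ (C.m e f g)) (C.hom d e ⊠ C.hom c d) ⋉ c₂ (C.assoc c d e g).hom *
        (sigInv (c₁ (C.m e f g)) (c₁ (C.m c d e)) ⋊ c₁ (C.m c e g) *
          lt₁ (C.hom f g ⊠ C.hom e f) (c₁ (C.m c d e)) ⋉ c₂ (C.assoc c e f g).hom) := by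
  simpa using congrArg c₂ (h.associativity c d e f g)

end Coherence

/-! ### Cancellation of whiskered invertible 2-cells -/

section Cancellation

variable {V : Type u} [Bicategory.{w, v} V] [Bicategory.Strict V]

theorem slice_cancel_right {X Y : V} {f g : X ⟶ Y} (p q : Cell₁ V) (χ : f ≅ g) {x y : Cell₂ V}
    (hx : cod₁ x = p * (c₁ f * q)) (hy : cod₁ y = p * (c₁ f * q))
    (h : x * p ⋉ c₂ χ.hom ⋊ q = y * p ⋉ c₂ χ.hom ⋊ q) : x = y := by
  have h' := congrArg (· * p ⋉ c₂ χ.inv ⋊ q) h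
  simpa only [mul_assoc₂, slice_hom_inv, mul_idc hx, mul_idc hy] using h'

theorem slice_cancel_left {X Y : V} {f g : X ⟶ Y} (p q : Cell₁ V) (χ : f ≅ g) {x y : Cell₂ V}
    (hx : dom₁ x = p * (c₁ g * q)) (hy : dom₁ y = p * (c₁ g * q))
    (h : p ⋉ c₂ χ.hom ⋊ q * x = p ⋉ c₂ χ.hom ⋊ q * y) : x = y := by
  have h' := congrArg (p ⋉ c₂ χ.inv ⋊ q * ·) h
  simpa only [← mul_assoc₂, slice_inv_hom, idc_mul hx, idc_mul hy] using h'

end Cancellation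

/-! ### Triangle and pentagon for the self-enrichment -/

section SelfCoherence

open GrayMonoid

variable {V : Type u} [Bicategory.{w, v} V] [Bicategory.Strict V] [GrayMonoid V] [RightClosed V]

/-- The condition `ht` excludes the zero cell for `x`, and `hd` then excludes it for `y`. -/
theorem ev_injective_cell {A Y : V} {x y : Cell₂ V} (hd : dom₁ x = dom₁ y) (hc : cod₁ x = cod₁ y)
    (ht : tgt₂ x = some (inn A Y))
    (h : rt₂ x A ⋊ c₁ (counitCell A Y) = rt₂ y A ⋊ c₁ (counitCell A Y)) : x = y := by
  induction x using Cell₂.cases' with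
  | h0 => cases ht
  | hm φ =>
  cases ht
  induction y using Cell₂.cases' with
  | h0 => cases hd
  | hm ψ =>
  obtain ⟨rfl, rfl, hf⟩ := c₁_eq_iff.1 hd
  obtain rfl := eq_of_heq hf
  obtain rfl := eq_of_heq (c₁_eq_iff.1 hc).2.2
  rw [ev_injective h]

theorem ev_self_identity (c d e : V) :
    rt₂ (lt₁ (inn d e) (rt₁ (c₁ (selfUnit d)) (inn c d)) ⋉ c₂ (selfAssoc c d d e).hom *
        lt₂ (inn d e) (c₂ (selfLam c d).hom) ⋊ c₁ (selfComp c d e)) c ⋊ c₁ (counitCell c e) =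
      rt₂ (rt₂ (c₂ (selfRho d e).hom) (inn c d) ⋊ c₁ (selfComp c d e)) c ⋊ c₁ (counitCell c e) := by
  -- The appended `evComp` supplies the cell needed to apply the characterisation of the associator,
  -- once the left unitor has slid past it.
  refine slice_cancel_right 1 1 (evComp c d e) (by simp) (by simp) ?_
  have e₁ := fun z => congrArg (fun t => lt₁ (inn d e) (rt₁ (c₁ (selfUnit d))
    (inn c d ⊠ c)) ⋉ t * z)
    (c₂_ev_selfAssoc c d d e)
  have e₂ := congrArg (lt₁ (inn d e) (c₁ (counitCell c d)) ⋉ ·) (c₂_ev_selfRho d e)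
  have e₃ := congrArg (fun t => lt₂ (inn d e) t ⋊ c₁ (counitCell d e)) (c₂_ev_selfLam c d)
  have s₁ := slice_swap 1 1 1 (lt₂ (inn d e) (rt₂ (c₂ (selfLam c d).hom) c)) (c₂ (evComp c d e).hom)
  have s₂ := slice_swap 1 1 1 (rt₂ (c₂ (selfRho d e).hom) (inn c d ⊠ c)) (c₂ (evComp c d e).hom)
  have s₃ := fun z => slice_swap' 1 1 1
    (sigInv (lt₁ (inn d e) (c₁ (selfUnit d))) (c₁ (counitCell c d))) (c₂ (evComp d d e).hom) z
  -- The codomain of the right unitor is an equality of objects, whose interchanger with `ε` is an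
  -- identity; naturality therefore leaves no interchanger on that side.
  have n := congrArg (· ⋊ c₁ (counitCell d e))
    (sigInv_naturality_left (selfRho d e).hom (counitCell c d))
  simp (maxDischargeDepth := 6) [sigInv_mul_left, c₁_run, sigInv_eqToHom_left, mul_idc]
    at e₁ e₂ e₃ s₁ s₂ s₃ n ⊢
  rw [s₁, e₃, s₂, e₁, ← s₃, n, e₂]

theorem ev_self_associativity (c d e f g : V) :
    rt₂ (rt₂ (c₂ (selfAssoc d e f g).hom) (inn c d) ⋊ c₁ (selfComp c d g) *
        (lt₁ (inn f g) (rt₁ (c₁ (selfComp d e f)) (inn c d)) ⋉ c₂ (selfAssoc c d f g).hom *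
          lt₂ (inn f g) (c₂ (selfAssoc c d e f).hom) ⋊ c₁ (selfComp c f g))) c ⋊
            c₁ (counitCell c g) =
    rt₂ (rt₁ (c₁ (selfComp e f g)) (inn d e ⊠ inn c d) ⋉ c₂ (selfAssoc c d e g).hom *
        (sigInv (c₁ (selfComp e f g)) (c₁ (selfComp c d e)) ⋊ c₁ (selfComp c e g) *
          lt₁ (inn f g ⊠ inn e f) (c₁ (selfComp c d e)) ⋉ c₂ (selfAssoc c e f g).hom)) c ⋊
            c₁ (counitCell c g) := by
  -- The three cells appended here and below continue the right-bracketed composite to the fourfold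
  -- iterated evaluation. Each of the five associators can then be brought against the cells in its
  -- characterisation.
  refine slice_cancel_right (lt₁ (inn f g) (lt₁ (inn e f) (rt₁ (c₁ (selfComp c d e)) c) *
    rt₁ (c₁ (selfComp c e f)) c)) 1 (evComp c f g) (by simp (maxDischargeDepth := 6))
    (by simp (maxDischargeDepth := 6)) ?_
  refine slice_cancel_right (lt₁ (inn f g) (lt₁ (inn e f) (rt₁ (c₁ (selfComp c d e)) c)))
    (c₁ (counitCell f g)) (lTIso (inn f g) (evComp c e f)) (by simp (maxDischargeDepth := 6))
    (by simp (maxDischargeDepth := 6)) ?_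
  refine slice_cancel_right 1 (lt₁ (inn f g) (c₁ (counitCell e f)) * c₁ (counitCell f g))
    (lTIso (inn f g) (lTIso (inn e f) (evComp c d e))) (by simp (maxDischargeDepth := 6))
    (by simp (maxDischargeDepth := 6)) ?_
  -- the characterisations
  have a₁ := fun z => congrArg (fun t => lt₁ (inn f g) (rt₁ (c₁ (selfComp d e f))
    (inn c d ⊠ c)) ⋉ t * z)
    (c₂_ev_selfAssoc c d f g)
  have a₂ := congrArg (fun t => lt₁ (inn f g ⊠ inn e f ⊠ inn d e) (c₁ (counitCell c d)) ⋉ t)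
    (c₂_ev_selfAssoc d e f g)
  have a₃ := congrArg (fun t => lt₂ (inn f g) t ⋊ c₁ (counitCell f g)) (c₂_ev_selfAssoc c d e f)
  have a₄ := fun z => congrArg (fun t => lt₁ (inn f g ⊠ inn e f) (rt₁
    (c₁ (selfComp c d e)) c) ⋉ t * z) (c₂_ev_selfAssoc c e f g)
  have a₅ := fun z => congrArg (fun t => rt₁ (c₁ (selfComp e f g))
    (inn d e ⊠ inn c d ⊠ c) ⋉ t * z) (c₂_ev_selfAssoc c d e g)
  -- left-hand side
  have s₁ := fun z => slice_swap' 1 1 1 (lt₂ (inn f g) (rt₂ (c₂ (selfAssoc c d e f).hom) c))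
    (c₂ (evComp c f g).hom) z
  have s₂ := fun z => slice_swap' 1 1 1 (rt₂ (c₂ (selfAssoc d e f g).hom) (inn c d ⊠ c))
    (c₂ (evComp c d g).hom) z
  have s₃ := fun z => slice_swap' 1 1 1
    (sigInv (lt₁ (inn f g) (c₁ (selfComp d e f))) (c₁ (counitCell c d))) (c₂ (evComp d f g).hom) z
  have n₁ := fun z => congrArg (fun t => t ⋊ c₁ (counitCell d g) * z)
    (sigInv_naturality_left (selfAssoc d e f g).hom (counitCell c d))
  -- right-hand side
  have s₄ := fun z => slice_swap' 1 1 1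
    (sigInv (c₁ (selfComp e f g)) (rt₁ (c₁ (selfComp c d e)) c)) (c₂ (evComp c e g).hom) z
  have s₅ := slice_swap 1 1 1 (lt₂ (inn f g ⊠ inn e f) (c₂ (evComp c d e).hom))
    (c₂ (evComp e f g).hom)
  have s₆ := fun z => slice_swap' 1 1 1
    (sigInv (c₁ (selfComp e f g)) (lt₁ (inn d e) (c₁ (counitCell c d)))) (c₂ (evComp d e g).hom) z
  have n₂ := fun z => congrArg (fun t => t ⋊ c₁ (counitCell e g) * z)
    (sigInv_naturality_right (selfComp e f g) (evComp c d e).hom)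
  simp (maxDischargeDepth := 6) [sigInv_mul_left, sigInv_mul_right]
    at a₁ a₂ a₃ a₄ a₅ s₁ s₂ s₃ s₄ s₅ s₆ n₁ n₂ ⊢
  rw [s₁, a₃, a₁, s₂, ← s₃, n₁, a₂, a₄, s₄, ← s₅, ← n₂, a₅, s₆]

theorem self_identity (c d e : V) :
    lt₁ (inn d e) (rt₁ (c₁ (selfUnit d)) (inn c d)) ⋉ c₂ (selfAssoc c d d e).hom *
        lt₂ (inn d e) (c₂ (selfLam c d).hom) ⋊ c₁ (selfComp c d e) =
      rt₂ (c₂ (selfRho d e).hom) (inn c d) ⋊ c₁ (selfComp c d e) :=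
  ev_injective_cell (A := c) (Y := e) (by simp) (by simp) (by simp) (ev_self_identity c d e)

theorem self_associativity (c d e f g : V) :
    rt₂ (c₂ (selfAssoc d e f g).hom) (inn c d) ⋊ c₁ (selfComp c d g) *
        (lt₁ (inn f g) (rt₁ (c₁ (selfComp d e f)) (inn c d)) ⋉ c₂ (selfAssoc c d f g).hom *
          lt₂ (inn f g) (c₂ (selfAssoc c d e f).hom) ⋊ c₁ (selfComp c f g)) =
      rt₁ (c₁ (selfComp e f g)) (inn d e ⊠ inn c d) ⋉ c₂ (selfAssoc c d e g).hom *
        (sigInv (c₁ (selfComp e f g)) (c₁ (selfComp c d e)) ⋊ c₁ (selfComp c e g) *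
          lt₁ (inn f g ⊠ inn e f) (c₁ (selfComp c d e)) ⋉ c₂ (selfAssoc c e f g).hom) := by
  refine ev_injective_cell (A := c) (Y := g) (by simp (maxDischargeDepth := 6))
    (by simp (maxDischargeDepth := 6)) (by simp (maxDischargeDepth := 6)) ?_
  exact ev_self_associativity c d e f g

variable (V) in
theorem selfData_isCoherent : (selfData V).IsCoherent :=
  isCoherent_of_cells (selfData V) (fun c d e => self_identity (V := V) c d e)
    fun c d e f g => self_associativity (V := V) c d e f g

end SelfCoherence

/-! ### Kelly's derivation of the left unit law for a composite -/

section Kelly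

open GrayMonoid

variable {V : Type u} [Bicategory.{w, v} V] [Bicategory.Strict V] [GrayMonoid V]

variable {C : EnrichedBicategoryData.{w, v, u, u₁} V}

/-- Tensoring with `C(y, y)` and composing is faithful. -/
theorem lT_comp_faithful {a y : C.Obj} {X : V} {f g : X ⟶ C.hom a y} {φ ψ : f ⟶ g}
    (h : lt₂ (C.hom y y) (c₂ φ) ⋊ c₁ (C.m a y y) = lt₂ (C.hom y y) (c₂ ψ) ⋊ c₁ (C.m a y y)) :
    c₂ φ = c₂ ψ := by
  have n := fun χ : f ⟶ g => congrArg (· ⋊ c₁ (C.m a y y)) (sigInv_naturality_right (C.u y) χ)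
  have s := fun χ : f ⟶ g => slice_swap 1 1 1 (c₂ χ) (c₂ (C.lam a y).hom)
  -- Restricting along `u ⊗ X` and using naturality of the interchanger replaces `C(y, y) ⊗ φ` by `I
  -- ⊗ φ = φ`; the left unitor then removes `u` and `m`.
  have h' := congrArg (fun t => rt₁ (c₁ (C.u y)) X ⋉ t * sigInv (c₁ (C.u y)) (c₁ g) ⋊
    c₁ (C.m a y y)) h
  simp (maxDischargeDepth := 6) at n s h'
  rw [n, n] at h'
  have e := slice_cancel_left 1 (c₁ (C.m a y y)) (inter (C.u y) f).symm
    (x := c₂ φ ⋊ (rt₁ (c₁ (C.u y)) (C.hom a y) * c₁ (C.m a y y)))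
    (y := c₂ ψ ⋊ (rt₁ (c₁ (C.u y)) (C.hom a y) * c₁ (C.m a y y)))
    (by simp) (by simp) (by simpa using h')
  refine slice_cancel_left (c₁ f) 1 (C.lam a y) (by simp) (by simp) ?_
  simp
  rw [← s, ← s, e]

theorem lT_comp_faithful_cell {a y : C.Obj} {x z : Cell₂ V} (hd : dom₁ x = dom₁ z)
    (hc : cod₁ x = cod₁ z) (ht : tgt₂ x = some (C.hom a y))
    (h : lt₂ (C.hom y y) x ⋊ c₁ (C.m a y y) = lt₂ (C.hom y y) z ⋊ c₁ (C.m a y y)) : x = z := by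
  induction x using Cell₂.cases' with
  | h0 => cases ht
  | hm φ =>
  cases ht
  induction z using Cell₂.cases' with
  | h0 => cases hd
  | hm ψ =>
  obtain ⟨rfl, rfl, hf⟩ := c₁_eq_iff.1 hd
  obtain rfl := eq_of_heq hf
  obtain rfl := eq_of_heq (c₁_eq_iff.1 hc).2.2
  exact lT_comp_faithful h

/-- The left unitor of a composite is determined by the left unitor of the last factor. -/
theorem EnrichedBicategoryData.IsCoherent.cell_lam_comp (h : C.IsCoherent) (a x y : C.Obj) :
    rt₁ (c₁ (C.u y)) (C.hom x y ⊠ C.hom a x) ⋉ c₂ (C.assoc a x y y).hom *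
        (sigInv (c₁ (C.u y)) (c₁ (C.m a x y)) ⋊ c₁ (C.m a y y) *
          c₁ (C.m a x y) ⋉ c₂ (C.lam a y).hom) =
      rt₂ (c₂ (C.lam x y).hom) (C.hom a x) ⋊ c₁ (C.m a x y) := by
  refine lT_comp_faithful_cell (a := a) (y := y) (by simp (maxDischargeDepth := 6))
    (by simp (maxDischargeDepth := 6)) (by simp (maxDischargeDepth := 6)) ?_
  -- The two associators put in front complete one leg of the pentagon for `a, x, y, y, y`,
  -- restricted along the unit `u y` in the second factor. The triangles for `x, y, y` and `a, y, y`
  -- turn both legs into the same right unitor.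
  refine slice_cancel_left (lt₁ (C.hom y y) (rt₁ (c₁ (C.u y)) (C.hom x y ⊠ C.hom a x) *
    rt₁ (c₁ (C.m x y y)) (C.hom a x))) 1 (C.assoc a x y y) (by simp (maxDischargeDepth := 6))
      (by simp (maxDischargeDepth := 6)) ?_
  refine slice_cancel_left (lt₁ (C.hom y y) (rt₁ (c₁ (C.u y)) (C.hom x y ⊠ C.hom a x)))
    (c₁ (C.m a x y)) (rTIso (C.assoc x y y y) (C.hom a x))
    (by simp (maxDischargeDepth := 6)) (by simp (maxDischargeDepth := 6)) ?_
  have p := fun z => congrArg (fun t => lt₁ (C.hom y y) (rt₁ (c₁ (C.u y))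
    (C.hom x y ⊠ C.hom a x)) ⋉ t * z)
    (h.cell_associativity a x y y y)
  have t₁ := fun z => congrArg (fun t => rt₂ t (C.hom a x) ⋊ c₁ (C.m a x y) * z)
    (h.cell_identity x y y)
  have t₂ := congrArg (fun t => lt₁ (C.hom y y) (c₁ (C.m a x y)) ⋉ t) (h.cell_identity a y y)
  have s₁ := slice_swap 1 1 1 (lt₂ (C.hom y y) (rt₂ (c₂ (C.lam x y).hom) (C.hom a x)))
    (c₂ (C.assoc a x y y).hom)
  have s₂ := fun z => slice_swap' 1 1 1 (sigInv (lt₁ (C.hom y y) (c₁ (C.u y))) (c₁ (C.m a x y)))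
    (c₂ (C.assoc a y y y).hom) z
  have s₃ := slice_swap 1 1 1 (rt₂ (c₂ (C.rho y y).hom) (C.hom x y ⊠ C.hom a x))
    (c₂ (C.assoc a x y y).hom)
  have n := congrArg (fun t => t ⋊ c₁ (C.m a y y))
    (sigInv_naturality_left (C.rho y y).hom (C.m a x y))
  simp (maxDischargeDepth := 6) [sigInv_mul_left, c₁_run, sigInv_eqToHom_left, mul_idc]
    at p t₁ t₂ s₁ s₂ s₃ n ⊢
  rw [p, ← s₂, t₂, ← n, ← s₃, ← s₁, t₁]

end Kelly

/-! ### The axioms of a `V`-pseudofunctor for untyped cells -/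

section Pseudofunctor

open GrayMonoid

variable {V : Type u} [Bicategory.{w, v} V] [Bicategory.Strict V] [GrayMonoid V]

theorem sigInv_eqToHom_right {A A' B B' : V} (f : A ⟶ A') (h : B = B') :
    sigInv (c₁ f) (c₁ (eqToHom h)) = idc (c₁ (f ▹ B)) := by
  subst h
  have e : (inter f (𝟙 B)).inv = eqToHom (by
      rw [lT_id, lT_id, Bicategory.Strict.comp_id, Bicategory.Strict.id_comp]) := by
    rw [← cancel_epi (inter f (𝟙 B)).hom, Iso.hom_inv_id, inter_id_right, eqToHom_trans,
      eqToHom_refl]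
  refine (congrArg c₂ e).trans ?_
  rw [c₂_eqToHom, lT_id, Strict.comp_id]

/-- A `V`-pseudofunctor from its axioms stated for untyped cells. -/
def pseudofunctorOfCells (C : EnrichedBicategory.{w, v, u, u₁} V)
    (D : EnrichedBicategory.{w, v, u, u₂} V)
    (F : EnrichedPseudofunctorData C.toEnrichedBicategoryData D.toEnrichedBicategoryData)
    (h₁ : ∀ a b c d : C.Obj,
      (rt₁ (c₁ (F.map c d)) (C.hom b c ⊠ C.hom a b) *
          (lt₁ (D.hom (F.obj c) (F.obj d)) (rt₁ (c₁ (F.map b c)) (C.hom a b)) *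
            lt₁ (D.hom (F.obj c) (F.obj d) ⊠ D.hom (F.obj b) (F.obj c)) (c₁ (F.map a b)))) ⋉
        c₂ (D.assoc (F.obj a) (F.obj b) (F.obj c) (F.obj d)).hom *
      (rt₁ (c₁ (F.map c d)) (C.hom b c ⊠ C.hom a b) ⋉
          lt₂ (D.hom (F.obj c) (F.obj d)) (c₂ (F.mapComp a b c).hom) ⋊
            c₁ (D.m (F.obj a) (F.obj c) (F.obj d)) *
        (sigInv (c₁ (F.map c d)) (c₁ (C.m a b c)) ⋊
            (lt₁ (D.hom (F.obj c) (F.obj d)) (c₁ (F.map a c)) *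
              c₁ (D.m (F.obj a) (F.obj c) (F.obj d))) *
          lt₁ (C.hom c d) (c₁ (C.m a b c)) ⋉ c₂ (F.mapComp a c d).hom)) =
      (rt₁ (c₁ (F.map c d)) (C.hom b c ⊠ C.hom a b) *
          lt₁ (D.hom (F.obj c) (F.obj d)) (rt₁ (c₁ (F.map b c)) (C.hom a b))) ⋉
        sig (c₁ (D.m (F.obj b) (F.obj c) (F.obj d))) (c₁ (F.map a b)) ⋊
          c₁ (D.m (F.obj a) (F.obj b) (F.obj d)) *
      (rt₂ (c₂ (F.mapComp b c d).hom) (C.hom a b) ⋊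
          (lt₁ (D.hom (F.obj b) (F.obj d)) (c₁ (F.map a b)) *
            c₁ (D.m (F.obj a) (F.obj b) (F.obj d))) *
        (rt₁ (c₁ (C.m b c d)) (C.hom a b) ⋉ c₂ (F.mapComp a b d).hom *
          c₂ (C.assoc a b c d).hom ⋊ c₁ (F.map a d))))
    (h₂ : ∀ a b : C.Obj,
      c₁ (F.map a b) ⋉ rt₂ (c₂ (F.mapUnit b).hom) (D.hom (F.obj a) (F.obj b)) ⋊
          c₁ (D.m (F.obj a) (F.obj b) (F.obj b)) *
        (sig (c₁ (C.u b) * c₁ (F.map b b)) (c₁ (F.map a b)) ⋊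
            c₁ (D.m (F.obj a) (F.obj b) (F.obj b)) *
          (rt₁ (c₁ (C.u b)) (C.hom a b) ⋉ c₂ (F.mapComp a b b).hom *
            c₂ (C.lam a b).hom ⋊ c₁ (F.map a b))) =
      c₁ (F.map a b) ⋉ c₂ (D.lam (F.obj a) (F.obj b)).hom)
    (h₃ : ∀ a b : C.Obj,
      c₁ (F.map a b) ⋉ lt₂ (D.hom (F.obj a) (F.obj b)) (c₂ (F.mapUnit a).hom) ⋊
          c₁ (D.m (F.obj a) (F.obj a) (F.obj b)) *
        (sigInv (c₁ (F.map a b)) (c₁ (C.u a)) ⋊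
            (lt₁ (D.hom (F.obj a) (F.obj b)) (c₁ (F.map a a)) *
              c₁ (D.m (F.obj a) (F.obj a) (F.obj b))) *
          (lt₁ (C.hom a b) (c₁ (C.u a)) ⋉ c₂ (F.mapComp a a b).hom *
            c₂ (C.rho a b).hom ⋊ c₁ (F.map a b))) =
      c₁ (F.map a b) ⋉ c₂ (D.rho (F.obj a) (F.obj b)).hom) :
    EnrichedPseudofunctor C D where
  toEnrichedPseudofunctorData := F
  map_assoc a b c d := c₂_injective (by simpa using h₁ a b c d)
  map_lam a b := c₂_injective (by simpa using h₂ a b)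
  map_rho a b := c₂_injective (by simpa using h₃ a b)

end Pseudofunctor

/-! ### The axioms of `C(a, -)` after evaluation -/

section Hom

open GrayMonoid

variable {V : Type u} [Bicategory.{w, v} V] [Bicategory.Strict V] [GrayMonoid V] [RightClosed V]

variable {C : EnrichedBicategoryData.{w, v, u, u₁} V}

/-- Evaluation turns this into the triangle of `C` for `a, x, y`: the right unitor of `C` comes from
the axiom, the left unitor and the associator from evaluating `homUnit` and `homComp`. -/
theorem ev_homData_rho (hC : C.IsCoherent) (a x y : C.Obj) :
    rt₂ (c₁ (homMap C a x y) ⋉ lt₂ (inn (C.hom a x) (C.hom a y)) (c₂ (homUnit C a x).hom) ⋊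
          c₁ (selfComp (C.hom a x) (C.hom a x) (C.hom a y)) *
        (sigInv (c₁ (homMap C a x y)) (c₁ (C.u x)) ⋊
            (lt₁ (inn (C.hom a x) (C.hom a y)) (c₁ (homMap C a x x)) *
              c₁ (selfComp (C.hom a x) (C.hom a x) (C.hom a y))) *
          (lt₁ (C.hom x y) (c₁ (C.u x)) ⋉ c₂ (homComp C a x x y).hom *
            c₂ (C.rho x y).hom ⋊ c₁ (homMap C a x y)))) (C.hom a x) ⋊
        c₁ (counitCell (C.hom a x) (C.hom a y)) =
      rt₂ (c₁ (homMap C a x y) ⋉ c₂ (selfRho (C.hom a x) (C.hom a y)).hom) (C.hom a x) ⋊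
        c₁ (counitCell (C.hom a x) (C.hom a y)) := by
  refine slice_cancel_right 1 1 (evHom C a x y) (by simp (maxDischargeDepth := 6))
    (by simp (maxDischargeDepth := 6)) ?_
  have k := fun z => congrArg (fun t => lt₁ (C.hom x y) (rt₁ (c₁ (C.u x)) (C.hom a x)) ⋉ t * z)
    (c₂_ev_homComp C a x x y)
  have i := fun z => congrArg (fun t => rt₁ (c₁ (homMap C a x y)) (C.hom a x) ⋉
    lt₂ (inn (C.hom a x) (C.hom a y)) t ⋊ c₁ (counitCell (C.hom a x) (C.hom a y)) * z)
      (c₂_ev_homUnit C a x)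
  have r := fun z => congrArg (fun t => rt₁ (c₁ (homMap C a x y)) (C.hom a x) ⋉ t * z)
    (c₂_ev_selfRho (C.hom a x) (C.hom a y))
  have s₁ := slice_swap 1 1 1 (rt₂ (c₂ (C.rho x y).hom) (C.hom a x)) (c₂ (evHom C a x y).hom)
  have s₂ := slice_swap 1 1 1 (lt₂ (C.hom x y) (c₂ (C.lam a x).hom)) (c₂ (evHom C a x y).hom)
  have s₃ := fun z => slice_swap' 1 1 1
    (rt₁ (c₁ (homMap C a x y)) (C.hom a x) ⋉
      lt₂ (inn (C.hom a x) (C.hom a y)) (rt₂ (c₂ (homUnit C a x).hom) (C.hom a x)))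
    (c₂ (evComp (C.hom a x) (C.hom a x) (C.hom a y)).hom) z
  have s₄ := fun z => slice_swap' 1 1 1
    (sigInv (c₁ (homMap C a x y)) (rt₁ (c₁ (C.u x)) (C.hom a x)))
    (lt₁ (inn (C.hom a x) (C.hom a y)) (rt₁ (c₁ (homMap C a x x)) (C.hom a x)) ⋉
      c₂ (evComp (C.hom a x) (C.hom a x) (C.hom a y)).hom) z
  have s₅ := fun z => slice_swap' 1 1 (c₁ (counitCell (C.hom a x) (C.hom a y)))
    (sigInv (c₁ (homMap C a x y)) (rt₁ (c₁ (C.u x)) (C.hom a x)))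
    (lt₂ (inn (C.hom a x) (C.hom a y)) (c₂ (evHom C a x x).hom)) z
  have n := fun z => congrArg (fun t => t ⋊ c₁ (counitCell (C.hom a x) (C.hom a y)) * z)
    (sigInv_naturality_right (homMap C a x y) (C.lam a x).hom)
  simp (maxDischargeDepth := 6) [sigInv_mul_right, c₁_lun, sigInv_eqToHom_right, mul_idc]
    at k i r s₁ s₂ s₃ s₄ s₅ n ⊢
  rw [s₁, ← hC.cell_identity, k, ← s₂, s₄, s₃, r, s₅, ← n, i]

/-- Here evaluation produces the left unit law of the composite `m : C(x, y) ⊗ C(a, x) ⟶ C(a, y)`.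
The interchanger of the axiom stands inverted on the other side, where naturality applies to it
directly. -/
theorem ev_homData_lam (hC : C.IsCoherent) (a x y : C.Obj) :
    rt₂ (rt₂ (c₂ (homUnit C a y).hom) (C.hom x y) ⋊
          (lt₁ (inn (C.hom a y) (C.hom a y)) (c₁ (homMap C a x y)) *
            c₁ (selfComp (C.hom a x) (C.hom a y) (C.hom a y))) *
        (rt₁ (c₁ (C.u y)) (C.hom x y) ⋉ c₂ (homComp C a x y y).hom *
          c₂ (C.lam x y).hom ⋊ c₁ (homMap C a x y))) (C.hom a x) ⋊
        c₁ (counitCell (C.hom a x) (C.hom a y)) =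
      rt₂ (sigInv (c₁ (selfUnit (C.hom a y))) (c₁ (homMap C a x y)) ⋊
          c₁ (selfComp (C.hom a x) (C.hom a y) (C.hom a y)) *
        c₁ (homMap C a x y) ⋉ c₂ (selfLam (C.hom a x) (C.hom a y)).hom) (C.hom a x) ⋊
        c₁ (counitCell (C.hom a x) (C.hom a y)) := by
  refine slice_cancel_right 1 1 (evHom C a x y) (by simp (maxDischargeDepth := 6))
    (by simp (maxDischargeDepth := 6)) ?_
  have k := fun z => congrArg (fun t => rt₁ (c₁ (C.u y)) (C.hom x y ⊠ C.hom a x) ⋉ t * z)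
    (c₂_ev_homComp C a x y y)
  have i := congrArg (c₁ (C.m a x y) ⋉ ·) (c₂_ev_homUnit C a y)
  have l := fun z => congrArg (fun t => rt₁ (c₁ (homMap C a x y)) (C.hom a x) ⋉ t * z)
    (c₂_ev_selfLam (C.hom a x) (C.hom a y))
  -- left-hand side
  have s₁ := slice_swap 1 1 1 (rt₂ (c₂ (C.lam x y).hom) (C.hom a x)) (c₂ (evHom C a x y).hom)
  have s₂ := fun z => slice_swap' 1 1 1 (sigInv (c₁ (C.u y)) (c₁ (C.m a x y)))
    (c₂ (evHom C a y y).hom) z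
  have s₃ := fun z => slice_swap' 1 1 1 (rt₂ (c₂ (homUnit C a y).hom) (C.hom x y ⊠ C.hom a x))
    (lt₁ (inn (C.hom a y) (C.hom a y)) (rt₁ (c₁ (homMap C a x y)) (C.hom a x)) ⋉
      c₂ (evComp (C.hom a x) (C.hom a y) (C.hom a y)).hom) z
  have s₄ := fun z => slice_swap' 1 1 (c₁ (counitCell (C.hom a y) (C.hom a y)))
    (rt₂ (c₂ (homUnit C a y).hom) (C.hom x y ⊠ C.hom a x))
    (lt₂ (inn (C.hom a y) (C.hom a y)) (c₂ (evHom C a x y).hom)) z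
  have n₁ := fun z => congrArg (fun t => t ⋊ c₁ (counitCell (C.hom a y) (C.hom a y)) * z)
    (sigInv_naturality_left (homUnit C a y).hom (C.m a x y))
  -- right-hand side
  have s₅ := fun z => slice_swap' 1 1 1
    (sigInv (c₁ (selfUnit (C.hom a y))) (rt₁ (c₁ (homMap C a x y)) (C.hom a x)))
    (c₂ (evComp (C.hom a x) (C.hom a y) (C.hom a y)).hom) z
  have s₆ := slice_swap 1 1 1 (c₂ (evHom C a x y).hom) (c₂ (evUnit (C.hom a y)).hom)
  have n₂ := fun z => congrArg (fun t => t ⋊ c₁ (counitCell (C.hom a y) (C.hom a y)) * z)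
    (sigInv_naturality_right (selfUnit (C.hom a y)) (evHom C a x y).hom)
  simp (maxDischargeDepth := 6) [sigInv_mul_left, sigInv_mul_right]
    at k i l s₁ s₂ s₃ s₄ s₅ s₆ n₁ n₂ ⊢
  rw [s₁, ← hC.cell_lam_comp, k, ← s₂, s₃, s₄, n₁, i, l, s₅, ← s₆, ← n₂]

/-- Evaluation produces the pentagon of `C` for `a, x, y, z, w`: one associator is already present,
and evaluating each of the four compositors contributes another. -/
theorem ev_homData_assoc (hC : C.IsCoherent) (a x y z w : C.Obj) :
    rt₂ ((rt₁ (c₁ (homMap C a z w)) (C.hom y z ⊠ C.hom x y) *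
          lt₁ (inn (C.hom a z) (C.hom a w)) (rt₁ (c₁ (homMap C a y z)) (C.hom x y))) ⋉
        sigInv (c₁ (selfComp (C.hom a y) (C.hom a z) (C.hom a w))) (c₁ (homMap C a x y)) ⋊
          c₁ (selfComp (C.hom a x) (C.hom a y) (C.hom a w)) *
      ((rt₁ (c₁ (homMap C a z w)) (C.hom y z ⊠ C.hom x y) *
          (lt₁ (inn (C.hom a z) (C.hom a w)) (rt₁ (c₁ (homMap C a y z)) (C.hom x y)) *
            lt₁ (inn (C.hom a z) (C.hom a w) ⊠ inn (C.hom a y) (C.hom a z))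
              (c₁ (homMap C a x y)))) ⋉
        c₂ (selfAssoc (C.hom a x) (C.hom a y) (C.hom a z) (C.hom a w)).hom *
      (rt₁ (c₁ (homMap C a z w)) (C.hom y z ⊠ C.hom x y) ⋉
          lt₂ (inn (C.hom a z) (C.hom a w)) (c₂ (homComp C a x y z).hom) ⋊
            c₁ (selfComp (C.hom a x) (C.hom a z) (C.hom a w)) *
        (sigInv (c₁ (homMap C a z w)) (c₁ (C.m x y z)) ⋊
            (lt₁ (inn (C.hom a z) (C.hom a w)) (c₁ (homMap C a x z)) *
              c₁ (selfComp (C.hom a x) (C.hom a z) (C.hom a w))) *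
          lt₁ (C.hom z w) (c₁ (C.m x y z)) ⋉ c₂ (homComp C a x z w).hom)))) (C.hom a x) ⋊
        c₁ (counitCell (C.hom a x) (C.hom a w)) =
      rt₂ (rt₂ (c₂ (homComp C a y z w).hom) (C.hom x y) ⋊
          (lt₁ (inn (C.hom a y) (C.hom a w)) (c₁ (homMap C a x y)) *
            c₁ (selfComp (C.hom a x) (C.hom a y) (C.hom a w))) *
        (rt₁ (c₁ (C.m y z w)) (C.hom x y) ⋉ c₂ (homComp C a x y w).hom *
          c₂ (C.assoc x y z w).hom ⋊ c₁ (homMap C a x w))) (C.hom a x) ⋊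
        c₁ (counitCell (C.hom a x) (C.hom a w)) := by
  -- The evaluation cell prepares the last compositor, and the two associators appended next
  -- complete one leg of the pentagon.
  refine slice_cancel_right (lt₁ (C.hom z w) (rt₁ (c₁ (C.m x y z)) (C.hom a x)) *
    rt₁ (c₁ (C.m x z w)) (C.hom a x)) 1 (evHom C a x w) (by simp (maxDischargeDepth := 6))
    (by simp (maxDischargeDepth := 6)) ?_
  refine slice_cancel_right (lt₁ (C.hom z w) (rt₁ (c₁ (C.m x y z)) (C.hom a x))) 1
    (C.assoc a x z w) (by simp (maxDischargeDepth := 6)) (by simp (maxDischargeDepth := 6)) ?_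
  refine slice_cancel_right 1 (c₁ (C.m a z w)) (lTIso (C.hom z w) (C.assoc a x y z))
    (by simp (maxDischargeDepth := 6)) (by simp (maxDischargeDepth := 6)) ?_
  -- right-hand side
  have s₁ := fun t => slice_swap' 1 1 1 (rt₂ (c₂ (C.assoc x y z w).hom) (C.hom a x))
    (c₂ (evHom C a x w).hom) t
  have p := hC.cell_associativity a x y z w
  have k₁ := fun t' => congrArg (fun t => rt₁ (c₁ (C.m y z w)) (C.hom x y ⊠ C.hom a x) ⋉ t * t')
    (c₂_ev_homComp C a x y w)
  have s₂ := fun t => slice_swap' 1 1 1 (rt₂ (c₂ (homComp C a y z w).hom) (C.hom x y ⊠ C.hom a x))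
    (lt₁ (inn (C.hom a y) (C.hom a w)) (rt₁ (c₁ (homMap C a x y)) (C.hom a x)) ⋉
      c₂ (evComp (C.hom a x) (C.hom a y) (C.hom a w)).hom) t
  have s₃ := fun t => slice_swap' 1 1 (c₁ (counitCell (C.hom a y) (C.hom a w)))
    (rt₂ (c₂ (homComp C a y z w).hom) (C.hom x y ⊠ C.hom a x))
    (lt₂ (inn (C.hom a y) (C.hom a w)) (c₂ (evHom C a x y).hom)) t
  have s₄ := fun t => slice_swap' 1 1 1 (sigInv (c₁ (C.m y z w)) (c₁ (C.m a x y)))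
    (c₂ (evHom C a y w).hom) t
  have n₁ := fun t' => congrArg (fun t => t ⋊ c₁ (counitCell (C.hom a y) (C.hom a w)) * t')
    (sigInv_naturality_left (homComp C a y z w).hom (C.m a x y))
  have k₂ := congrArg (lt₁ (C.hom z w ⊠ C.hom y z) (c₁ (C.m a x y)) ⋉ ·)
    (c₂_ev_homComp C a y z w)
  -- left-hand side
  have k₃ := fun t' => congrArg (fun t => lt₁ (C.hom z w) (rt₁ (c₁ (C.m x y z))
    (C.hom a x)) ⋉ t * t')
    (c₂_ev_homComp C a x z w)
  have s₅ := slice_swap 1 1 1 (lt₂ (C.hom z w) (c₂ (C.assoc a x y z).hom))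
    (c₂ (evHom C a z w).hom)
  have s₆ := fun t => slice_swap' 1 1 1
    (sigInv (c₁ (homMap C a z w)) (rt₁ (c₁ (C.m x y z)) (C.hom a x)))
    (lt₁ (inn (C.hom a z) (C.hom a w)) (rt₁ (c₁ (homMap C a x z)) (C.hom a x)) ⋉
      c₂ (evComp (C.hom a x) (C.hom a z) (C.hom a w)).hom) t
  have s₇ := fun t => slice_swap' (rt₁ (c₁ (homMap C a z w))
    (C.hom y z ⊠ C.hom x y ⊠ C.hom a x)) 1 1
    (lt₂ (inn (C.hom a z) (C.hom a w)) (rt₂ (c₂ (homComp C a x y z).hom) (C.hom a x)))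
    (c₂ (evComp (C.hom a x) (C.hom a z) (C.hom a w)).hom) t
  have s₈ := fun t => slice_swap' 1 1 (c₁ (counitCell (C.hom a z) (C.hom a w)))
    (sigInv (c₁ (homMap C a z w)) (rt₁ (c₁ (C.m x y z)) (C.hom a x)))
    (lt₂ (inn (C.hom a z) (C.hom a w)) (c₂ (evHom C a x z).hom)) t
  have n₂ := fun t' => congrArg (fun t => t ⋊ c₁ (counitCell (C.hom a z) (C.hom a w)) * t')
    (sigInv_naturality_right (homMap C a z w) (C.assoc a x y z).hom)
  have k₄ := fun t' => congrArg (fun t => rt₁ (c₁ (homMap C a z w))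
    (C.hom y z ⊠ C.hom x y ⊠ C.hom a x) ⋉
      lt₂ (inn (C.hom a z) (C.hom a w)) t ⋊ c₁ (counitCell (C.hom a z) (C.hom a w)) * t')
    (c₂_ev_homComp C a x y z)
  have k₅ := fun t' => congrArg (fun t => (rt₁ (c₁ (homMap C a z w))
    (C.hom y z ⊠ C.hom x y ⊠ C.hom a x) *
      (lt₁ (inn (C.hom a z) (C.hom a w)) (rt₁ (c₁ (homMap C a y z)) (C.hom x y ⊠ C.hom a x)) *
        lt₁ (inn (C.hom a z) (C.hom a w) ⊠ inn (C.hom a y) (C.hom a z))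
          (rt₁ (c₁ (homMap C a x y)) (C.hom a x)))) ⋉ t * t')
    (c₂_ev_selfAssoc (C.hom a x) (C.hom a y) (C.hom a z) (C.hom a w))
  have s₉ := fun t => slice_swap' (rt₁ (c₁ (homMap C a z w)) (C.hom y z ⊠ C.hom x y ⊠ C.hom a x) *
      lt₁ (inn (C.hom a z) (C.hom a w)) (rt₁ (c₁ (homMap C a y z)) (C.hom x y ⊠ C.hom a x))) 1 1
    (sigInv (c₁ (selfComp (C.hom a y) (C.hom a z) (C.hom a w)))
      (rt₁ (c₁ (homMap C a x y)) (C.hom a x)))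
    (c₂ (evComp (C.hom a x) (C.hom a y) (C.hom a w)).hom) t
  have s₁₀ := fun t => slice_swap' (rt₁ (c₁ (homMap C a z w)) (C.hom y z ⊠ C.hom x y ⊠ C.hom a x) *
      lt₁ (inn (C.hom a z) (C.hom a w)) (rt₁ (c₁ (homMap C a y z)) (C.hom x y ⊠ C.hom a x))) 1 1
    (lt₂ (inn (C.hom a z) (C.hom a w) ⊠ inn (C.hom a y) (C.hom a z)) (c₂ (evHom C a x y).hom))
    (c₂ (evComp (C.hom a y) (C.hom a z) (C.hom a w)).hom) t
  have n₃ := fun t' => congrArg (fun t => (rt₁ (c₁ (homMap C a z w))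
    (C.hom y z ⊠ C.hom x y ⊠ C.hom a x) *
      lt₁ (inn (C.hom a z) (C.hom a w)) (rt₁ (c₁ (homMap C a y z)) (C.hom x y ⊠ C.hom a x))) ⋉ t ⋊
        c₁ (counitCell (C.hom a y) (C.hom a w)) * t')
    (sigInv_naturality_right (selfComp (C.hom a y) (C.hom a z) (C.hom a w)) (evHom C a x y).hom)
  have s₁₁ := fun t => slice_swap' (rt₁ (c₁ (homMap C a z w))
    (C.hom y z ⊠ C.hom x y ⊠ C.hom a x)) 1 1
    (sigInv (lt₁ (inn (C.hom a z) (C.hom a w)) (c₁ (homMap C a y z))) (c₁ (C.m a x y)))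
    (c₂ (evComp (C.hom a y) (C.hom a z) (C.hom a w)).hom) t
  have s₁₂ := fun t => slice_swap' 1 1 (c₁ (counitCell (C.hom a z) (C.hom a w)))
    (sigInv (c₁ (homMap C a z w)) (lt₁ (C.hom y z) (c₁ (C.m a x y))))
    (lt₂ (inn (C.hom a z) (C.hom a w)) (c₂ (evHom C a y z).hom)) t
  have s₁₃ := fun t => slice_swap' 1 1 1
    (sigInv (c₁ (homMap C a z w)) (lt₁ (C.hom y z) (c₁ (C.m a x y))))
    (lt₁ (inn (C.hom a z) (C.hom a w)) (rt₁ (c₁ (homMap C a y z)) (C.hom a y)) ⋉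
      c₂ (evComp (C.hom a y) (C.hom a z) (C.hom a w)).hom) t
  simp (maxDischargeDepth := 6) [sigInv_mul_left, sigInv_mul_right]
    at s₁ s₂ s₃ s₄ s₅ s₆ s₇ s₈ s₉ s₁₀ s₁₁ s₁₂ s₁₃ k₁ k₂ k₃ k₄ k₅ n₁ n₂ n₃ ⊢
  rw [s₁, p, k₁, s₂, s₃, ← s₄, n₁, k₂]
  rw [k₃, ← s₅, s₆, s₇, s₈, ← n₂, k₄, k₅]
  rw [s₉, ← s₁₀, ← n₃, ← s₁₁, ← s₁₂, ← s₁₃]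

end Hom

/-! ### The axioms of `C(a, -)` with evaluation removed -/

section HomAxioms

open GrayMonoid

variable {V : Type u} [Bicategory.{w, v} V] [Bicategory.Strict V] [GrayMonoid V]

theorem sigInv_slice_sig {A A' B B' : V} (f : A ⟶ A') (g : B ⟶ B') (p q : Cell₁ V) (z : Cell₂ V)
    (hz : dom₁ z = p * (c₁ (f ▹ B) * (c₁ (A' ◃ g) * q))) :
    p ⋉ sigInv (c₁ f) (c₁ g) ⋊ q * (p ⋉ sig (c₁ f) (c₁ g) ⋊ q * z) = z :=
  slice_inv_hom_mul p q z (inter f g) (hz.trans (by simp))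

variable [RightClosed V]

variable {C : EnrichedBicategoryData.{w, v, u, u₁} V}

theorem homData_rho (hC : C.IsCoherent) (a x y : C.Obj) :
    c₁ (homMap C a x y) ⋉ lt₂ (inn (C.hom a x) (C.hom a y)) (c₂ (homUnit C a x).hom) ⋊
          c₁ (selfComp (C.hom a x) (C.hom a x) (C.hom a y)) *
        (sigInv (c₁ (homMap C a x y)) (c₁ (C.u x)) ⋊
            (lt₁ (inn (C.hom a x) (C.hom a y)) (c₁ (homMap C a x x)) *
              c₁ (selfComp (C.hom a x) (C.hom a x) (C.hom a y))) *
          (lt₁ (C.hom x y) (c₁ (C.u x)) ⋉ c₂ (homComp C a x x y).hom *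
            c₂ (C.rho x y).hom ⋊ c₁ (homMap C a x y))) =
      c₁ (homMap C a x y) ⋉ c₂ (selfRho (C.hom a x) (C.hom a y)).hom := by
  refine ev_injective_cell (A := C.hom a x) (Y := C.hom a y) (by simp (maxDischargeDepth := 6))
    (by simp (maxDischargeDepth := 6)) (by simp (maxDischargeDepth := 6)) ?_
  exact ev_homData_rho hC a x y

theorem homData_lam (hC : C.IsCoherent) (a x y : C.Obj) :
    c₁ (homMap C a x y) ⋉ rt₂ (c₂ (homUnit C a y).hom) (inn (C.hom a x) (C.hom a y)) ⋊
          c₁ (selfComp (C.hom a x) (C.hom a y) (C.hom a y)) *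
        (sig (c₁ (C.u y) * c₁ (homMap C a y y)) (c₁ (homMap C a x y)) ⋊
            c₁ (selfComp (C.hom a x) (C.hom a y) (C.hom a y)) *
          (rt₁ (c₁ (C.u y)) (C.hom x y) ⋉ c₂ (homComp C a x y y).hom *
            c₂ (C.lam x y).hom ⋊ c₁ (homMap C a x y))) =
      c₁ (homMap C a x y) ⋉ c₂ (selfLam (C.hom a x) (C.hom a y)).hom := by
  -- Prepending the inverse interchanger and moving the unitor through it makes it meet the forward
  -- interchanger of the axiom, and the two cancel. What remains is the equation verified after
  -- evaluation.
  refine slice_cancel_left 1 (c₁ (selfComp (C.hom a x) (C.hom a y) (C.hom a y)))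
    (inter (selfUnit (C.hom a y)) (homMap C a x y)).symm (by simp (maxDischargeDepth := 6))
    (by simp (maxDischargeDepth := 6)) ?_
  have n := fun z => congrArg (fun t => t ⋊ c₁ (selfComp (C.hom a x) (C.hom a y) (C.hom a y)) * z)
    (sigInv_naturality_left (homUnit C a y).hom (homMap C a x y))
  have i := fun z => sigInv_slice_sig (C.u y ≫ homMap C a y y) (homMap C a x y) 1
    (c₁ (selfComp (C.hom a x) (C.hom a y) (C.hom a y))) z
  refine (?_ : _ = rt₂ (c₂ (homUnit C a y).hom) (C.hom x y) ⋊
          (lt₁ (inn (C.hom a y) (C.hom a y)) (c₁ (homMap C a x y)) *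
            c₁ (selfComp (C.hom a x) (C.hom a y) (C.hom a y))) *
        (rt₁ (c₁ (C.u y)) (C.hom x y) ⋉ c₂ (homComp C a x y y).hom *
          c₂ (C.lam x y).hom ⋊ c₁ (homMap C a x y))).trans ?_
  · simp (maxDischargeDepth := 6) at n i ⊢
    rw [← n, i]
    simp (maxDischargeDepth := 6)
  · refine (ev_injective_cell (A := C.hom a x) (Y := C.hom a y) (by simp (maxDischargeDepth := 6))
      (by simp (maxDischargeDepth := 6)) (by simp (maxDischargeDepth := 6))
      (ev_homData_lam hC a x y)).trans (by simp)

theorem homData_assoc (hC : C.IsCoherent) (a x y z w : C.Obj) :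
    (rt₁ (c₁ (homMap C a z w)) (C.hom y z ⊠ C.hom x y) *
          (lt₁ (inn (C.hom a z) (C.hom a w)) (rt₁ (c₁ (homMap C a y z)) (C.hom x y)) *
            lt₁ (inn (C.hom a z) (C.hom a w) ⊠ inn (C.hom a y) (C.hom a z))
              (c₁ (homMap C a x y)))) ⋉
        c₂ (selfAssoc (C.hom a x) (C.hom a y) (C.hom a z) (C.hom a w)).hom *
      (rt₁ (c₁ (homMap C a z w)) (C.hom y z ⊠ C.hom x y) ⋉
          lt₂ (inn (C.hom a z) (C.hom a w)) (c₂ (homComp C a x y z).hom) ⋊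
            c₁ (selfComp (C.hom a x) (C.hom a z) (C.hom a w)) *
        (sigInv (c₁ (homMap C a z w)) (c₁ (C.m x y z)) ⋊
            (lt₁ (inn (C.hom a z) (C.hom a w)) (c₁ (homMap C a x z)) *
              c₁ (selfComp (C.hom a x) (C.hom a z) (C.hom a w))) *
          lt₁ (C.hom z w) (c₁ (C.m x y z)) ⋉ c₂ (homComp C a x z w).hom)) =
      (rt₁ (c₁ (homMap C a z w)) (C.hom y z ⊠ C.hom x y) *
          lt₁ (inn (C.hom a z) (C.hom a w)) (rt₁ (c₁ (homMap C a y z)) (C.hom x y))) ⋉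
        sig (c₁ (selfComp (C.hom a y) (C.hom a z) (C.hom a w))) (c₁ (homMap C a x y)) ⋊
          c₁ (selfComp (C.hom a x) (C.hom a y) (C.hom a w)) *
      (rt₂ (c₂ (homComp C a y z w).hom) (C.hom x y) ⋊
          (lt₁ (inn (C.hom a y) (C.hom a w)) (c₁ (homMap C a x y)) *
            c₁ (selfComp (C.hom a x) (C.hom a y) (C.hom a w))) *
        (rt₁ (c₁ (C.m y z w)) (C.hom x y) ⋉ c₂ (homComp C a x y w).hom *
          c₂ (C.assoc x y z w).hom ⋊ c₁ (homMap C a x w))) := by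
  -- The inverse interchanger cancels the forward one on the right and yields the form in which the
  -- axiom was evaluated.
  refine slice_cancel_left (rt₁ (c₁ (homMap C a z w)) (C.hom y z ⊠ C.hom x y) *
      lt₁ (inn (C.hom a z) (C.hom a w)) (rt₁ (c₁ (homMap C a y z)) (C.hom x y)))
    (c₁ (selfComp (C.hom a x) (C.hom a y) (C.hom a w)))
    (inter (selfComp (C.hom a y) (C.hom a z) (C.hom a w)) (homMap C a x y)).symm
    (by simp (maxDischargeDepth := 6)) (by simp (maxDischargeDepth := 6)) ?_
  have i := fun t => sigInv_slice_sig (selfComp (C.hom a y) (C.hom a z) (C.hom a w))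
    (homMap C a x y) (rt₁ (c₁ (homMap C a z w)) (C.hom y z ⊠ C.hom x y) *
      lt₁ (inn (C.hom a z) (C.hom a w)) (rt₁ (c₁ (homMap C a y z)) (C.hom x y)))
    (c₁ (selfComp (C.hom a x) (C.hom a y) (C.hom a w))) t
  have e := ev_injective_cell (A := C.hom a x) (Y := C.hom a w)
    (by simp (maxDischargeDepth := 6)) (by simp (maxDischargeDepth := 6))
    (by simp (maxDischargeDepth := 6)) (ev_homData_assoc hC a x y z w)
  refine (Eq.trans ?_ e).trans ?_
  · simp
  · rw [Iso.symm_hom, c₂_inter_inv, i]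
    simp (maxDischargeDepth := 6)

end HomAxioms

end GrayEnriched

theorem mainTheorem6 {V : Type u} [Bicategory.{w, v} V] [Bicategory.Strict V] [GrayMonoid V]
    [RightClosed V] (C : EnrichedBicategory.{w, v, u, u₁} V) (a : C.Obj) :
    ∃ hV : (selfData V).IsCoherent,
      ∃ F : EnrichedPseudofunctor C
          (EnrichedBicategory.mk (selfData V) hV : EnrichedBicategory.{w, v, u, u} V),
        F.toEnrichedPseudofunctorData = homData C.toEnrichedBicategoryData a :=
  ⟨selfData_isCoherent V,
    pseudofunctorOfCells C (EnrichedBicategory.mk (selfData V) (selfData_isCoherent V))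
      (homData C.toEnrichedBicategoryData a)
      (fun x y z t => homData_assoc C.coherent a x y z t)
      (fun x y => homData_lam C.coherent a x y)
      (fun x y => homData_rho C.coherent a x y), rfl⟩
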